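/- Let $V_{10}=E\oplus F$, with $E=\langle e_1,\dots,e_5\rangle$ and $F$ its dual, carry the natural quadratic form; let $\Delta_+=\wedge^{\mathrm{even}}E$ be the half-spin representation of $Spin_{10}$, $\langle\cdot,\cdot\rangle$ the invariant pairing of spinors, and $\gamma:S^2\Delta_+\to V_{10}$ the equivariant map $\gamma(\delta,\delta')=\sum_i\langle v_i\delta,\delta'\rangle w_i$ for dual bases $(v_i),(w_i)$ of $V_{10}$. Write $e_{ij\dots}=e_i\wedge e_j\wedge\cdots$. Let $\mathfrak c=\langle p_1,p_2,p_3,p_4\rangle\subset\mathbb C^4\otimes\Delta_+$ be the Cartan subspace with basis $$\begin{aligned}p_1&=a_1\otimes e_{53}+a_2\otimes e_{1245}+a_3\otimes e_{42}+a_4\otimes e_{31},\\ p_2&=a_1\otimes e_{52}+a_2\otimes e_{1345}+a_3\otimes e_{34}+a_4\otimes e_{12},\\ p_3&=a_1\otimes e_{1234}+a_2\otimes 1+a_3\otimes e_{1235}+a_4\otimes e_{54},\\ p_4&=a_1\otimes e_{14}+a_2\otimes e_{23}+a_3\otimes e_{51}+a_4\otimes e_{2345},\end{aligned}$$ where $a_1,\dots,a_4$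 is the standard basis of $\mathbb C^4$. Let $W_{\mathfrak c}$ be the little Weyl group, that is, the group of transformations of $\mathfrak c$ induced by the elements of $SL_4\times Spin_{10}$ preserving $\mathfrak c$; it is the complex reflection group $G_{31}$ of order $46080$, generated by the reflections whose matrices in the basis $p_1,\dots,p_4$ are $$\begin{pmatrix}-1&0&0&0\\0&1&0&0\\0&0&1&0\\0&0&0&1\end{pmatrix},\ \begin{pmatrix}0&-1&0&0\\-1&0&0&0\\0&0&1&0\\0&0&0&1\end{pmatrix},\ \begin{pmatrix}0&-i&0&0\\i&0&0&0\\0&0&1&0\\0&0&0&1\end{pmatrix},$$ $$\tfrac12\begin{pmatrix}1&-1&-1&-1\\-1&1&-1&-1\\-1&-1&1&-1\\-1&-1&-1&1\end{pmatrix},\ \tfrac12\begin{pmatrix}0&0&-1-i&-1+i\\0&2&0&0\\-1+i&0&1&i\\-1-i&0&-i&1\end{pmatrix}.$$ A point $a\in\mathfrak c$ defines a linear map $\mathbb C^4\to\Delta_+$, hence, by composition with $\delta\mapsto\gamma(\delta,\delta)$, a quadratic map $\gamma_a:\mathbb C^4\to V_{10}$. Let $\Theta(a)$ be the quadratic section of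 $G(2,4)$ given by $(x,y)\mapsto(\gamma_a(x),\gamma_a(y))$, a quadratic form in the Plücker coordinates of the line $\overline{xy}$. Let $U_5$ be the linear span of all $\Theta(a)$, $a\in\mathfrak c$. **Proposition.** The space $U_5$ has dimension five. The map $\Theta$ is given by quartic forms on $\mathfrak c$ without common zero, and it induces a finite morphism $\Theta:\mathbb P(\mathfrak c)\to\mathbb P(U_5)\simeq\mathbb P^4$. It is $W_{\mathfrak c}$-equivariant: there is a linear action of $W_{\mathfrak c}$ on $U_5$ such that $\Theta(w\cdot a)=w\cdot\Theta(a)$ for all $w\in W_{\mathfrak c}$ and $a\in\mathfrak c$. The morphism has degree $16$ onto its image. Its image is projectively isomorphic to the Castelnuovo–Richmond (Igusa) quartic $$CR_4=\Big\{\textstyle\sum_{i=0}^5t_i=0,\ \big(\sum_{i=0}^5 t_i^2\big)^2=4\sum_{i=0}^5 t_i^4\Big\}\subset\mathbb P^5.$$ The singular locus of $CR_4$ is the union of exactly $15$ lines, and the preimage in $\mathbb P(\mathfrak c)$ of the union of these $15$ lines is the union of exactly $30$ lines. -/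

import Mathlib

noncomputable section

namespace SpinorKummer

/-! ### The half-spin representations of `Spin₁₀`

`V₁₀ = E ⊕ F` with `E = ⟨e₁,…,e₅⟩`, `F = ⟨f₁,…,f₅⟩` the dual basis, and the spinors are the
exterior algebra of `E`.  All indices are shifted by one: `e₁` has index `0 : Fin 5`, and so on. -/

/-- `Δ₊ ⊕ Δ₋ = ∧E`, a spinor being given by its coefficients on the basis `e_I`
(`e_I` is the wedge product of the `e_i`, `i ∈ I`, in increasing order).
`Δ₊` is spanned by the `e_I` with `|I|` even. -/
abbrev Spinor : Type := Finset (Fin 5) → ℂ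

/-- `V₁₀ = E ⊕ F`; the pair `(u, v)` is the vector `∑ uᵢ eᵢ + ∑ vᵢ fᵢ`. -/
abbrev V10 : Type := (Fin 5 → ℂ) × (Fin 5 → ℂ)

/-- The quadratic form on `V₁₀`. -/
def quadForm (v : V10) : ℂ := ∑ i, v.1 i * v.2 i

/-- The polar bilinear form on `V₁₀`: `(eᵢ, fⱼ) = δᵢⱼ`, `E` and `F` isotropic. -/
def bilinForm (v w : V10) : ℂ := ∑ i, (v.1 i * w.2 i + v.2 i * w.1 i)

/-- The sign such that `eᵢ ∧ e_I = sign • e_{I ∪ {i}}` for `i ∉ I`. -/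
def insertSign (i : Fin 5) (I : Finset (Fin 5)) : ℂ := (-1) ^ (I.filter (· < i)).card

/-- `ψ ↦ eᵢ ∧ ψ`. -/
def wedge (i : Fin 5) (ψ : Spinor) : Spinor :=
  fun J => if i ∈ J then insertSign i J * ψ (J.erase i) else 0

/-- `ψ ↦ fᵢ ⌟ ψ`, contraction by `fᵢ`. -/
def contract (i : Fin 5) (ψ : Spinor) : Spinor :=
  fun J => if i ∈ J then 0 else insertSign i J * ψ (insert i J)

/-- The Clifford action of `V₁₀` on spinors: vectors of `E` act by wedge product, vectors of `F`
by contraction, so that `v · (v · ψ) = quadForm v • ψ`. -/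
def clifford (v : V10) (ψ : Spinor) : Spinor :=
  ∑ i, (v.1 i • wedge i ψ + v.2 i • contract i ψ)

/-- The sign such that `e_I ∧ e_{Iᶜ} = sign • e_{12345}`. -/
def shuffleSign (I : Finset (Fin 5)) : ℂ :=
  (-1) ^ ((I ×ˢ Iᶜ).filter fun p => p.2 < p.1).card

/-- The invariant pairing of spinors: the coefficient of `e_{12345}` in `ψᵗ ∧ φ`, where `ψ ↦ ψᵗ` is
the main anti-automorphism, `e_I ↦ (-1)^{|I|(|I|-1)/2} e_I`.
It is the duality between `Δ₊` and `Δ₋`. -/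
def pairing (ψ φ : Spinor) : ℂ :=
  ∑ I : Finset (Fin 5), (-1) ^ (I.card * (I.card - 1) / 2) * shuffleSign I * ψ I * φ Iᶜ

/-- The equivariant morphism `γ : S²Δ₊ → V₁₀`, `γ(ψ, φ) = ∑ ⟨vᵢ ψ, φ⟩ wᵢ` for dual bases
`(vᵢ)`, `(wᵢ)` of `V₁₀`. -/
def gamma (ψ φ : Spinor) : V10 :=
  (fun i => pairing (contract i ψ) φ, fun i => pairing (wedge i ψ) φ)

/-- The group `Spin₁₀`, in its faithful action on spinors: it is generated by the products `v · w` of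
two vectors with `q(v) = q(w) = 1`. -/
def spin10 : Subgroup (Spinor ≃ₗ[ℂ] Spinor) :=
  Subgroup.closure {h | ∃ v w : V10, quadForm v = 1 ∧ quadForm w = 1 ∧
    ∀ ψ, h ψ = clifford v (clifford w ψ)}

/-- The wedge product of a list of vectors `eᵢ`; for instance `e [4, 2]` is `e₅ ∧ e₃ = e₅₃`. -/
def e (l : List (Fin 5)) : Spinor := l.foldr wedge (Pi.single ∅ 1)

/-! ### The Cartan subspace and its reflection group -/

/-- The Cartan subspace `𝔠 ⊂ ℂ⁴ ⊗ Δ₊` has basis `p₁,…,p₄`, where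
`p_j = ∑ₖ aₖ ⊗ cartanSpinor j k` for the basis `a₁,…,a₄` of `ℂ⁴`. -/
def cartanSpinor : Fin 4 → Fin 4 → Spinor :=
  ![![e [4, 2], e [0, 1, 3, 4], e [3, 1], e [2, 0]],
    ![e [4, 1], e [0, 2, 3, 4], e [2, 3], e [0, 1]],
    ![e [0, 1, 2, 3], e [], e [0, 1, 2, 4], e [4, 3]],
    ![e [0, 3], e [1, 2], e [4, 0], e [1, 2, 3, 4]]]

/-- The point `a₁p₁ + a₂p₂ + a₃p₃ + a₄p₄` of the Cartan subspace.  A tensor `∑ₖ aₖ ⊗ tₖ` of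
`ℂ⁴ ⊗ Δ₊` is written `k ↦ tₖ`. -/
def cartan (a : Fin 4 → ℂ) : Fin 4 → Spinor := fun k => ∑ j, a j • cartanSpinor j k

/-- `p₁,…,p₄` are linearly independent, so that `cartan` identifies `ℂ⁴` with `𝔠`. -/
theorem cartan_injective : Function.Injective cartan := by
  intro a b h
  have h1 := congrFun (congrFun h 0) {2, 4}
  have h2 := congrFun (congrFun h 0) {1, 4}
  have h3 := congrFun (congrFun h 0) {0, 1, 2, 3}
  have h4 := congrFun (congrFun h 0) {0, 3}
  simp +decide [cartan, cartanSpinor, Fin.sum_univ_four, e, wedge, insertSign,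
    Pi.single_apply] at h1 h2 h3 h4
  funext i
  fin_cases i
  · exact h1
  · exact h2
  · exact h3
  · exact h4

/-- The action of `(g, h) ∈ SL₄ × Spin₁₀` on `ℂ⁴ ⊗ Δ`. -/
def tensorAct (g : Matrix (Fin 4) (Fin 4) ℂ) (h : Spinor ≃ₗ[ℂ] Spinor) (t : Fin 4 → Spinor) :
    Fin 4 → Spinor := fun k => ∑ l, g k l • h (t l)

theorem tensorAct_one (t : Fin 4 → Spinor) : tensorAct 1 1 t = t := by
  funext k
  simp [tensorAct, Matrix.one_apply]

theorem tensorAct_mul (g g' : Matrix (Fin 4) (Fin 4) ℂ) (h h' : Spinor ≃ₗ[ℂ] Spinor)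
    (t : Fin 4 → Spinor) :
    tensorAct (g * g') (h * h') t = tensorAct g h (tensorAct g' h' t) := by
  funext k
  simp only [tensorAct, map_sum, map_smul, Matrix.mul_apply, Finset.sum_smul, Finset.smul_sum,
    smul_smul, LinearEquiv.mul_apply]
  exact Finset.sum_comm

/-- The little Weyl group `W_𝔠`: the group of linear transformations of `𝔠` (written as matrices in
the basis `p₁,…,p₄`) induced by the elements of `SL₄ × Spin₁₀` that preserve `𝔠`. -/
def littleWeylGroup : Subgroup (GL (Fin 4) ℂ) where
  carrier := {w | ∃ g : Matrix.SpecialLinearGroup (Fin 4) ℂ, ∃ h ∈ spin10,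
    ∀ a, cartan ((w : Matrix (Fin 4) (Fin 4) ℂ).mulVec a) = tensorAct g.1 h (cartan a)}
  one_mem' := ⟨1, 1, spin10.one_mem, fun a => by simp [tensorAct_one]⟩
  mul_mem' := by
    rintro w w' ⟨g, h, hh, H⟩ ⟨g', h', hh', H'⟩
    refine ⟨g * g', h * h', spin10.mul_mem hh hh', fun a => ?_⟩
    rw [Units.val_mul, ← Matrix.mulVec_mulVec, H, H', Matrix.SpecialLinearGroup.coe_mul,
      tensorAct_mul]
  inv_mem' := by
    rintro w ⟨g, h, hh, H⟩
    refine ⟨g⁻¹, h⁻¹, spin10.inv_mem hh, fun a => ?_⟩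
    have key := H ((w⁻¹ : GL (Fin 4) ℂ).1.mulVec a)
    rw [Matrix.mulVec_mulVec, ← Units.val_mul, mul_inv_cancel, Units.val_one,
      Matrix.one_mulVec] at key
    rw [key, ← tensorAct_mul, ← Matrix.SpecialLinearGroup.coe_mul, inv_mul_cancel, inv_mul_cancel,
      Matrix.SpecialLinearGroup.coe_one, tensorAct_one]

/-- Matrices, in the basis `p₁,…,p₄`, of five reflections that generate `W_𝔠`
(the group `G₃₁` of Shephard and Todd, of order `46080`). -/
def reflectionMatrix : Fin 5 → Matrix (Fin 4) (Fin 4) ℂ :=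
  ![!![-1, 0, 0, 0; 0, 1, 0, 0; 0, 0, 1, 0; 0, 0, 0, 1],
    !![0, -1, 0, 0; -1, 0, 0, 0; 0, 0, 1, 0; 0, 0, 0, 1],
    !![0, -Complex.I, 0, 0; Complex.I, 0, 0, 0; 0, 0, 1, 0; 0, 0, 0, 1],
    (1 / 2 : ℂ) • !![1, -1, -1, -1; -1, 1, -1, -1; -1, -1, 1, -1; -1, -1, -1, 1],
    (1 / 2 : ℂ) • !![0, 0, -1 - Complex.I, -1 + Complex.I; 0, 2, 0, 0;
      -1 + Complex.I, 0, 1, Complex.I; -1 - Complex.I, 0, -Complex.I, 1]]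

theorem reflectionMatrix_sq (k : Fin 5) : reflectionMatrix k * reflectionMatrix k = 1 := by
  have hI : Complex.I ^ 2 = -1 := Complex.I_sq
  fin_cases k <;> ext i j <;> fin_cases i <;> fin_cases j <;>
    simp [reflectionMatrix, Matrix.mul_apply, Fin.sum_univ_four] <;>
    ring_nf <;> simp [hI] <;> norm_num

/-- The complex reflection group generated by the five reflections. -/
def reflectionGroup : Subgroup (GL (Fin 4) ℂ) :=
  Subgroup.closure (Set.range fun k => (⟨reflectionMatrix k, reflectionMatrix k,
    reflectionMatrix_sq k, reflectionMatrix_sq k⟩ : GL (Fin 4) ℂ))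

/-! ### The quadratic complexes `Θ(a)` -/

/-- A tensor in `ℂ⁴ ⊗ Δ₊`, seen as a linear map `ℂ⁴ → Δ₊`. -/
def toSpinor (t : Fin 4 → Spinor) (x : Fin 4 → ℂ) : Spinor := ∑ k, x k • t k

/-- The quadratic map `γ_a : ℂ⁴ → V₁₀`. -/
def gammaAt (a x : Fin 4 → ℂ) : V10 := gamma (toSpinor (cartan a) x) (toSpinor (cartan a) x)

/-- Biquadratic forms `(x, y) ↦ B(x, y)`, seen as functions.  The space `S₂₂(ℂ⁴)` of quadratic
sections of `G(2,4)` is the subspace of those that are quadratic forms in the Plücker coordinates of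
the line spanned by `x` and `y`. -/
abbrev BiquadraticForm : Type := (Fin 4 → ℂ) → (Fin 4 → ℂ) → ℂ

/-- The quadratic section of `G(2,4)` defined by `a ∈ 𝔠`: the condition, on the line spanned by `x`
and `y`, that the isotropic vectors `γ_a(x)` and `γ_a(y)` be orthogonal. -/
def quadraticSection (a : Fin 4 → ℂ) : BiquadraticForm :=
  fun x y => bilinForm (gammaAt a x) (gammaAt a y)

/-- The span `U₅` of the quadratic sections defined by the points of `𝔠`. -/
def U5 : Submodule ℂ BiquadraticForm := Submodule.span ℂ (Set.range quadraticSection)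

/-- The map `Θ : 𝔠 → U₅`, on vectors. -/
def theta (a : Fin 4 → ℂ) : U5 := ⟨quadraticSection a, Submodule.subset_span ⟨a, rfl⟩⟩

/-- `f : ℂ⁴ → V` is equivariant for `W ⊂ GL₄(ℂ)` and some linear action of `W` on `V`.  (If `f`
spans `V`, there is at most one such action.) -/
def IsEquivariant {V : Type*} [AddCommGroup V] [Module ℂ V] (W : Subgroup (GL (Fin 4) ℂ))
    (f : (Fin 4 → ℂ) → V) : Prop :=
  ∃ ρ : Representation ℂ W V, ∀ (w : W) (a : Fin 4 → ℂ),
    f (((w : GL (Fin 4) ℂ) : Matrix (Fin 4) (Fin 4) ℂ).mulVec a) = ρ w (f a)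

/-! ### Morphisms from a projective space to a projective space -/

section Morphisms

variable {n : ℕ} {V : Type*} [AddCommGroup V] [Module ℂ V]

/-- The linear system of `f : ℂⁿ → V`: the polynomials `φ ∘ f`, for `φ` a linear form on `V`. -/
def linearSystem (f : (Fin n → ℂ) → V) : Set (MvPolynomial (Fin n) ℂ) :=
  {P | ∃ φ : Module.Dual ℂ V, ∀ a, MvPolynomial.eval a P = φ (f a)}

/-- The field of rational functions on `ℂⁿ`. -/
abbrev RatFun (n : ℕ) : Type := FractionRing (MvPolynomial (Fin n) ℂ)

/-- A polynomial as a rational function. -/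
abbrev toRatFun (P : MvPolynomial (Fin n) ℂ) : RatFun n := algebraMap _ _ P

/-- The function field of `ℙ(ℂⁿ)`, generated by the quotients `Xᵢ / Xⱼ` of the coordinates. -/
def functionField (n : ℕ) : IntermediateField ℂ (RatFun n) :=
  IntermediateField.adjoin ℂ
    {z | ∃ i j, z = toRatFun (MvPolynomial.X i) / toRatFun (MvPolynomial.X j)}

/-- The function field of the image of `[f] : ℙ(ℂⁿ) → ℙ(V)`, pulled back to `ℙ(ℂⁿ)`; it is generated
by the quotients of linear forms. -/
def imageFunctionField (f : (Fin n → ℂ) → V) : IntermediateField ℂ (RatFun n) :=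
  IntermediateField.adjoin ℂ
    {z | ∃ P ∈ linearSystem f, ∃ Q ∈ linearSystem f, z = toRatFun P / toRatFun Q}

/-- The degree of `[f] : ℙ(ℂⁿ) → ℙ(V)` onto its image, that is, the degree of the extension of
function fields. -/
def degreeOntoImage (f : (Fin n → ℂ) → V) : ℕ :=
  (imageFunctionField f).relfinrank (functionField n)

/-- The ring of regular functions on the affine open set `P ≠ 0` of `ℙ(ℂⁿ)`, where `P` is a form of
degree `d`: the quotients `N / Pᵏ` with `N` a form of degree `dk`. -/
def sourceChart (d : ℕ) (P : MvPolynomial (Fin n) ℂ) : Subalgebra ℂ (RatFun n) :=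
  Algebra.adjoin ℂ {z | ∃ (k : ℕ) (N : MvPolynomial (Fin n) ℂ), N.IsHomogeneous (d * k) ∧
    z = toRatFun N / toRatFun P ^ k}

/-- For `P = φ ∘ f`, with `φ` a linear form on `V`: the pull-backs by `[f]` of the regular functions
on the affine open set `φ ≠ 0` of `ℙ(V)`; they are generated by the quotients `ψ / φ`, with `ψ` a
linear form. -/
def targetChart (f : (Fin n → ℂ) → V) (P : MvPolynomial (Fin n) ℂ) : Subalgebra ℂ (RatFun n) :=
  Algebra.adjoin ℂ {z | ∃ N ∈ linearSystem f, z = toRatFun N / toRatFun P}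

/-- `f : ℂⁿ → V` is given by forms of degree `d` without common zero, so that `[f]` is a morphism
from `ℙ(ℂⁿ)` to `ℙ(V)`, and this morphism is finite: over each affine open set `φ ≠ 0` of `ℙ(V)`
(whose preimage is the affine open set `φ ∘ f ≠ 0`, possibly empty), the ring of functions on the
preimage is a finite module. -/
structure IsFiniteMorphism (d : ℕ) (f : (Fin n → ℂ) → V) : Prop where
  isForm : ∀ φ : Module.Dual ℂ V, ∃ P : MvPolynomial (Fin n) ℂ, P.IsHomogeneous d ∧
    ∀ a, MvPolynomial.eval a P = φ (f a)
  ne_zero : ∀ a, a ≠ 0 → f a ≠ 0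
  finite : ∀ P ∈ linearSystem f, P ≠ 0 →
    ∃ h : targetChart f P ≤ sourceChart d P, (Subalgebra.inclusion h).Finite

end Morphisms

/-! ### The Castelnuovo–Richmond quartic -/

/-- The hyperplane `t₀ + ⋯ + t₅ = 0` of `ℂ⁶`. -/
def sumZero : Submodule ℂ (Fin 6 → ℂ) where
  carrier := {t | ∑ i, t i = 0}
  add_mem' := fun {s t} hs ht => by
    simp only [Set.mem_ofPred_eq, Pi.add_apply, Finset.sum_add_distrib] at *
    rw [hs, ht, add_zero]
  zero_mem' := by simp
  smul_mem' := fun c t ht => by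
    simp only [Set.mem_ofPred_eq, Pi.smul_apply, smul_eq_mul, ← Finset.mul_sum] at *
    rw [ht, mul_zero]

/-- The quartic form `(∑ tᵢ²)² - 4 ∑ tᵢ⁴`. -/
def crForm : MvPolynomial (Fin 6) ℂ :=
  (∑ i, MvPolynomial.X i ^ 2) ^ 2 - 4 * ∑ i, MvPolynomial.X i ^ 4

/-- The Castelnuovo–Richmond (or Igusa) quartic `CR₄` in the hyperplane `∑ tᵢ = 0` of `ℙ⁵`. -/
def CR4 : Set (Projectivization ℂ sumZero) :=
  {p | MvPolynomial.eval (p.rep : Fin 6 → ℂ) crForm = 0}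

/-- The singular points of `CR₄`: the differential of the quartic form vanishes on the
hyperplane. -/
def singularCR4 : Set (Projectivization ℂ sumZero) :=
  {p | p ∈ CR4 ∧ ∀ v : sumZero,
    ∑ i, (v : Fin 6 → ℂ) i *
      MvPolynomial.eval (p.rep : Fin 6 → ℂ) (MvPolynomial.pderiv i crForm) = 0}

/-- `Z ⊂ ℙ(V)` is the union of exactly `m` distinct lines. -/
def IsUnionOfLines {V : Type*} [AddCommGroup V] [Module ℂ V] (m : ℕ)
    (Z : Set (Projectivization ℂ V)) : Prop :=
  ∃ 𝓛 : Finset (Submodule ℂ V), 𝓛.card = m ∧ (∀ S ∈ 𝓛, Module.finrank ℂ S = 2) ∧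
    Z = ⋃ S ∈ 𝓛, {p | p.submodule ≤ S}

end SpinorKummer

end

/-!
In suitable coordinates `b = (b₀, b₁, b₂, b₃)` on `𝔠` (`heisenbergCoord`), the map `Θ` is given by
the five quartic invariants of the Heisenberg group of level two, `∑ bᵢ⁴`, `b₀b₁b₂b₃` and the
three forms `bᵢ²bⱼ² + bₖ²bₗ²`. This is an explicit computation with spinors
(`quadraticSection_eq`); as the five corresponding quadratic complexes are linearly independent
and the values of the invariants span `ℂ⁵`, it gives an isomorphism `U₅ ≃ ℂ⁵` (`coordU5`) and the
dimension of `U₅`.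

*Finiteness.* The coefficients of `∏ (T - bᵢ⁴)` are polynomials in the invariants. Hence the `bᵢ⁴`
are integral over the ring generated by the invariants, which gives the finiteness of the morphism
(`isFiniteMorphism_of_isIntegral`, `isIntegral_pow_four_div`).

*Equivariance.* A product of two Clifford multiplications by vectors with `q = 1` preserves
`(γ(ψ, ψ), γ(φ, φ))`, by the Clifford relations and the self-adjointness of Clifford multiplication
(`bilinForm_gamma_spin`). Therefore an element of `SL₄ × Spin₁₀` that preserves `𝔠` acts on the
quadratic sections by a linear substitution in `(x, y)`, and restricts to `U₅`. In the coordinates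
`t₀, …, t₅` of `igusaCoord`, the five reflections act on `U₅` as transpositions
(`igusaMap_reflection`), that is, through the symmetric group `S₆`.

*Degree.* The sixteen elements of the Heisenberg group modulo scalars preserve the invariants, so
the degree is at least `16`. Conversely, all the quotients `bᵢ / bⱼ` are rational in the
invariants and in four elements that are at most quadratic over the field of the invariants:
`b₀b₁ / b₂b₃`, `b₀b₂ / b₁b₃`, `∑ bᵢ² / (b₀b₁ + b₂b₃)` and `∑ bᵢ² / (b₀b₂ + b₁b₃)`
(`div_mem_of_quadratic_elements`).

*Image.* The equation of the Igusa quartic, evaluated at the invariants, is an identity.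
Conversely, after the substitution `c₂ / c₁ = u₁ + u₁⁻¹`, `c₃ / c₁ = u₂ + u₂⁻¹`,
`c₄ / c₁ = u₃ + u₃⁻¹`, the equation splits into two factors, linear in `c₀`, and a preimage of a
point is obtained by extracting square roots (`exists_igusaMap`).

*Singular lines.* At a singular point, the `tᵢ` are roots of a common cubic polynomial without
quadratic term, and they are equal in pairs by a count of multiplicities; the singular lines
correspond to the fifteen partitions of six indices in three pairs (`singular_iff`). The
differences `tᵢ - tⱼ` pull back to products of four linear forms in `b`, and the three such
products attached to a partition vanish simultaneously on exactly two lines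
(`igusaMap_mem_synthemeLine_iff`).
-/

noncomputable section

namespace SpinorKummer

/-! ### Invariance of the quadratic sections under `Spin₁₀` -/

theorem insertSign_erase {i j : Fin 5} {J : Finset (Fin 5)} (hj : j ∈ J) :
    insertSign i (J.erase j) = (if j < i then -1 else 1) * insertSign i J := by
  unfold insertSign
  rw [Finset.filter_erase]
  split_ifs with h
  · have hm : j ∈ J.filter (· < i) := by simp [hj, h]
    obtain ⟨n, hn⟩ := Nat.exists_eq_succ_of_ne_zero (Finset.card_ne_zero_of_mem hm)
    rw [Finset.card_erase_of_mem hm, hn]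
    simp [pow_succ]
  · rw [Finset.erase_eq_of_notMem (by simp [h]), one_mul]

theorem insertSign_insert {i j : Fin 5} {J : Finset (Fin 5)} (hj : j ∉ J) :
    insertSign i (insert j J) = (if j < i then -1 else 1) * insertSign i J := by
  have h := insertSign_erase (i := i) (Finset.mem_insert_self j J)
  rw [Finset.erase_insert hj] at h
  rw [h]
  split_ifs <;> simp

theorem insertSign_mul_self (i : Fin 5) (J : Finset (Fin 5)) :
    insertSign i J * insertSign i J = 1 := by
  rw [insertSign, ← mul_pow]
  simp

theorem wedge_wedge (i j : Fin 5) (ψ : Spinor) :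
    wedge i (wedge j ψ) + wedge j (wedge i ψ) = 0 := by
  funext J
  simp only [wedge, Pi.add_apply, Pi.zero_apply, Finset.mem_erase]
  rcases eq_or_ne i j with rfl | hij
  · simp
  by_cases hi : i ∈ J <;> by_cases hj : j ∈ J <;> simp only [hi, hj, hij, hij.symm, ne_eq,
    not_false_eq_true, and_true, and_false, if_true, if_false, mul_zero, add_zero]
  rw [insertSign_erase hi, insertSign_erase hj, Finset.erase_right_comm]
  rcases lt_or_gt_of_ne hij with h | h <;> simp only [h, h.not_gt, if_true, if_false] <;> ring

theorem contract_contract (i j : Fin 5) (ψ : Spinor) :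
    contract i (contract j ψ) + contract j (contract i ψ) = 0 := by
  funext J
  simp only [contract, Pi.add_apply, Pi.zero_apply, Finset.mem_insert]
  rcases eq_or_ne i j with rfl | hij
  · simp
  by_cases hi : i ∈ J <;> by_cases hj : j ∈ J <;> simp only [hi, hj, hij, hij.symm, or_true,
    or_false, if_true, if_false, mul_zero, add_zero]
  rw [insertSign_insert hi, insertSign_insert hj, Finset.insert_comm]
  rcases lt_or_gt_of_ne hij with h | h <;> simp only [h, h.not_gt, if_true, if_false] <;> ring

theorem wedge_contract (i j : Fin 5) (ψ : Spinor) :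
    wedge i (contract j ψ) + contract j (wedge i ψ) = if i = j then ψ else 0 := by
  funext J
  simp only [wedge, contract, Pi.add_apply, Finset.mem_insert, Finset.mem_erase]
  rcases eq_or_ne i j with rfl | hij
  · by_cases hi : i ∈ J
    · simp only [hi, if_true, ne_eq, not_true_eq_false, false_and, if_false, add_zero,
        Finset.insert_erase, insertSign_erase hi, lt_irrefl]
      rw [one_mul, ← mul_assoc, insertSign_mul_self, one_mul]
    · simp only [hi, if_true, if_false, true_or, zero_add, Finset.erase_insert,
        insertSign_insert hi, lt_irrefl, not_false_eq_true]
      rw [one_mul, ← mul_assoc, insertSign_mul_self, one_mul]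
  · by_cases hi : i ∈ J <;> by_cases hj : j ∈ J <;> simp only [hi, hj, hij, hij.symm, or_true,
      or_false, and_true, and_false, ne_eq, not_false_eq_true, if_true, if_false, mul_zero,
      add_zero, Pi.zero_apply]
    rw [insertSign_insert hj, insertSign_erase hi, Finset.erase_insert_of_ne hij.symm]
    rcases lt_or_gt_of_ne hij with h | h <;> simp only [h, h.not_gt, if_true, if_false] <;> ring

theorem wedge_add (i : Fin 5) (ψ φ : Spinor) : wedge i (ψ + φ) = wedge i ψ + wedge i φ := by
  funext J
  simp only [wedge, Pi.add_apply]
  split_ifs <;> ring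

theorem wedge_smul (i : Fin 5) (c : ℂ) (ψ : Spinor) : wedge i (c • ψ) = c • wedge i ψ := by
  funext J
  simp only [wedge, Pi.smul_apply, smul_eq_mul]
  split_ifs <;> ring

theorem contract_add (i : Fin 5) (ψ φ : Spinor) :
    contract i (ψ + φ) = contract i ψ + contract i φ := by
  funext J
  simp only [contract, Pi.add_apply]
  split_ifs <;> ring

theorem contract_smul (i : Fin 5) (c : ℂ) (ψ : Spinor) :
    contract i (c • ψ) = c • contract i ψ := by
  funext J
  simp only [contract, Pi.smul_apply, smul_eq_mul]
  split_ifs <;> ring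

/-- The Clifford action, bundled as a linear map in the spinor. -/
def cliffordLin (v : V10) : Spinor →ₗ[ℂ] Spinor :=
  ∑ i, (v.1 i • { toFun := wedge i, map_add' := wedge_add i, map_smul' := wedge_smul i } +
    v.2 i • { toFun := contract i, map_add' := contract_add i, map_smul' := contract_smul i })

theorem cliffordLin_apply (v : V10) (ψ : Spinor) : cliffordLin v ψ = clifford v ψ := by
  simp [cliffordLin, clifford, LinearMap.sum_apply]

theorem clifford_smul (v : V10) (c : ℂ) (ψ : Spinor) :
    clifford v (c • ψ) = c • clifford v ψ := by
  simp only [← cliffordLin_apply, map_smul]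

theorem clifford_sub (v : V10) (ψ φ : Spinor) :
    clifford v (ψ - φ) = clifford v ψ - clifford v φ := by
  simp only [← cliffordLin_apply, map_sub]

theorem clifford_sub_left (v w : V10) (ψ : Spinor) :
    clifford (v - w) ψ = clifford v ψ - clifford w ψ := by
  simp only [clifford, ← Finset.sum_sub_distrib, Prod.fst_sub, Prod.snd_sub, Pi.sub_apply,
    sub_smul]
  refine Finset.sum_congr rfl fun i _ => ?_
  abel

theorem clifford_smul_left (c : ℂ) (v : V10) (ψ : Spinor) :
    clifford (c • v) ψ = c • clifford v ψ := by
  simp only [clifford, Finset.smul_sum, Prod.smul_fst, Prod.smul_snd, Pi.smul_apply, smul_add,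
    smul_smul, smul_eq_mul]

/-- The Clifford relation. -/
theorem clifford_clifford (v w : V10) (ψ : Spinor) :
    clifford v (clifford w ψ) + clifford w (clifford v ψ) = bilinForm v w • ψ := by
  have key : ∀ v w : V10, clifford v (clifford w ψ) = ∑ i, ∑ j,
      ((v.1 i * w.1 j) • wedge i (wedge j ψ) + (v.1 i * w.2 j) • wedge i (contract j ψ) +
      (v.2 i * w.1 j) • contract i (wedge j ψ) +
      (v.2 i * w.2 j) • contract i (contract j ψ)) := by
    intro v w
    rw [← cliffordLin_apply v, clifford, map_sum, Finset.sum_comm]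
    refine Finset.sum_congr rfl fun j _ => ?_
    rw [cliffordLin_apply, clifford]
    refine Finset.sum_congr rfl fun i _ => ?_
    simp only [wedge_add, wedge_smul, contract_add, contract_smul, smul_add, smul_smul]
    abel
  rw [key v w, key w v, Finset.sum_comm (f := fun i j => ((w.1 i * v.1 j) • _ + _ + _ + _)),
    ← Finset.sum_add_distrib]
  simp only [← Finset.sum_add_distrib]
  have step : ∀ i j, ((v.1 i * w.1 j) • wedge i (wedge j ψ) +
      (v.1 i * w.2 j) • wedge i (contract j ψ) + (v.2 i * w.1 j) • contract i (wedge j ψ) +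
      (v.2 i * w.2 j) • contract i (contract j ψ)) + ((w.1 j * v.1 i) • wedge j (wedge i ψ) +
      (w.1 j * v.2 i) • wedge j (contract i ψ) + (w.2 j * v.1 i) • contract j (wedge i ψ) +
      (w.2 j * v.2 i) • contract j (contract i ψ)) =
      if i = j then (v.1 i * w.2 j + v.2 i * w.1 j) • ψ else 0 := by
    intro i j
    have h1 := wedge_wedge i j ψ
    have h2 := contract_contract i j ψ
    have h3 := wedge_contract i j ψ
    have h4 := wedge_contract j i ψ
    rw [← eq_neg_iff_add_eq_zero] at h1 h2
    rw [← eq_sub_iff_add_eq] at h3 h4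
    rw [h1, h2, h3, h4]
    rcases eq_or_ne i j with rfl | hij
    · simp only [if_true]
      module
    · simp only [hij, hij.symm, if_false]
      module
  simp only [step, Finset.sum_ite_eq, Finset.mem_univ, if_true, bilinForm, Finset.sum_smul]

theorem clifford_self (v : V10) (ψ : Spinor) :
    clifford v (clifford v ψ) = quadForm v • ψ := by
  have h := clifford_clifford v v ψ
  have hq : bilinForm v v = 2 * quadForm v := by
    simp only [bilinForm, quadForm, Finset.mul_sum]
    exact Finset.sum_congr rfl fun i _ => by ring
  rw [hq, ← two_smul ℂ (clifford v (clifford v ψ)), mul_smul] at h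
  exact smul_right_injective _ (two_ne_zero (α := ℂ)) h

theorem sum_finset_fin_five {M : Type*} [AddCommMonoid M] (f : Finset (Fin 5) → M) :
    ∑ I, f I = f ∅ + f {0} + f {1} + f {2} + f {3} + f {4} + f {0, 1} + f {0, 2} + f {0, 3} +
      f {0, 4} + f {1, 2} + f {1, 3} + f {1, 4} + f {2, 3} + f {2, 4} + f {3, 4} + f {0, 1, 2} +
      f {0, 1, 3} + f {0, 1, 4} + f {0, 2, 3} + f {0, 2, 4} + f {0, 3, 4} + f {1, 2, 3} +
      f {1, 2, 4} + f {1, 3, 4} + f {2, 3, 4} + f {0, 1, 2, 3} + f {0, 1, 2, 4} +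
      f {0, 1, 3, 4} + f {0, 2, 3, 4} + f {1, 2, 3, 4} + f {0, 1, 2, 3, 4} := by
  have h : (Finset.univ : Finset (Finset (Fin 5))) = {∅, {0}, {1}, {2}, {3}, {4}, {0, 1}, {0, 2},
      {0, 3}, {0, 4}, {1, 2}, {1, 3}, {1, 4}, {2, 3}, {2, 4}, {3, 4}, {0, 1, 2}, {0, 1, 3},
      {0, 1, 4}, {0, 2, 3}, {0, 2, 4}, {0, 3, 4}, {1, 2, 3}, {1, 2, 4}, {1, 3, 4}, {2, 3, 4},
      {0, 1, 2, 3}, {0, 1, 2, 4}, {0, 1, 3, 4}, {0, 2, 3, 4}, {1, 2, 3, 4}, {0, 1, 2, 3, 4}} := by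
    decide
  rw [h]
  iterate 31 rw [Finset.sum_insert (by decide)]
  rw [Finset.sum_singleton]
  simp only [add_assoc]

theorem pairing_wedge (i : Fin 5) (ψ φ : Spinor) :
    pairing (wedge i ψ) φ = pairing ψ (wedge i φ) := by
  have sign : ∀ i : Fin 5, ∀ I : Finset (Fin 5), i ∉ I →
      (((insert i I).card * ((insert i I).card - 1) / 2 +
        (((insert i I) ×ˢ (insert i I)ᶜ).filter fun p => p.2 < p.1).card) +
        ((insert i I).filter (· < i)).card) % 2 =
      ((I.card * (I.card - 1) / 2 + ((I ×ˢ Iᶜ).filter fun p => p.2 < p.1).card) +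
        (Iᶜ.filter (· < i)).card) % 2 := by decide
  unfold pairing
  rw [← Finset.sum_filter_add_sum_filter_not _ (fun I => i ∈ I),
    Finset.sum_eq_zero (s := Finset.univ.filter fun I => ¬ i ∈ I),
    ← Finset.sum_filter_add_sum_filter_not (f := fun I => _ * wedge i φ Iᶜ) _ (fun I => i ∈ I),
    Finset.sum_eq_zero (f := fun I => _ * wedge i φ Iᶜ) (s := Finset.univ.filter fun I => i ∈ I),
    add_zero, zero_add]
  · symm
    refine Finset.sum_nbij' (insert i) (fun I => I.erase i) ?_ ?_ ?_ ?_ ?_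
    · simp
    · simp
    · intro I hI
      exact Finset.erase_insert (by simpa using hI)
    · intro I hI
      exact Finset.insert_erase (by simpa using hI)
    · intro I hI
      have hi : i ∉ I := by simpa using hI
      have hc : Iᶜ.erase i = (insert i I)ᶜ := by
        rw [Finset.compl_insert]
      have hs : (-1 : ℂ) ^ (I.card * (I.card - 1) / 2) * shuffleSign I * insertSign i Iᶜ =
          (-1) ^ ((insert i I).card * ((insert i I).card - 1) / 2) * shuffleSign (insert i I) *
            insertSign i (insert i I) := by
        simp only [shuffleSign, insertSign, ← pow_add]
        rw [neg_one_pow_eq_pow_mod_two, ← sign i I hi, ← neg_one_pow_eq_pow_mod_two]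
      simp only [wedge, Finset.mem_compl, hi, not_false_eq_true, if_true, Finset.mem_insert_self,
        Finset.erase_insert, hc]
      linear_combination ψ I * φ (insert i I)ᶜ * hs
  · intro I hI
    have hi : i ∈ I := by simpa using hI
    simp [wedge, hi]
  · intro I hI
    have hi : i ∉ I := by simpa using hI
    simp [wedge, hi]

theorem pairing_contract (i : Fin 5) (ψ φ : Spinor) :
    pairing (contract i ψ) φ = pairing ψ (contract i φ) := by
  have sign : ∀ i : Fin 5, ∀ I : Finset (Fin 5), i ∉ I →
      ((I.card * (I.card - 1) / 2 + ((I ×ˢ Iᶜ).filter fun p => p.2 < p.1).card) +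
        (I.filter (· < i)).card) % 2 =
      (((insert i I).card * ((insert i I).card - 1) / 2 +
        (((insert i I) ×ˢ (insert i I)ᶜ).filter fun p => p.2 < p.1).card) +
        ((insert i I)ᶜ.filter (· < i)).card) % 2 := by decide
  unfold pairing
  rw [← Finset.sum_filter_add_sum_filter_not _ (fun I => i ∈ I),
    Finset.sum_eq_zero (s := Finset.univ.filter fun I => i ∈ I),
    ← Finset.sum_filter_add_sum_filter_not (f := fun I => _ * contract i φ Iᶜ) _ (fun I => i ∈ I),
    Finset.sum_eq_zero (f := fun I => _ * contract i φ Iᶜ)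
      (s := Finset.univ.filter fun I => ¬ i ∈ I), add_zero, zero_add]
  · refine Finset.sum_nbij' (insert i) (fun I => I.erase i) ?_ ?_ ?_ ?_ ?_
    · simp
    · simp
    · intro I hI
      exact Finset.erase_insert (by simpa using hI)
    · intro I hI
      exact Finset.insert_erase (by simpa using hI)
    · intro I hI
      have hi : i ∉ I := by simpa using hI
      have hc : insert i (insert i I)ᶜ = Iᶜ := by
        rw [Finset.compl_insert, Finset.insert_erase (by simpa using hi)]
      have hs : (-1 : ℂ) ^ (I.card * (I.card - 1) / 2) * shuffleSign I * insertSign i I =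
          (-1) ^ ((insert i I).card * ((insert i I).card - 1) / 2) * shuffleSign (insert i I) *
            insertSign i (insert i I)ᶜ := by
        simp only [shuffleSign, insertSign, ← pow_add]
        rw [neg_one_pow_eq_pow_mod_two, sign i I hi, ← neg_one_pow_eq_pow_mod_two]
      simp only [contract, Finset.mem_compl, hi, Finset.mem_insert_self, not_true_eq_false,
        if_false, hc]
      linear_combination ψ (insert i I) * φ Iᶜ * hs
  · intro I hI
    have hi : i ∉ I := by simpa using hI
    simp [contract, hi]
  · intro I hI
    have hi : i ∈ I := by simpa using hI
    simp [contract, hi]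

theorem pairing_sum_left {ι : Type*} (s : Finset ι) (f : ι → Spinor) (φ : Spinor) :
    pairing (∑ i ∈ s, f i) φ = ∑ i ∈ s, pairing (f i) φ := by
  simp only [pairing, Finset.sum_apply, Finset.mul_sum, Finset.sum_mul]
  exact Finset.sum_comm

theorem pairing_sum_right {ι : Type*} (s : Finset ι) (ψ : Spinor) (f : ι → Spinor) :
    pairing ψ (∑ i ∈ s, f i) = ∑ i ∈ s, pairing ψ (f i) := by
  simp only [pairing, Finset.sum_apply, Finset.mul_sum]
  exact Finset.sum_comm

theorem pairing_add_left (ψ ψ' φ : Spinor) :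
    pairing (ψ + ψ') φ = pairing ψ φ + pairing ψ' φ := by
  simp only [pairing, Pi.add_apply, ← Finset.sum_add_distrib]
  exact Finset.sum_congr rfl fun _ _ => by ring

theorem pairing_add_right (ψ φ φ' : Spinor) :
    pairing ψ (φ + φ') = pairing ψ φ + pairing ψ φ' := by
  simp only [pairing, Pi.add_apply, ← Finset.sum_add_distrib]
  exact Finset.sum_congr rfl fun _ _ => by ring

theorem pairing_smul_left (c : ℂ) (ψ φ : Spinor) : pairing (c • ψ) φ = c * pairing ψ φ := by
  simp only [pairing, Pi.smul_apply, smul_eq_mul, Finset.mul_sum]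
  exact Finset.sum_congr rfl fun _ _ => by ring

theorem pairing_smul_right (c : ℂ) (ψ φ : Spinor) : pairing ψ (c • φ) = c * pairing ψ φ := by
  simp only [pairing, Pi.smul_apply, smul_eq_mul, Finset.mul_sum]
  exact Finset.sum_congr rfl fun _ _ => by ring

/-- Vectors are self-adjoint for the pairing of spinors. -/
theorem pairing_clifford (v : V10) (ψ φ : Spinor) :
    pairing (clifford v ψ) φ = pairing ψ (clifford v φ) := by
  simp only [clifford, pairing_sum_left, pairing_sum_right, pairing_add_left, pairing_add_right,
    pairing_smul_left, pairing_smul_right, pairing_wedge, pairing_contract]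

theorem bilinForm_gamma (ψ φ : Spinor) (w : V10) :
    bilinForm (gamma ψ φ) w = pairing (clifford w ψ) φ := by
  simp only [clifford, pairing_sum_left, pairing_add_left, pairing_smul_left, bilinForm, gamma]
  exact Finset.sum_congr rfl fun _ _ => by ring

theorem bilinForm_comm (v w : V10) : bilinForm v w = bilinForm w v :=
  Finset.sum_congr rfl fun _ _ => by ring

theorem bilinForm_reflect (u v w : V10) (c d : ℂ) :
    bilinForm u (c • v - d • w) = c * bilinForm u v - d * bilinForm u w := by
  simp only [bilinForm, Finset.mul_sum, ← Finset.sum_sub_distrib, Prod.fst_sub, Prod.snd_sub,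
    Prod.smul_fst, Prod.smul_snd, Pi.sub_apply, Pi.smul_apply, smul_eq_mul]
  exact Finset.sum_congr rfl fun _ _ => by ring

/-- `γ(vψ, vψ)` is the image of `γ(ψ, ψ)` by the reflection `w ↦ (v, w) v - q(v) w`. -/
theorem bilinForm_gamma_clifford (v w : V10) (ψ : Spinor) :
    bilinForm (gamma (clifford v ψ) (clifford v ψ)) w =
      bilinForm (gamma ψ ψ) (bilinForm v w • v - quadForm v • w) := by
  have h : clifford w (clifford v ψ) = bilinForm v w • ψ - clifford v (clifford w ψ) :=
    eq_sub_of_add_eq' (clifford_clifford v w ψ)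
  rw [bilinForm_gamma, bilinForm_gamma, ← pairing_clifford, h, clifford_sub, clifford_smul,
    clifford_self, clifford_sub_left, clifford_smul_left, clifford_smul_left]

theorem bilinForm_gamma_gamma_clifford (v : V10) (hv : quadForm v = 1) (ψ φ : Spinor) :
    bilinForm (gamma (clifford v ψ) (clifford v ψ)) (gamma (clifford v φ) (clifford v φ)) =
      bilinForm (gamma ψ ψ) (gamma φ φ) := by
  have hvv : bilinForm v v = 2 := by
    have : bilinForm v v = 2 * quadForm v := by
      simp only [bilinForm, quadForm, Finset.mul_sum]
      exact Finset.sum_congr rfl fun i _ => by ring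
    rw [this, hv, mul_one]
  have h1 := bilinForm_gamma_clifford v (gamma ψ ψ) φ
  have h2 := bilinForm_gamma_clifford v v φ
  rw [bilinForm_reflect, hv] at h1 h2
  rw [bilinForm_gamma_clifford, hv, bilinForm_reflect, bilinForm_comm (gamma ψ ψ) v,
    bilinForm_comm (gamma ψ ψ) (gamma (clifford v φ) _), h1,
    bilinForm_comm v (gamma (clifford v φ) _), h2, hvv, bilinForm_comm (gamma φ φ) (gamma ψ ψ)]
  ring

/-- The invariance of `(γ(ψ, ψ), γ(φ, φ))` under the spin group. -/
theorem bilinForm_gamma_spin {h : Spinor ≃ₗ[ℂ] Spinor} (hh : h ∈ spin10) (ψ φ : Spinor) :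
    bilinForm (gamma (h ψ) (h ψ)) (gamma (h φ) (h φ)) = bilinForm (gamma ψ ψ) (gamma φ φ) := by
  induction hh using Subgroup.closure_induction generalizing ψ φ with
  | mem h hh =>
    obtain ⟨v, w, hv, hw, H⟩ := hh
    rw [H, H, bilinForm_gamma_gamma_clifford v hv, bilinForm_gamma_gamma_clifford w hw]
  | one => rfl
  | mul h h' _ _ ih ih' =>
    rw [LinearEquiv.mul_apply, LinearEquiv.mul_apply, ih, ih']
  | inv h _ ih =>
    rw [← ih]
    have e : ∀ χ, h (h⁻¹ χ) = χ := fun χ => h.apply_symm_apply χ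
    rw [e, e]

theorem pairing_eq (ψ φ : Spinor) : pairing ψ φ =
      ψ ∅ * φ {0, 1, 2, 3, 4} + ψ {0} * φ {1, 2, 3, 4} - ψ {1} * φ {0, 2, 3, 4}
      + ψ {2} * φ {0, 1, 3, 4} - ψ {3} * φ {0, 1, 2, 4} + ψ {4} * φ {0, 1, 2, 3}
      - ψ {0, 1} * φ {2, 3, 4} + ψ {0, 2} * φ {1, 3, 4} - ψ {0, 3} * φ {1, 2, 4}
      + ψ {0, 4} * φ {1, 2, 3} - ψ {1, 2} * φ {0, 3, 4} + ψ {1, 3} * φ {0, 2, 4}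
      - ψ {1, 4} * φ {0, 2, 3} - ψ {2, 3} * φ {0, 1, 4} + ψ {2, 4} * φ {0, 1, 3}
      - ψ {3, 4} * φ {0, 1, 2} - ψ {0, 1, 2} * φ {3, 4} + ψ {0, 1, 3} * φ {2, 4}
      - ψ {0, 1, 4} * φ {2, 3} - ψ {0, 2, 3} * φ {1, 4} + ψ {0, 2, 4} * φ {1, 3}
      - ψ {0, 3, 4} * φ {1, 2} + ψ {1, 2, 3} * φ {0, 4} - ψ {1, 2, 4} * φ {0, 3}
      + ψ {1, 3, 4} * φ {0, 2} - ψ {2, 3, 4} * φ {0, 1} + ψ {0, 1, 2, 3} * φ {4}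
      - ψ {0, 1, 2, 4} * φ {3} + ψ {0, 1, 3, 4} * φ {2} - ψ {0, 2, 3, 4} * φ {1}
      + ψ {1, 2, 3, 4} * φ {0} + ψ {0, 1, 2, 3, 4} * φ ∅ := by
  have t : ∀ I J : Finset (Fin 5), ∀ n : ℕ, Iᶜ = J → (I.card * (I.card - 1) / 2 +
      ((I ×ˢ Iᶜ).filter fun p => p.2 < p.1).card) % 2 = n →
      (-1) ^ (I.card * (I.card - 1) / 2) * shuffleSign I * ψ I * φ Iᶜ =
        (-1) ^ n * (ψ I * φ J) := by
    rintro I J n rfl rfl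
    rw [shuffleSign, ← pow_add, neg_one_pow_eq_pow_mod_two, mul_assoc]
  rw [pairing, sum_finset_fin_five,
    t ∅ {0, 1, 2, 3, 4} 0 (by decide) (by decide), t {0} {1, 2, 3, 4} 0 (by decide) (by decide),
    t {1} {0, 2, 3, 4} 1 (by decide) (by decide), t {2} {0, 1, 3, 4} 0 (by decide) (by decide),
    t {3} {0, 1, 2, 4} 1 (by decide) (by decide), t {4} {0, 1, 2, 3} 0 (by decide) (by decide),
    t {0, 1} {2, 3, 4} 1 (by decide) (by decide), t {0, 2} {1, 3, 4} 0 (by decide) (by decide),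
    t {0, 3} {1, 2, 4} 1 (by decide) (by decide), t {0, 4} {1, 2, 3} 0 (by decide) (by decide),
    t {1, 2} {0, 3, 4} 1 (by decide) (by decide), t {1, 3} {0, 2, 4} 0 (by decide) (by decide),
    t {1, 4} {0, 2, 3} 1 (by decide) (by decide), t {2, 3} {0, 1, 4} 1 (by decide) (by decide),
    t {2, 4} {0, 1, 3} 0 (by decide) (by decide), t {3, 4} {0, 1, 2} 1 (by decide) (by decide),
    t {0, 1, 2} {3, 4} 1 (by decide) (by decide), t {0, 1, 3} {2, 4} 0 (by decide) (by decide),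
    t {0, 1, 4} {2, 3} 1 (by decide) (by decide), t {0, 2, 3} {1, 4} 1 (by decide) (by decide),
    t {0, 2, 4} {1, 3} 0 (by decide) (by decide), t {0, 3, 4} {1, 2} 1 (by decide) (by decide),
    t {1, 2, 3} {0, 4} 0 (by decide) (by decide), t {1, 2, 4} {0, 3} 1 (by decide) (by decide),
    t {1, 3, 4} {0, 2} 0 (by decide) (by decide), t {2, 3, 4} {0, 1} 1 (by decide) (by decide),
    t {0, 1, 2, 3} {4} 0 (by decide) (by decide), t {0, 1, 2, 4} {3} 1 (by decide) (by decide),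
    t {0, 1, 3, 4} {2} 0 (by decide) (by decide), t {0, 2, 3, 4} {1} 1 (by decide) (by decide),
    t {1, 2, 3, 4} {0} 0 (by decide) (by decide), t {0, 1, 2, 3, 4} ∅ 0 (by decide) (by decide)]
  ring

theorem toSpinor_cartan (a x : Fin 4 → ℂ) :
    toSpinor (cartan a) x ∅ = a 2 * x 1 ∧ toSpinor (cartan a) x {0} = 0 ∧
    toSpinor (cartan a) x {1} = 0 ∧ toSpinor (cartan a) x {2} = 0 ∧
    toSpinor (cartan a) x {3} = 0 ∧ toSpinor (cartan a) x {4} = 0 ∧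
    toSpinor (cartan a) x {0, 1} = a 1 * x 3 ∧ toSpinor (cartan a) x {0, 2} = -(a 0 * x 3) ∧
    toSpinor (cartan a) x {0, 3} = a 3 * x 0 ∧ toSpinor (cartan a) x {0, 4} = -(a 3 * x 2) ∧
    toSpinor (cartan a) x {1, 2} = a 3 * x 1 ∧ toSpinor (cartan a) x {1, 3} = -(a 0 * x 2) ∧
    toSpinor (cartan a) x {1, 4} = -(a 1 * x 0) ∧ toSpinor (cartan a) x {2, 3} = a 1 * x 2 ∧
    toSpinor (cartan a) x {2, 4} = -(a 0 * x 0) ∧ toSpinor (cartan a) x {3, 4} = -(a 2 * x 3) ∧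
    toSpinor (cartan a) x {0, 1, 2} = 0 ∧ toSpinor (cartan a) x {0, 1, 3} = 0 ∧
    toSpinor (cartan a) x {0, 1, 4} = 0 ∧ toSpinor (cartan a) x {0, 2, 3} = 0 ∧
    toSpinor (cartan a) x {0, 2, 4} = 0 ∧ toSpinor (cartan a) x {0, 3, 4} = 0 ∧
    toSpinor (cartan a) x {1, 2, 3} = 0 ∧ toSpinor (cartan a) x {1, 2, 4} = 0 ∧
    toSpinor (cartan a) x {1, 3, 4} = 0 ∧ toSpinor (cartan a) x {2, 3, 4} = 0 ∧
    toSpinor (cartan a) x {0, 1, 2, 3} = a 2 * x 0 ∧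
    toSpinor (cartan a) x {0, 1, 2, 4} = a 2 * x 2 ∧
    toSpinor (cartan a) x {0, 1, 3, 4} = a 0 * x 1 ∧
    toSpinor (cartan a) x {0, 2, 3, 4} = a 1 * x 1 ∧
    toSpinor (cartan a) x {1, 2, 3, 4} = a 3 * x 3 ∧ toSpinor (cartan a) x {0, 1, 2, 3, 4} = 0 := by
  refine ⟨?_, ?_, ?_, ?_, ?_, ?_, ?_, ?_, ?_, ?_, ?_, ?_, ?_, ?_, ?_, ?_, ?_, ?_, ?_, ?_, ?_, ?_,
      ?_, ?_, ?_, ?_, ?_, ?_, ?_, ?_, ?_, ?_⟩ <;>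
    simp +decide [toSpinor, cartan, cartanSpinor, Fin.sum_univ_four, e, wedge, insertSign,
      Pi.single_apply, mul_comm]

/-! ### The space `U₅` -/

/-- Coordinates on `𝔠` in which the linear system of `Θ` is spanned by the quartic invariants of the
Heisenberg group, `∑ bᵢ⁴`, `b₀b₁b₂b₃` and `bᵢ²bⱼ² + bₖ²bₗ²`. -/
def heisenbergCoord : (Fin 4 → ℂ) ≃ₗ[ℂ] (Fin 4 → ℂ) where
  toFun a := ![Complex.I * (a 0 - a 1), a 0 + a 1, a 2 - a 3, a 2 + a 3]
  invFun b := ![(b 1 - Complex.I * b 0) / 2, (b 1 + Complex.I * b 0) / 2, (b 3 + b 2) / 2,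
    (b 3 - b 2) / 2]
  map_add' a b := by
    funext i
    fin_cases i <;> simp <;> ring
  map_smul' c a := by
    funext i
    fin_cases i <;> simp <;> ring
  left_inv a := by
    have hI := Complex.I_mul_I
    funext i
    fin_cases i <;> simp
    · linear_combination (a 1 - a 0) / 2 * hI
    · linear_combination (a 0 - a 1) / 2 * hI
  right_inv b := by
    have hI := Complex.I_mul_I
    funext i
    fin_cases i <;> simp
    · linear_combination (-b 0) * hI
    · ring
    · ring
    · ring

/-- The quartic invariants of the Heisenberg group. -/
def invariantQuartics (b : Fin 4 → ℂ) : Fin 5 → ℂ :=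
  ![b 0 ^ 4 + b 1 ^ 4 + b 2 ^ 4 + b 3 ^ 4, b 0 * b 1 * b 2 * b 3,
    b 0 ^ 2 * b 1 ^ 2 + b 2 ^ 2 * b 3 ^ 2, b 0 ^ 2 * b 2 ^ 2 + b 1 ^ 2 * b 3 ^ 2,
    b 0 ^ 2 * b 3 ^ 2 + b 1 ^ 2 * b 2 ^ 2]

/-- The Plücker coordinates of the line spanned by `x` and `y`. -/
def pluecker (x y : Fin 4 → ℂ) (i j : Fin 4) : ℂ := x i * y j - x j * y i

/-- The quadratic section of `G(2,4)` with given coordinates in a basis of `U₅`. -/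
def quadraticComplex : (Fin 5 → ℂ) →ₗ[ℂ] BiquadraticForm where
  toFun c x y :=
    -c 0 * (pluecker x y 0 1 * pluecker x y 2 3) +
    c 1 * (4 * Complex.I * (pluecker x y 0 1 ^ 2 - pluecker x y 2 3 ^ 2)) -
    c 2 * (2 * (pluecker x y 0 2 * pluecker x y 1 3 + pluecker x y 0 3 * pluecker x y 1 2)) +
    c 3 * (pluecker x y 0 2 ^ 2 + pluecker x y 1 3 ^ 2 - pluecker x y 0 3 ^ 2 -
      pluecker x y 1 2 ^ 2) -
    c 4 * (pluecker x y 0 2 ^ 2 + pluecker x y 1 3 ^ 2 + pluecker x y 0 3 ^ 2 +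
      pluecker x y 1 2 ^ 2)
  map_add' c d := by
    funext x y
    simp only [Pi.add_apply]
    ring
  map_smul' c d := by
    funext x y
    simp only [Pi.smul_apply, smul_eq_mul, RingHom.id_apply]
    ring

theorem quadraticComplex_injective : Function.Injective quadraticComplex := by
  rw [injective_iff_map_eq_zero]
  intro c hc
  have h := fun x y => congrFun (congrFun hc x) y
  have h1 := h ![1, 0, 0, 0] ![0, 1, 0, 0]
  have h2 := h ![1, 0, 0, 0] ![0, 0, 1, 0]
  have h3 := h ![1, 0, 0, 0] ![0, 0, 0, 1]
  have h4 := h ![1, 1, 0, 0] ![0, 0, 1, 1]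
  have h5 := h ![1, 0, 1, 0] ![0, 1, 0, 1]
  simp [quadraticComplex, pluecker] at h1 h2 h3 h4 h5
  have e3 : c 3 = 0 := by linear_combination (h2 - h3) / 2
  have e4 : c 4 = 0 := by linear_combination -(h2 + h3) / 2
  have e2 : c 2 = 0 := by linear_combination -h4 / 4 - e4
  have e0 : c 0 = 0 := by linear_combination -h5 + 2 * e2 - 2 * e3 - 2 * e4
  funext i
  fin_cases i
  exacts [e0, h1, e2, e3, e4]

/-- The coordinates of the isotropic vector `γ_a(x)` in the bases `(eᵢ)` and `(fᵢ)`. -/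
theorem gammaAt_eq (a x : Fin 4 → ℂ) : gammaAt a x =
    (![-2 * (a 0 ^ 2 + a 1 ^ 2) * (x 1 * x 3) - 4 * (a 2 * a 3) * (x 0 * x 2),
      2 * (a 0 * a 2 * x 2 ^ 2 + a 0 * a 3 * x 1 ^ 2 - a 1 * a 2 * x 0 ^ 2 - a 1 * a 3 * x 3 ^ 2),
      2 * (a 1 * a 3 * x 1 ^ 2 + a 0 * a 3 * x 3 ^ 2 - a 0 * a 2 * x 0 ^ 2 - a 1 * a 2 * x 2 ^ 2),
      -4 * (a 0 * a 1) * (x 1 * x 2) - 2 * (a 2 ^ 2 + a 3 ^ 2) * (x 0 * x 3),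
      2 * (a 0 ^ 2 - a 1 ^ 2) * (x 0 * x 1) - 2 * (a 2 ^ 2 - a 3 ^ 2) * (x 2 * x 3)],
    ![2 * (a 0 ^ 2 + a 1 ^ 2) * (x 0 * x 2) + 4 * (a 2 * a 3) * (x 1 * x 3),
      2 * (a 0 * a 2 * x 3 ^ 2 + a 0 * a 3 * x 0 ^ 2 - a 1 * a 2 * x 1 ^ 2 - a 1 * a 3 * x 2 ^ 2),
      2 * (a 0 * a 2 * x 1 ^ 2 - a 0 * a 3 * x 2 ^ 2 + a 1 * a 2 * x 3 ^ 2 - a 1 * a 3 * x 0 ^ 2),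
      -4 * (a 0 * a 1) * (x 0 * x 3) - 2 * (a 2 ^ 2 + a 3 ^ 2) * (x 1 * x 2),
      2 * (a 0 ^ 2 - a 1 ^ 2) * (x 2 * x 3) + 2 * (a 2 ^ 2 - a 3 ^ 2) * (x 0 * x 1)]) := by
  obtain ⟨h1, h2, h3, h4, h5, h6, h7, h8, h9, h10, h11, h12, h13, h14, h15, h16, h17, h18, h19,
    h20, h21, h22, h23, h24, h25, h26, h27, h28, h29, h30, h31, h32⟩ := toSpinor_cartan a x
  have comm := Finset.insert_comm (α := Fin 5)
  have pair := Finset.pair_comm (α := Fin 5)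
  unfold gammaAt gamma
  set ψ := toSpinor (cartan a) x
  refine Prod.ext ?_ ?_ <;> funext i <;>
    simp only [pairing_eq, h1, h2, h3, h4, h5, h6, h7, h8, h9, h10, h11, h12, h13, h14, h15, h16,
      h17, h18, h19, h20, h21, h22, h23, h24, h25, h26, h27, h28, h29, h30, h31, h32, mul_zero,
      add_zero, sub_zero, zero_add]
  all_goals
    fin_cases i <;>
    simp +decide [contract, wedge, insertSign, Finset.erase_insert_of_ne,
      comm 1 0, comm 2 0, comm 2 1, comm 3 0, comm 3 1, comm 3 2, comm 4 0, comm 4 1, comm 4 2,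
      pair 1 0, pair 2 0, pair 2 1, pair 3 0, pair 3 1, pair 3 2, pair 4 0, pair 4 1, pair 4 2,
      pair 4 3, Finset.filter_insert, Finset.filter_singleton, h1, h7, h8, h9, h10, h11, h12, h13,
      h14, h15, h16, h27, h28, h29, h30, h31] <;>
    ring

theorem quadraticSection_eq (a : Fin 4 → ℂ) :
    quadraticSection a = quadraticComplex (invariantQuartics (heisenbergCoord a)) := by
  have hI := Complex.I_mul_I
  have h2 : Complex.I ^ 2 = -1 := Complex.I_sq
  have h4 : Complex.I ^ 4 = 1 := Complex.I_pow_four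
  funext x y
  rw [quadraticSection, gammaAt_eq, gammaAt_eq]
  simp [bilinForm, Fin.sum_univ_five, quadraticComplex, invariantQuartics, heisenbergCoord,
    pluecker, mul_pow, h2, h4]
  linear_combination (a 0 - a 1) * (a 0 + a 1) * (a 2 - a 3) * (a 2 + a 3) * (-4) *
    ((x 0 * y 1 - x 1 * y 0) ^ 2 - (x 2 * y 3 - x 3 * y 2) ^ 2) * hI

theorem span_invariantQuartics : Submodule.span ℂ (Set.range invariantQuartics) = ⊤ := by
  rw [eq_top_iff]
  have mem : ∀ b c, invariantQuartics b = c →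
      c ∈ Submodule.span ℂ (Set.range invariantQuartics) :=
    fun b c h => Submodule.subset_span ⟨b, h⟩
  have h0 := mem ![1, 0, 0, 0] ![1, 0, 0, 0, 0]
    (by funext i; fin_cases i <;> simp [invariantQuartics])
  have h2 := mem ![1, 1, 0, 0] ![2, 0, 1, 0, 0]
    (by funext i; fin_cases i <;> simp [invariantQuartics]; all_goals norm_num)
  have h3 := mem ![1, 0, 1, 0] ![2, 0, 0, 1, 0]
    (by funext i; fin_cases i <;> simp [invariantQuartics]; all_goals norm_num)
  have h4 := mem ![1, 0, 0, 1] ![2, 0, 0, 0, 1]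
    (by funext i; fin_cases i <;> simp [invariantQuartics]; all_goals norm_num)
  have h1 := mem ![1, 1, 1, 1] ![4, 1, 2, 2, 2]
    (by funext i; fin_cases i <;> simp [invariantQuartics]; all_goals norm_num)
  intro c _
  have hc : c = (c 0 - 4 * c 1 - 2 * (c 2 - 2 * c 1) - 2 * (c 3 - 2 * c 1) - 2 * (c 4 - 2 * c 1)) •
      (![1, 0, 0, 0, 0] : Fin 5 → ℂ) + c 1 • (![4, 1, 2, 2, 2] : Fin 5 → ℂ) +
      (c 2 - 2 * c 1) • (![2, 0, 1, 0, 0] : Fin 5 → ℂ) +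
      (c 3 - 2 * c 1) • (![2, 0, 0, 1, 0] : Fin 5 → ℂ) +
      (c 4 - 2 * c 1) • (![2, 0, 0, 0, 1] : Fin 5 → ℂ) := by
    funext i
    fin_cases i <;> simp <;> ring
  rw [hc]
  exact add_mem (add_mem (add_mem (add_mem (Submodule.smul_mem _ _ h0) (Submodule.smul_mem _ _ h1))
    (Submodule.smul_mem _ _ h2)) (Submodule.smul_mem _ _ h3)) (Submodule.smul_mem _ _ h4)

theorem U5_eq_range : U5 = LinearMap.range quadraticComplex := by
  have h : quadraticSection = quadraticComplex ∘ invariantQuartics ∘ heisenbergCoord :=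
    funext quadraticSection_eq
  rw [U5, h, Set.range_comp, Set.range_comp, heisenbergCoord.surjective.range_eq, Set.image_univ,
    Submodule.span_image, span_invariantQuartics, LinearMap.range_eq_map]

/-- The coordinates on `U₅` given by the basis of quadratic sections `quadraticComplex`. -/
def coordU5 : U5 ≃ₗ[ℂ] (Fin 5 → ℂ) :=
  (LinearEquiv.ofEq _ _ U5_eq_range).trans
    (LinearEquiv.ofInjective quadraticComplex quadraticComplex_injective).symm

theorem coordU5_theta (a : Fin 4 → ℂ) :
    coordU5 (theta a) = invariantQuartics (heisenbergCoord a) := by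
  rw [coordU5, LinearEquiv.trans_apply, LinearEquiv.symm_apply_eq]
  apply Subtype.ext
  exact quadraticSection_eq a

theorem finrank_U5 : Module.finrank ℂ U5 = 5 := by
  rw [coordU5.finrank_eq, Module.finrank_fin_fun]

/-! ### Equivariance -/

/-- If the image of `f` spans `V`, the linear maps of `V` compatible with the elements of `W` are
unique, and hence form a representation. -/
theorem isEquivariant_of_exists {V : Type*} [AddCommGroup V] [Module ℂ V]
    {W : Subgroup (GL (Fin 4) ℂ)} {f : (Fin 4 → ℂ) → V}
    (hf : Submodule.span ℂ (Set.range f) = ⊤)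
    (h : ∀ w ∈ W, ∃ T : V →ₗ[ℂ] V, ∀ a,
      f ((w : Matrix (Fin 4) (Fin 4) ℂ).mulVec a) = T (f a)) : IsEquivariant W f := by
  choose! T hT using h
  have ext : ∀ S S' : V →ₗ[ℂ] V, (∀ a, S (f a) = S' (f a)) → S = S' := fun S S' H =>
    LinearMap.ext_on_range hf H
  refine ⟨{ toFun := fun w => T w, map_one' := ?_, map_mul' := ?_ }, fun w a => hT w w.2 a⟩
  · refine ext _ _ fun a => ?_
    rw [← hT _ (1 : W).2]
    simp
  · intro w w'
    refine ext _ _ fun a => ?_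
    rw [← hT _ (w * w').2, Module.End.mul_apply, ← hT _ w'.2, ← hT _ w.2, Matrix.mulVec_mulVec]
    simp

theorem span_theta : Submodule.span ℂ (Set.range theta) = ⊤ := by
  have h : coordU5 ∘ theta = invariantQuartics ∘ heisenbergCoord := funext coordU5_theta
  have h' : theta = coordU5.symm ∘ invariantQuartics ∘ heisenbergCoord := by
    rw [← h]
    funext a
    simp
  rw [h', Set.range_comp, Set.range_comp, heisenbergCoord.surjective.range_eq, Set.image_univ]
  have := Submodule.span_image (s := Set.range invariantQuartics) coordU5.symm.toLinearMap
  rw [span_invariantQuartics, Submodule.map_top, LinearEquiv.range] at this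
  exact this

theorem toSpinor_tensorAct (g : Matrix (Fin 4) (Fin 4) ℂ) (h : Spinor ≃ₗ[ℂ] Spinor)
    (t : Fin 4 → Spinor) (x : Fin 4 → ℂ) :
    toSpinor (tensorAct g h t) x = h (toSpinor t (Matrix.vecMul x g)) := by
  simp only [toSpinor, tensorAct, map_sum, map_smul, Finset.smul_sum, smul_smul, Matrix.vecMul,
    dotProduct, Finset.sum_smul]
  exact Finset.sum_comm

/-- An element `(g, h)` of `SL₄ × Spin₁₀` acts on the quadratic sections of `G(2,4)` through the
substitution `(x, y) ↦ (ᵗg x, ᵗg y)`. -/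
theorem isEquivariant_littleWeylGroup : IsEquivariant littleWeylGroup theta := by
  refine isEquivariant_of_exists span_theta ?_
  rintro w ⟨g, h, hh, H⟩
  let S : BiquadraticForm →ₗ[ℂ] BiquadraticForm :=
    { toFun := fun B x y => B (Matrix.vecMul x g.1) (Matrix.vecMul y g.1)
      map_add' := fun _ _ => rfl
      map_smul' := fun _ _ => rfl }
  have hS : ∀ a, quadraticSection ((w : Matrix (Fin 4) (Fin 4) ℂ).mulVec a) =
      S (quadraticSection a) := by
    intro a
    funext x y
    change bilinForm (gammaAt _ x) (gammaAt _ y) = bilinForm (gammaAt _ _) (gammaAt _ _)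
    simp only [gammaAt, H, toSpinor_tensorAct]
    exact bilinForm_gamma_spin hh _ _
  have hU : ∀ B ∈ U5, S B ∈ U5 := by
    intro B hB
    refine (Submodule.span_le.mpr ?_ : U5 ≤ U5.comap S) hB
    rintro _ ⟨a, rfl⟩
    rw [SetLike.mem_coe, Submodule.mem_comap, ← hS]
    exact Submodule.subset_span ⟨_, rfl⟩
  exact ⟨S.restrict hU, fun a => Subtype.ext (hS a)⟩

/-- The coordinates `t₀, …, t₅` on `U₅` in which the image of `Θ` is the Igusa quartic. Each
difference `tᵢ - tⱼ` is, on `𝔠`, a product of four linear forms. -/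
def igusaCoord : (Fin 5 → ℂ) ≃ₗ[ℂ] sumZero where
  toFun c := ⟨![2 * c 0 + 24 * c 1, 2 * c 0 - 24 * c 1, -c 0 + 6 * (c 2 + c 3 + c 4),
    -c 0 + 6 * (c 2 - c 3 - c 4), -c 0 + 6 * (c 4 - c 2 - c 3), -c 0 + 6 * (c 3 - c 2 - c 4)], by
      change ∑ i, _ = (0 : ℂ)
      simp [Fin.sum_univ_six]
      ring⟩
  invFun t := ![(t.1 0 + t.1 1) / 4, (t.1 0 - t.1 1) / 48,
    (t.1 2 + t.1 3 + (t.1 0 + t.1 1) / 2) / 12, (t.1 2 + t.1 5 + (t.1 0 + t.1 1) / 2) / 12,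
    (t.1 2 + t.1 4 + (t.1 0 + t.1 1) / 2) / 12]
  map_add' c d := by
    apply Subtype.ext
    funext i
    fin_cases i <;> simp <;> ring
  map_smul' k c := by
    apply Subtype.ext
    funext i
    fin_cases i <;> simp <;> ring
  left_inv c := by
    funext i
    fin_cases i <;> simp <;> ring
  right_inv t := by
    have ht : ∑ i, t.1 i = 0 := t.2
    rw [Fin.sum_univ_six] at ht
    apply Subtype.ext
    funext i
    fin_cases i <;> simp
    · ring
    · ring
    · linear_combination ht / 2
    · linear_combination -ht / 2
    · linear_combination -ht / 2
    · linear_combination -ht / 2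

/-- The composition of `Θ` with coordinates on `𝔠` and `U₅`. -/
def igusaMap (b : Fin 4 → ℂ) : sumZero := igusaCoord (invariantQuartics b)

/-- The identification of `U₅` with the hyperplane `∑ tᵢ = 0`. -/
def identU5 : U5 ≃ₗ[ℂ] sumZero := coordU5.trans igusaCoord

theorem identU5_theta (a : Fin 4 → ℂ) : identU5 (theta a) = igusaMap (heisenbergCoord a) := by
  rw [identU5, LinearEquiv.trans_apply, coordU5_theta]
  rfl

/-- The action of the symmetric group `S₆` on the hyperplane `∑ tᵢ = 0`. -/
def permSumZero (σ : Equiv.Perm (Fin 6)) : sumZero ≃ₗ[ℂ] sumZero where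
  toFun t := ⟨fun i => t.1 (σ i), (Equiv.sum_comp σ t.1).trans t.2⟩
  invFun t := ⟨fun i => t.1 (σ.symm i), (Equiv.sum_comp σ.symm t.1).trans t.2⟩
  map_add' _ _ := rfl
  map_smul' _ _ := rfl
  left_inv t := Subtype.ext (funext fun i => congrArg t.1 (σ.apply_symm_apply i))
  right_inv t := Subtype.ext (funext fun i => congrArg t.1 (σ.symm_apply_apply i))

/-- The transpositions by which the five reflections act on the coordinates `t₀, …, t₅`. -/
def reflectionPerm : Fin 5 → Equiv.Perm (Fin 6) :=
  ![Equiv.swap 2 3, Equiv.swap 0 1, Equiv.swap 4 5, Equiv.swap 3 4, Equiv.swap 0 5]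

/-- The quartic forms `t₀, …, t₅` in the coordinates of `𝔠` given by `p₁, …, p₄`. -/
theorem igusaMap_heisenbergCoord (a : Fin 4 → ℂ) : (igusaMap (heisenbergCoord a)).1 =
    let q := 4 * (a 0 ^ 4 + 6 * a 0 ^ 2 * a 1 ^ 2 + a 1 ^ 4 + a 2 ^ 4 + 6 * a 2 ^ 2 * a 3 ^ 2 +
      a 3 ^ 4)
    let r := (a 0 ^ 2 - a 1 ^ 2) ^ 2 - (a 2 ^ 2 - a 3 ^ 2) ^ 2
    let u := (a 0 ^ 2 + a 1 ^ 2) * (a 2 * a 3)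
    let v := a 0 * a 1 * (a 2 ^ 2 + a 3 ^ 2)
    let p := 24 * (Complex.I * ((a 0 ^ 2 - a 1 ^ 2) * (a 2 ^ 2 - a 3 ^ 2)))
    ![q + p, q - p, -q / 2 - 6 * r + 48 * v, -q / 2 - 6 * r - 48 * v, -q / 2 + 6 * r - 48 * u,
      -q / 2 + 6 * r + 48 * u] := by
  have h2 : Complex.I ^ 2 = -1 := Complex.I_sq
  have h4 : Complex.I ^ 4 = 1 := Complex.I_pow_four
  funext i
  fin_cases i <;>
    simp [igusaMap, igusaCoord, invariantQuartics, heisenbergCoord, mul_pow, h2, h4] <;> ring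

theorem igusaMap_reflection (k : Fin 5) (a : Fin 4 → ℂ) :
    igusaMap (heisenbergCoord ((reflectionMatrix k).mulVec a)) =
      permSumZero (reflectionPerm k) (igusaMap (heisenbergCoord a)) := by
  have h2 : Complex.I ^ 2 = -1 := Complex.I_sq
  have h3 : Complex.I ^ 3 = -Complex.I := Complex.I_pow_three
  have h4 : Complex.I ^ 4 = 1 := Complex.I_pow_four
  have h5 : Complex.I ^ 5 = Complex.I := by rw [pow_succ, h4, one_mul]
  apply Subtype.ext
  change _ = fun i => (igusaMap (heisenbergCoord a)).1 (reflectionPerm k i)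
  rw [igusaMap_heisenbergCoord, igusaMap_heisenbergCoord]
  funext i
  fin_cases k <;> fin_cases i <;>
    simp +decide [reflectionMatrix, reflectionPerm, Matrix.mulVec, dotProduct, Fin.sum_univ_four,
      Equiv.swap_apply_def] <;>
    ring_nf <;> simp only [h2, h3, h4, h5] <;> ring

theorem isEquivariant_reflectionGroup : IsEquivariant reflectionGroup theta := by
  refine isEquivariant_of_exists span_theta fun w hw => ?_
  suffices h : ∃ T : U5 ≃ₗ[ℂ] U5, ∀ a,
      theta ((w : Matrix (Fin 4) (Fin 4) ℂ).mulVec a) = T (theta a) from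
    ⟨h.choose.toLinearMap, h.choose_spec⟩
  induction hw using Subgroup.closure_induction with
  | mem w hw =>
    obtain ⟨k, rfl⟩ := hw
    refine ⟨identU5.trans ((permSumZero (reflectionPerm k)).trans identU5.symm), fun a => ?_⟩
    rw [LinearEquiv.trans_apply, LinearEquiv.trans_apply, LinearEquiv.eq_symm_apply,
      identU5_theta, identU5_theta]
    exact igusaMap_reflection k a
  | one => exact ⟨LinearEquiv.refl ℂ U5, fun a => by simp⟩
  | mul w w' _ _ h h' =>
    obtain ⟨T, hT⟩ := h
    obtain ⟨T', hT'⟩ := h'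
    refine ⟨T'.trans T, fun a => ?_⟩
    rw [Units.val_mul, ← Matrix.mulVec_mulVec, hT, hT', LinearEquiv.trans_apply]
  | inv w _ h =>
    obtain ⟨T, hT⟩ := h
    refine ⟨T.symm, fun a => ?_⟩
    rw [LinearEquiv.eq_symm_apply, ← hT, Matrix.mulVec_mulVec, ← Units.val_mul, mul_inv_cancel,
      Units.val_one, Matrix.one_mulVec]

/-! ### The image of `Θ` -/

theorem igusaMap_apply (b : Fin 4 → ℂ) : (igusaMap b).1 =
    let A := b 0 ^ 4 + b 1 ^ 4 + b 2 ^ 4 + b 3 ^ 4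
    let p := b 0 * b 1 * b 2 * b 3
    let B₁ := b 0 ^ 2 * b 1 ^ 2 + b 2 ^ 2 * b 3 ^ 2
    let B₂ := b 0 ^ 2 * b 2 ^ 2 + b 1 ^ 2 * b 3 ^ 2
    let B₃ := b 0 ^ 2 * b 3 ^ 2 + b 1 ^ 2 * b 2 ^ 2
    ![2 * A + 24 * p, 2 * A - 24 * p, -A + 6 * (B₁ + B₂ + B₃), -A + 6 * (B₁ - B₂ - B₃),
      -A + 6 * (B₃ - B₁ - B₂), -A + 6 * (B₂ - B₁ - B₃)] := rfl

theorem invariantQuartics_smul (c : ℂ) (b : Fin 4 → ℂ) :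
    invariantQuartics (c • b) = c ^ 4 • invariantQuartics b := by
  funext i
  fin_cases i <;> simp [invariantQuartics] <;> ring

theorem igusaMap_smul (c : ℂ) (b : Fin 4 → ℂ) : igusaMap (c • b) = c ^ 4 • igusaMap b := by
  rw [igusaMap, invariantQuartics_smul, map_smul]
  rfl

theorem eq_zero_of_invariantQuartics {b : Fin 4 → ℂ} (h : invariantQuartics b = 0) : b = 0 := by
  have hA := congrFun h 0
  have h1 := congrFun h 1
  have h2 := congrFun h 2
  have h3 := congrFun h 3
  have h4 := congrFun h 4
  simp [invariantQuartics] at hA h1 h2 h3 h4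
  have key : b 0 = 0 ∧ b 1 = 0 ∧ b 2 = 0 ∧ b 3 = 0 := by
    rcases h1 with ((h | h) | h) | h <;> simp [h] at hA h2 h3 h4 <;>
      rcases h2 with h2 | h2 <;> rcases h3 with h3 | h3 <;> rcases h4 with h4 | h4 <;> simp_all
  funext i
  fin_cases i
  exacts [key.1, key.2.1, key.2.2.1, key.2.2.2]

theorem igusaMap_ne_zero {b : Fin 4 → ℂ} (hb : b ≠ 0) : igusaMap b ≠ 0 := fun h =>
  hb (eq_zero_of_invariantQuartics (igusaCoord.map_eq_zero_iff.mp h))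

theorem eval_crForm (t : Fin 6 → ℂ) :
    MvPolynomial.eval t crForm = (∑ i, t i ^ 2) ^ 2 - 4 * ∑ i, t i ^ 4 := by
  simp [crForm]

/-- The equation of the Igusa quartic in the coordinates given by `invariantQuartics`. -/
theorem eval_crForm_igusaCoord (c : Fin 5 → ℂ) :
    MvPolynomial.eval (igusaCoord c).1 crForm = -82944 *
      (c 0 ^ 2 * c 1 ^ 2 - c 0 * c 2 * c 3 * c 4 + 16 * c 1 ^ 4 +
      c 2 ^ 2 * c 3 ^ 2 + c 2 ^ 2 * c 4 ^ 2 + c 3 ^ 2 * c 4 ^ 2 -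
      4 * c 1 ^ 2 * (c 2 ^ 2 + c 3 ^ 2 + c 4 ^ 2)) := by
  rw [eval_crForm]
  simp [igusaCoord, Fin.sum_univ_six]
  ring

theorem eval_crForm_igusaMap (b : Fin 4 → ℂ) :
    MvPolynomial.eval (igusaMap b).1 crForm = 0 := by
  rw [igusaMap, eval_crForm_igusaCoord]
  simp [invariantQuartics]
  ring

theorem exists_sq_eq (z : ℂ) : ∃ w : ℂ, w ^ 2 = z := by
  obtain ⟨w, hw⟩ := IsAlgClosed.exists_pow_nat_eq z (n := 2) two_pos
  exact ⟨w, hw⟩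

theorem exists_sum_prod (s p : ℂ) : ∃ u v : ℂ, u + v = s ∧ u * v = p := by
  obtain ⟨d, hd⟩ := exists_sq_eq (s ^ 2 - 4 * p)
  exact ⟨(s + d) / 2, (s - d) / 2, by ring, by linear_combination -hd / 4⟩

/-- The equation of the quartic, where `c₁ ≠ 0`: with `c₂ / c₁ = u₁ + u₁⁻¹` and so on, the quartic
is a product of two factors, `c₀ / c₁ - ∑ u₁^± u₂^± u₃^±`, over an even, respectively odd, number
of minus signs. Exchanging `u₃` and `u₃⁻¹` if necessary, the first factor vanishes, and a preimage
is a point with `b₀b₁ / b₂b₃ = u₁`, `b₀b₂ / b₁b₃ = u₂` and `b₀b₃ / b₁b₂ = u₃`. -/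
theorem exists_invariantQuartics_of_ne_zero {c : Fin 5 → ℂ} (h1 : c 1 ≠ 0)
    (hc : c 0 ^ 2 * c 1 ^ 2 - c 0 * c 2 * c 3 * c 4 + 16 * c 1 ^ 4 +
      c 2 ^ 2 * c 3 ^ 2 + c 2 ^ 2 * c 4 ^ 2 + c 3 ^ 2 * c 4 ^ 2 -
      4 * c 1 ^ 2 * (c 2 ^ 2 + c 3 ^ 2 + c 4 ^ 2) = 0) :
    ∃ b : Fin 4 → ℂ, ∃ k : ℂ, k ≠ 0 ∧ invariantQuartics b = k • c := by
  obtain ⟨u₁, v₁, s₁, p₁⟩ := exists_sum_prod (c 2 / c 1) 1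
  obtain ⟨u₂, v₂, s₂, p₂⟩ := exists_sum_prod (c 3 / c 1) 1
  have e2 : c 2 = (u₁ + v₁) * c 1 := by rw [s₁]; field_simp
  have e3 : c 3 = (u₂ + v₂) * c 1 := by rw [s₂]; field_simp
  obtain ⟨u₃, v₃, e4, p₃, e0⟩ : ∃ u₃ v₃ : ℂ, c 4 = (u₃ + v₃) * c 1 ∧ u₃ * v₃ = 1 ∧
      c 0 = (u₁ * u₂ * u₃ + u₁ * v₂ * v₃ + u₂ * v₁ * v₃ + u₃ * v₁ * v₂) * c 1 := by
    obtain ⟨u₃, v₃, s₃, p₃⟩ := exists_sum_prod (c 4 / c 1) 1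
    have e4 : c 4 = (u₃ + v₃) * c 1 := by rw [s₃]; field_simp
    have hprod : c 1 ^ 2 * ((c 0 -
        (u₁ * u₂ * u₃ + u₁ * v₂ * v₃ + u₂ * v₁ * v₃ + u₃ * v₁ * v₂) * c 1) * (c 0 -
        (u₁ * u₂ * v₃ + u₁ * v₂ * u₃ + u₂ * v₁ * u₃ + v₃ * v₁ * v₂) * c 1)) = 0 := by
      have hom : (u₁ * u₂ * u₃ + u₁ * v₂ * v₃ + u₂ * v₁ * v₃ + u₃ * v₁ * v₂) *
          (u₁ * u₂ * v₃ + u₁ * v₂ * u₃ + u₂ * v₁ * u₃ + v₃ * v₁ * v₂) =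
          16 * (u₁ * v₁) * (u₂ * v₂) * (u₃ * v₃) + (u₁ + v₁) ^ 2 * (u₂ + v₂) ^ 2 * (u₃ * v₃) +
          (u₁ + v₁) ^ 2 * (u₃ + v₃) ^ 2 * (u₂ * v₂) + (u₂ + v₂) ^ 2 * (u₃ + v₃) ^ 2 * (u₁ * v₁) -
          4 * ((u₁ + v₁) ^ 2 * (u₂ * v₂) * (u₃ * v₃) + (u₂ + v₂) ^ 2 * (u₁ * v₁) * (u₃ * v₃) +
          (u₃ + v₃) ^ 2 * (u₁ * v₁) * (u₂ * v₂)) := by ring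
      rw [p₁, p₂, p₃] at hom
      rw [e2, e3, e4] at hc
      linear_combination hc + c 1 ^ 4 * hom
    rcases mul_eq_zero.mp ((mul_eq_zero.mp hprod).resolve_left (pow_ne_zero 2 h1)) with h | h
    · exact ⟨u₃, v₃, e4, p₃, sub_eq_zero.mp h⟩
    · exact ⟨v₃, u₃, by rw [e4]; ring, by rw [mul_comm]; exact p₃, sub_eq_zero.mp h⟩
  obtain ⟨x, hx⟩ := exists_sq_eq (u₁ * u₂)
  obtain ⟨y, hy⟩ := exists_sq_eq (u₁ * v₃)
  have hz : (x * y * v₁) ^ 2 = u₂ * v₃ := by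
    rw [mul_pow, mul_pow, hx, hy]
    linear_combination u₂ * v₃ * (u₁ * v₁ + 1) * p₁
  have hu : u₁ * u₂ * v₃ ≠ 0 := by
    intro h
    have : (1 : ℂ) = 0 := by linear_combination v₁ * v₂ * u₃ * h - p₁ - u₁ * v₁ * p₂ -
      u₁ * v₁ * u₂ * v₂ * p₃
    exact one_ne_zero this
  refine ⟨![x, y, x * y * v₁, 1], u₁ * u₂ * v₃ / c 1, div_ne_zero hu h1, ?_⟩
  have hk : ∀ z : ℂ, u₁ * u₂ * v₃ / c 1 * (z * c 1) = u₁ * u₂ * v₃ * z := fun z => by field_simp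
  have hx4 : x ^ 4 = (u₁ * u₂) ^ 2 := by rw [← hx]; ring
  have hy4 : y ^ 4 = (u₁ * v₃) ^ 2 := by rw [← hy]; ring
  have hz4 : (x * y * v₁) ^ 4 = (u₂ * v₃) ^ 2 := by rw [← hz]; ring
  funext i
  fin_cases i
  · simp only [invariantQuartics, Fin.zero_eta, Matrix.cons_val_zero, Matrix.cons_val_one,
      Pi.smul_apply, smul_eq_mul, e0, hk, Matrix.cons_val]
    rw [hx4, hy4, hz4]
    linear_combination -(u₁ ^ 2 * u₂ ^ 2 + 1) * p₃ - (u₁ ^ 2 * v₃ ^ 2 + u₃ * v₃) * p₂ -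
      (u₂ ^ 2 * v₃ ^ 2 + u₂ * v₂ * u₃ * v₃) * p₁
  · have := hk 1
    simp only [invariantQuartics, Fin.mk_one, Matrix.cons_val_zero, Matrix.cons_val_one,
      Pi.smul_apply, smul_eq_mul, Matrix.cons_val]
    rw [one_mul, mul_one] at this
    rw [this, ← sub_eq_zero]
    have : x * y * (x * y * v₁) * 1 = x ^ 2 * y ^ 2 * v₁ := by ring
    rw [this, hx, hy]
    linear_combination u₁ * u₂ * v₃ * p₁
  · simp [invariantQuartics, e2, hk, hx, hy, hz]
    linear_combination -u₂ * v₃ * p₁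
  · simp [invariantQuartics, e3, hk, hx, hy, hz]
    linear_combination -u₁ * v₃ * p₂
  · simp [invariantQuartics, e4, hk, hx, hy, hz]
    linear_combination -u₁ * u₂ * p₃

theorem exists_sq_add_sq_mul (A B : ℂ) :
    ∃ x y : ℂ, x ^ 4 + y ^ 4 = A ∧ x ^ 2 * y ^ 2 = B := by
  obtain ⟨m, hm⟩ := exists_sq_eq (A + 2 * B)
  obtain ⟨s, s', hs, hp⟩ := exists_sum_prod m B
  obtain ⟨x, rfl⟩ := exists_sq_eq s
  obtain ⟨y, rfl⟩ := exists_sq_eq s'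
  refine ⟨x, y, ?_, hp⟩
  rw [← hs] at hm
  linear_combination hm - 2 * hp

/-- The equation of the quartic, where `c₁ = 0`: there is a preimage with `b₃ = 0` if `c₂, c₃, c₄`
are not zero; otherwise two of them vanish, and there is a preimage with two zero coordinates. -/
theorem exists_invariantQuartics_of_eq_zero {c : Fin 5 → ℂ} (h1 : c 1 = 0)
    (hc : c 0 * c 2 * c 3 * c 4 =
      c 2 ^ 2 * c 3 ^ 2 + c 2 ^ 2 * c 4 ^ 2 + c 3 ^ 2 * c 4 ^ 2) :
    ∃ b : Fin 4 → ℂ, invariantQuartics b = c := by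
  have ext : ∀ b, (invariantQuartics b 0 = c 0 ∧ invariantQuartics b 1 = c 1 ∧
      invariantQuartics b 2 = c 2 ∧ invariantQuartics b 3 = c 3 ∧ invariantQuartics b 4 = c 4) →
      ∃ b : Fin 4 → ℂ, invariantQuartics b = c := by
    rintro b ⟨e0, e1, e2, e3, e4⟩
    refine ⟨b, ?_⟩
    funext i
    fin_cases i
    exacts [e0, e1, e2, e3, e4]
  by_cases h : c 2 ≠ 0 ∧ c 3 ≠ 0 ∧ c 4 ≠ 0
  · obtain ⟨h2, h3, h4⟩ := h
    obtain ⟨s, hs⟩ := exists_sq_eq (c 2 * c 3 / c 4)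
    have hs0 : s ≠ 0 := by
      rintro rfl
      have : c 2 * c 3 / c 4 ≠ 0 := div_ne_zero (mul_ne_zero h2 h3) h4
      exact this (by rw [← hs]; ring)
    obtain ⟨x, hx⟩ := exists_sq_eq s
    obtain ⟨y, hy⟩ := exists_sq_eq (c 2 / s)
    obtain ⟨z, hz⟩ := exists_sq_eq (c 3 / s)
    have hs' : s ^ 2 * c 4 = c 2 * c 3 := by rw [hs]; field_simp
    refine ext ![x, y, z, 0] ⟨?_, ?_, ?_, ?_, ?_⟩
    · have e : x ^ 4 + y ^ 4 + z ^ 4 = s ^ 2 + (c 2 / s) ^ 2 + (c 3 / s) ^ 2 := by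
        linear_combination (x ^ 2 + s) * hx + (y ^ 2 + c 2 / s) * hy + (z ^ 2 + c 3 / s) * hz
      simp [invariantQuartics]
      rw [e, div_pow, div_pow, hs]
      field_simp
      linear_combination -hc
    · simp [invariantQuartics, h1]
    · simp [invariantQuartics, hx, hy]
      field_simp
    · simp [invariantQuartics, hx, hz]
      field_simp
    · simp [invariantQuartics, hy, hz]
      field_simp
      linear_combination -hs'
  · have hcases : (c 2 = 0 ∧ c 3 = 0) ∨ (c 2 = 0 ∧ c 4 = 0) ∨ (c 3 = 0 ∧ c 4 = 0) := by
      by_cases h2 : c 2 = 0 <;> by_cases h3 : c 3 = 0 <;> by_cases h4 : c 4 = 0 <;>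
        simp_all
    rcases hcases with ⟨ha, hb⟩ | ⟨ha, hb⟩ | ⟨ha, hb⟩
    · obtain ⟨x, y, hA, hB⟩ := exists_sq_add_sq_mul (c 0) (c 4)
      exact ext ![0, x, y, 0] (by simp [invariantQuartics, ha, hb, h1, hA, hB])
    · obtain ⟨x, y, hA, hB⟩ := exists_sq_add_sq_mul (c 0) (c 3)
      exact ext ![x, 0, y, 0] (by simp [invariantQuartics, ha, hb, h1, hA, hB])
    · obtain ⟨x, y, hA, hB⟩ := exists_sq_add_sq_mul (c 0) (c 2)
      exact ext ![x, y, 0, 0] (by simp [invariantQuartics, ha, hb, h1, hA, hB])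

/-- Every point of the Igusa quartic is in the image. -/
theorem exists_igusaMap {t : sumZero} (ht : MvPolynomial.eval t.1 crForm = 0) :
    ∃ b : Fin 4 → ℂ, ∃ k : ℂ, k ≠ 0 ∧ igusaMap b = k • t := by
  obtain ⟨c, rfl⟩ := igusaCoord.surjective t
  rw [eval_crForm_igusaCoord] at ht
  have hc := (mul_eq_zero.mp ht).resolve_left (by norm_num)
  suffices h : ∃ b : Fin 4 → ℂ, ∃ k : ℂ, k ≠ 0 ∧ invariantQuartics b = k • c by
    obtain ⟨b, k, hk, h⟩ := h
    exact ⟨b, k, hk, by rw [igusaMap, h, map_smul]⟩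
  by_cases h1 : c 1 = 0
  · obtain ⟨b, hb⟩ := exists_invariantQuartics_of_eq_zero h1
      (by rw [h1] at hc; linear_combination -hc)
    exact ⟨b, 1, one_ne_zero, by rw [hb, one_smul]⟩
  · exact exists_invariantQuartics_of_ne_zero h1 hc

/-! ### The singular lines of the Igusa quartic -/

/-- The fifteen partitions of `{0, …, 5}` in three pairs, seen as maps to `Fin 3`. -/
def syntheme : Fin 15 → Fin 6 → Fin 3 :=
  ![![0, 0, 1, 1, 2, 2], ![0, 1, 0, 1, 2, 2], ![0, 1, 1, 0, 2, 2], ![0, 1, 2, 2, 0, 1],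
    ![0, 1, 2, 2, 1, 0], ![0, 0, 1, 2, 2, 1], ![0, 1, 0, 2, 2, 1], ![0, 1, 1, 2, 2, 0],
    ![0, 1, 2, 1, 0, 2], ![0, 1, 2, 0, 1, 2], ![0, 0, 1, 2, 1, 2], ![0, 1, 0, 2, 1, 2],
    ![0, 1, 1, 2, 0, 2], ![0, 1, 2, 0, 2, 1], ![0, 1, 2, 1, 2, 0]]

/-- The line of `CR₄` attached to a partition of the coordinates in pairs. -/
def synthemeLine (k : Fin 15) : Submodule ℂ sumZero where
  carrier := {t | ∀ i j, syntheme k i = syntheme k j → t.1 i = t.1 j}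
  add_mem' := fun hs ht i j h => congrArg₂ (· + ·) (hs i j h) (ht i j h)
  zero_mem' := fun _ _ _ => rfl
  smul_mem' := fun c _ ht i j h => congrArg (c * ·) (ht i j h)

theorem sum_syntheme (k : Fin 15) (F : Fin 3 → ℂ) :
    ∑ i, F (syntheme k i) = 2 * (F 0 + F 1 + F 2) := by
  fin_cases k <;> simp [syntheme, Fin.sum_univ_six] <;> ring

theorem syntheme_surjective : ∀ k, ∀ j : Fin 3, ∃ i, syntheme k i = j := by decide

/-- The parametrization of `synthemeLine k` by the values on the three pairs. -/
def synthemeParam (k : Fin 15) : (Fin 2 → ℂ) →ₗ[ℂ] sumZero where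
  toFun v := ⟨fun i => (![v 0, v 1, -(v 0 + v 1)] : Fin 3 → ℂ) (syntheme k i), by
    change ∑ i, _ = (0 : ℂ)
    rw [sum_syntheme]
    simp⟩
  map_add' v w := by
    apply Subtype.ext
    funext i
    change _ = (![v 0, v 1, -(v 0 + v 1)] : Fin 3 → ℂ) (syntheme k i) +
      (![w 0, w 1, -(w 0 + w 1)] : Fin 3 → ℂ) (syntheme k i)
    dsimp only
    generalize syntheme k i = j
    fin_cases j <;> simp
    ring
  map_smul' c v := by
    apply Subtype.ext
    funext i
    change _ = c * (![v 0, v 1, -(v 0 + v 1)] : Fin 3 → ℂ) (syntheme k i)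
    dsimp only
    generalize syntheme k i = j
    fin_cases j <;> simp
    ring

theorem synthemeParam_injective (k : Fin 15) : Function.Injective (synthemeParam k) := by
  rw [injective_iff_map_eq_zero]
  intro v hv
  have h : ∀ j : Fin 3, (![v 0, v 1, -(v 0 + v 1)] : Fin 3 → ℂ) j = 0 := by
    intro j
    obtain ⟨i, rfl⟩ := syntheme_surjective k j
    exact congrFun (congrArg Subtype.val hv) i
  funext i
  fin_cases i
  exacts [h 0, h 1]

theorem exists_of_mem_synthemeLine {k : Fin 15} {t : sumZero} (ht : t ∈ synthemeLine k) :
    ∃ v : Fin 3 → ℂ, v 0 + v 1 + v 2 = 0 ∧ ∀ i, t.1 i = v (syntheme k i) := by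
  choose s hs using syntheme_surjective k
  have hv : ∀ i, t.1 i = t.1 (s (syntheme k i)) := fun i => ht _ _ (hs _).symm
  refine ⟨fun j => t.1 (s j), ?_, hv⟩
  have h0 : ∑ i, t.1 i = 0 := t.2
  have h1 := sum_syntheme k fun j => t.1 (s j)
  rw [← Finset.sum_congr rfl fun i _ => hv i, h0] at h1
  linear_combination -h1 / 2

theorem range_synthemeParam (k : Fin 15) :
    LinearMap.range (synthemeParam k) = synthemeLine k := by
  ext t
  constructor
  · rintro ⟨v, rfl⟩ i j h
    exact congrArg (![v 0, v 1, -(v 0 + v 1)] : Fin 3 → ℂ) h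
  · intro ht
    obtain ⟨v, hv, h⟩ := exists_of_mem_synthemeLine ht
    refine ⟨![v 0, v 1], Subtype.ext (funext fun i => ?_)⟩
    rw [h i]
    change (![v 0, v 1, -(v 0 + v 1)] : Fin 3 → ℂ) (syntheme k i) = _
    rw [← eq_neg_iff_add_eq_zero.mpr ((add_comm _ _).trans hv)]
    generalize syntheme k i = j
    fin_cases j <;> rfl

theorem finrank_synthemeLine (k : Fin 15) : Module.finrank ℂ (synthemeLine k) = 2 := by
  rw [← range_synthemeParam, LinearMap.finrank_range_of_inj (synthemeParam_injective k),
    Module.finrank_fin_fun]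

theorem synthemeLine_injective : Function.Injective synthemeLine := by
  intro k l h
  have hdec : ∀ k l, (∀ i j, syntheme l i = syntheme l j → syntheme k i = syntheme k j) →
      k = l := by decide +kernel
  refine hdec k l fun i j hij => ?_
  have hmem : synthemeParam k ![1, 2] ∈ synthemeLine l := by
    rw [← h, ← range_synthemeParam]
    exact ⟨_, rfl⟩
  have := hmem i j hij
  change (![1, 2, -(1 + 2)] : Fin 3 → ℂ) (syntheme k i) =
    (![1, 2, -(1 + 2)] : Fin 3 → ℂ) (syntheme k j) at this
  generalize syntheme k i = x at this
  generalize syntheme k j = y at this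
  fin_cases x <;> fin_cases y <;> first | rfl | (exfalso; revert this; norm_num)

theorem exists_syntheme_of_even (f : Fin 6 → Fin 3)
    (hf : ∀ m, Even (Finset.univ.filter fun i => f i = m).card) :
    ∃ k, ∀ i j, syntheme k i = syntheme k j → f i = f j := by
  have h : ∀ a₀ a₁ a₂ a₃ a₄ a₅ : Fin 3,
      (∀ m, Even (Finset.univ.filter fun i => ![a₀, a₁, a₂, a₃, a₄, a₅] i = m).card) →
      ∃ k, ∀ i j, syntheme k i = syntheme k j →
        ![a₀, a₁, a₂, a₃, a₄, a₅] i = ![a₀, a₁, a₂, a₃, a₄, a₅] j := by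
    decide +kernel
  have hfe : f = ![f 0, f 1, f 2, f 3, f 4, f 5] := by
    funext i
    fin_cases i <;> rfl
  rw [hfe] at hf ⊢
  exact h _ _ _ _ _ _ hf

theorem sum_comp_eq_sum_card (f : Fin 6 → Fin 3) (F : Fin 3 → ℂ) :
    ∑ i, F (f i) = ∑ m, ((Finset.univ.filter fun i => f i = m).card : ℂ) * F m := by
  rw [← Finset.sum_fiberwise Finset.univ f]
  refine Finset.sum_congr rfl fun m _ => ?_
  rw [Finset.sum_congr rfl (g := fun _ => F m) fun i hi => by rw [(Finset.mem_filter.mp hi).2]]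
  simp

/-- If all `tᵢ` are roots of the cubic polynomial `X³ - (∑ tᵢ²) / 4 X - c`, they coincide in pairs:
the three roots `x, y, z` have sum zero and `∑ tᵢ² = 2 (x² + y² + z²)`, so that the excesses of the
multiplicities over `2` satisfy a Vandermonde system. -/
theorem mem_synthemeLine_of_cubic {t : sumZero} {c : ℂ}
    (h : ∀ i, t.1 i ^ 3 - (∑ i, t.1 i ^ 2) / 4 * t.1 i = c) : ∃ k, t ∈ synthemeLine k := by
  have ht : ∑ i, t.1 i = 0 := t.2
  set σ := ∑ i, t.1 i ^ 2 with hσ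
  obtain ⟨x, y, hx, hxy⟩ : ∃ x y : ℂ, x ^ 3 - σ / 4 * x = c ∧ x ^ 2 + x * y + y ^ 2 = σ / 4 := by
    obtain ⟨y, z, hs, hp⟩ := exists_sum_prod (-t.1 0) (t.1 0 ^ 2 - σ / 4)
    exact ⟨t.1 0, y, h 0, by linear_combination y * hs - hp⟩
  have hroot : ∀ i, t.1 i = x ∨ t.1 i = y ∨ t.1 i = -x - y := by
    intro i
    have : (t.1 i - x) * ((t.1 i - y) * (t.1 i - (-x - y))) = 0 := by
      linear_combination h i - hx + (t.1 i - x) * (-hxy)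
    rcases mul_eq_zero.mp this with h | h
    · exact Or.inl (sub_eq_zero.mp h)
    rcases mul_eq_zero.mp h with h | h
    · exact Or.inr (Or.inl (sub_eq_zero.mp h))
    · exact Or.inr (Or.inr (sub_eq_zero.mp h))
  have all3 : ∀ {P : Fin 3 → Prop}, P 0 → P 1 → P 2 → ∀ m, P m := by
    intro P h0 h1 h2 m
    fin_cases m <;> assumption
  -- It suffices to express `t` through three values of even multiplicity.
  suffices hs : ∃ (v : Fin 3 → ℂ) (f : Fin 6 → Fin 3), (∀ i, t.1 i = v (f i)) ∧
      ∀ m, Even (Finset.univ.filter fun i => f i = m).card by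
    obtain ⟨v, f, hv, he⟩ := hs
    obtain ⟨k, hk⟩ := exists_syntheme_of_even f he
    exact ⟨k, fun i j hij => by rw [hv, hv, hk i j hij]⟩
  have hcount : ∀ f : Fin 6 → Fin 3, (Finset.univ.filter fun i => f i = 0).card +
      (Finset.univ.filter fun i => f i = 1).card + (Finset.univ.filter fun i => f i = 2).card =
        6 := by
    intro f
    have := Finset.card_eq_sum_card_fiberwise (f := f) (s := Finset.univ) (t := Finset.univ)
      (fun _ _ => Finset.mem_univ _)
    rw [Fin.sum_univ_three] at this
    simpa using this.symm
  have hmult : ∀ (v : Fin 3 → ℂ) (f : Fin 6 → Fin 3), (∀ i, t.1 i = v (f i)) →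
      (∑ m, ((Finset.univ.filter fun i => f i = m).card : ℂ) * v m = 0 ∧
      ∑ m, ((Finset.univ.filter fun i => f i = m).card : ℂ) * v m ^ 2 = σ) := by
    intro v f hv
    rw [← sum_comp_eq_sum_card, ← sum_comp_eq_sum_card f fun m => v m ^ 2]
    simp only [← hv]
    exact ⟨ht, rfl⟩
  by_cases hd : x ≠ y ∧ x ≠ -x - y ∧ y ≠ -x - y
  · choose! f hf using fun i => show ∃ m : Fin 3, t.1 i = (![x, y, -x - y] : Fin 3 → ℂ) m from by
      rcases hroot i with h | h | h
      · exact ⟨0, h⟩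
      · exact ⟨1, h⟩
      · exact ⟨2, h⟩
    refine ⟨_, f, hf, ?_⟩
    obtain ⟨e1, e2⟩ := hmult _ f hf
    have e0 := congrArg (Nat.cast : ℕ → ℂ) (hcount f)
    rw [Fin.sum_univ_three] at e1 e2
    push_cast at e0
    simp only [Matrix.cons_val_zero, Matrix.cons_val_one, Matrix.cons_val] at e1 e2
    obtain ⟨d1, d2, d3⟩ := hd
    have two : ∀ n : ℕ, (n : ℂ) = 2 → Even n := fun n hn => by
      have : n = 2 := by exact_mod_cast hn
      rw [this]
      exact even_two
    refine all3 (two _ (sub_eq_zero.mp ?_)) (two _ (sub_eq_zero.mp ?_))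
      (two _ (sub_eq_zero.mp ?_))
    · refine (mul_eq_zero.mp ?_).resolve_right
        (mul_ne_zero (sub_ne_zero.mpr d1) (sub_ne_zero.mpr d2))
      linear_combination e2 - (y + (-x - y)) * e1 + y * (-x - y) * e0 - 4 * hxy
    · refine (mul_eq_zero.mp ?_).resolve_right
        (mul_ne_zero (sub_ne_zero.mpr d1.symm) (sub_ne_zero.mpr d3))
      linear_combination e2 - (x + (-x - y)) * e1 + x * (-x - y) * e0 - 4 * hxy
    · refine (mul_eq_zero.mp ?_).resolve_right
        (mul_ne_zero (sub_ne_zero.mpr d2.symm) (sub_ne_zero.mpr d3.symm))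
      linear_combination e2 - (x + y) * e1 + x * y * e0 - 4 * hxy
  · obtain ⟨w, hw, hval⟩ : ∃ w : ℂ, σ = 12 * w ^ 2 ∧ ∀ i, t.1 i = w ∨ t.1 i = -2 * w := by
      rw [not_and_or, not_and_or, not_not, not_not, not_not] at hd
      rcases hd with hd | hd | hd
      · subst hd
        refine ⟨x, by linear_combination -4 * hxy, fun i => ?_⟩
        rcases hroot i with h | h | h
        exacts [Or.inl h, Or.inl h, Or.inr (by rw [h]; ring)]
      · have hy : y = -2 * x := by linear_combination hd
        refine ⟨x, by rw [hy] at hxy; linear_combination -4 * hxy, fun i => ?_⟩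
        rcases hroot i with h | h | h
        exacts [Or.inl h, Or.inr (by rw [h, hy]), Or.inl (by rw [h, ← hd])]
      · have hx' : x = -2 * y := by linear_combination hd
        refine ⟨y, by rw [hx'] at hxy; linear_combination -4 * hxy, fun i => ?_⟩
        rcases hroot i with h | h | h
        exacts [Or.inr (by rw [h, hx']), Or.inl h, Or.inl (by rw [h, ← hd])]
    rcases eq_or_ne w 0 with rfl | hw0
    · refine ⟨0, fun _ => 0, fun i => ?_, by decide⟩
      rcases hval i with h | h <;> simp [h]
    · choose! f hf hf2 using fun i => show ∃ m : Fin 3, t.1 i = (![w, -2 * w, 0] : Fin 3 → ℂ) m ∧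
          m ≠ 2 from by
        rcases hval i with h | h
        · exact ⟨0, h, by decide⟩
        · exact ⟨1, h, by decide⟩
      refine ⟨_, f, hf, ?_⟩
      have e1 := (hmult _ f hf).1
      have e0 := hcount f
      have e2 : (Finset.univ.filter fun i => f i = 2).card = 0 := by
        rw [Finset.card_eq_zero, Finset.filter_eq_empty_iff]
        exact fun i _ => hf2 i
      rw [Fin.sum_univ_three] at e1
      simp only [Matrix.cons_val_zero, Matrix.cons_val_one, Matrix.cons_val] at e1
      have e3 : (((Finset.univ.filter fun i => f i = 0).card : ℕ) : ℂ) =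
          ((2 * (Finset.univ.filter fun i => f i = 1).card : ℕ) : ℂ) := by
        refine mul_right_cancel₀ hw0 ?_
        push_cast
        linear_combination e1
      have e3 := Nat.cast_injective e3
      exact all3 ⟨2, by omega⟩ ⟨1, by omega⟩ ⟨0, by omega⟩

theorem eval_pderiv_crForm (t : Fin 6 → ℂ) (i : Fin 6) :
    MvPolynomial.eval t (MvPolynomial.pderiv i crForm) =
      16 * ((∑ j, t j ^ 2) / 4 * t i - t i ^ 3) := by
  have h4 : MvPolynomial.pderiv i (4 : MvPolynomial (Fin 6) ℂ) = 0 := by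
    have : (4 : MvPolynomial (Fin 6) ℂ) = MvPolynomial.C 4 := (map_ofNat MvPolynomial.C 4).symm
    rw [this, MvPolynomial.pderiv_C]
  simp [crForm, MvPolynomial.pderiv_X, h4, Pi.single_apply, map_sum]
  ring

/-- The singular points of the affine cone over `CR₄`. -/
theorem singular_iff {t : sumZero} : (MvPolynomial.eval t.1 crForm = 0 ∧ ∀ v : sumZero,
    ∑ i, v.1 i * MvPolynomial.eval t.1 (MvPolynomial.pderiv i crForm) = 0) ↔
      ∃ k, t ∈ synthemeLine k := by
  simp only [eval_pderiv_crForm, eval_crForm]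
  constructor
  · rintro ⟨-, h⟩
    refine mem_synthemeLine_of_cubic (c := t.1 0 ^ 3 - (∑ i, t.1 i ^ 2) / 4 * t.1 0) fun i => ?_
    have hv : (Pi.single i 1 - Pi.single 0 1 : Fin 6 → ℂ) ∈ sumZero := by
      change ∑ j, _ = (0 : ℂ)
      simp
    have := h ⟨_, hv⟩
    simp only [Pi.sub_apply, sub_mul, Finset.sum_sub_distrib, Pi.single_apply, ite_mul, one_mul,
      zero_mul, Finset.sum_ite_eq', Finset.mem_univ, if_true] at this
    linear_combination -this / 16
  · rintro ⟨k, hk⟩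
    obtain ⟨v, hv, h⟩ := exists_of_mem_synthemeLine hk
    have hv2 : v 2 = -v 0 - v 1 := by linear_combination hv
    simp only [h]
    rw [sum_syntheme k fun m => v m ^ 2, sum_syntheme k fun m => v m ^ 4]
    refine ⟨by rw [hv2]; ring, fun u => ?_⟩
    have hconst : ∀ m, 16 * (2 * (v 0 ^ 2 + v 1 ^ 2 + v 2 ^ 2) / 4 * v m - v m ^ 3) =
        -16 * (v 0 * v 1 * v 2) := by
      intro m
      fin_cases m <;> simp [hv2] <;> ring
    have hu : ∑ i, u.1 i = 0 := u.2
    simp only [hconst, ← Finset.sum_mul, hu, zero_mul]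

/-! ### The thirty lines in the source -/

/-- The line `b_{σ 0} = c b_{σ 1}`, `b_{σ 2} = c' b_{σ 3}` of `ℙ³`. -/
def coordLine (σ : Fin 4 → Fin 4) (c c' : ℂ) : Submodule ℂ (Fin 4 → ℂ) where
  carrier := {b | b (σ 0) = c * b (σ 1) ∧ b (σ 2) = c' * b (σ 3)}
  add_mem' := by
    rintro a b ⟨h1, h2⟩ ⟨h3, h4⟩
    exact ⟨by rw [Pi.add_apply, Pi.add_apply, h1, h3, mul_add],
      by rw [Pi.add_apply, Pi.add_apply, h2, h4, mul_add]⟩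
  zero_mem' := by simp
  smul_mem' := by
    rintro k a ⟨h1, h2⟩
    exact ⟨by rw [Pi.smul_apply, Pi.smul_apply, h1, smul_eq_mul, smul_eq_mul, mul_left_comm],
      by rw [Pi.smul_apply, Pi.smul_apply, h2, smul_eq_mul, smul_eq_mul, mul_left_comm]⟩

theorem finrank_coordLine {σ : Fin 4 → Fin 4} (hσ : Function.Injective σ) (c c' : ℂ) :
    Module.finrank ℂ (coordLine σ c c') = 2 := by
  let e : Fin 4 ≃ Fin 4 := Equiv.ofBijective σ (Finite.injective_iff_bijective.mp hσ)
  have he : ∀ i, e.symm (σ i) = i := fun i => e.symm_apply_apply i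
  have he' : ∀ i, σ (e.symm i) = i := fun i => e.apply_symm_apply i
  let L : coordLine σ c c' ≃ₗ[ℂ] ℂ × ℂ :=
    { toFun := fun b => (b.1 (σ 1), b.1 (σ 3))
      invFun := fun p => ⟨fun i => (![c * p.1, p.1, c' * p.2, p.2] : Fin 4 → ℂ) (e.symm i), by
        change _ = c * _ ∧ _ = c' * _
        simp [he]⟩
      map_add' := fun _ _ => rfl
      map_smul' := fun _ _ => rfl
      left_inv := by
        rintro ⟨b, h1, h2⟩
        apply Subtype.ext
        funext i
        obtain ⟨j, rfl⟩ := e.surjective i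
        change (![c * b (σ 1), b (σ 1), c' * b (σ 3), b (σ 3)] : Fin 4 → ℂ) (e.symm (σ j)) =
          b (σ j)
        rw [he]
        fin_cases j
        exacts [h1.symm, rfl, h2.symm, rfl]
      right_inv := fun p => by
        simp [he] }
  rw [L.finrank_eq, Module.finrank_prod, Module.finrank_self]

/-- The equations of the thirty lines: two for each partition of `{0, …, 5}` in pairs. -/
def edge : Fin 15 → Fin 2 → (Fin 4 → Fin 4) × GaussianInt × GaussianInt :=
  ![![(![0, 2, 1, 3], 0, 0), (![2, 0, 3, 1], 0, 0)],
    ![(![0, 1, 2, 3], 1, 1), (![0, 1, 2, 3], -1, -1)],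
    ![(![0, 1, 2, 3], 1, -1), (![0, 1, 2, 3], -1, 1)],
    ![(![0, 1, 2, 3], ⟨0, 1⟩, ⟨0, 1⟩), (![0, 1, 2, 3], ⟨0, -1⟩, ⟨0, -1⟩)],
    ![(![0, 1, 2, 3], ⟨0, 1⟩, ⟨0, -1⟩), (![0, 1, 2, 3], ⟨0, -1⟩, ⟨0, 1⟩)],
    ![(![0, 1, 2, 3], 0, 0), (![1, 0, 3, 2], 0, 0)],
    ![(![0, 2, 1, 3], 1, 1), (![0, 2, 1, 3], -1, -1)],
    ![(![0, 2, 1, 3], 1, -1), (![0, 2, 1, 3], -1, 1)],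
    ![(![0, 2, 1, 3], ⟨0, 1⟩, ⟨0, 1⟩), (![0, 2, 1, 3], ⟨0, -1⟩, ⟨0, -1⟩)],
    ![(![0, 2, 1, 3], ⟨0, 1⟩, ⟨0, -1⟩), (![0, 2, 1, 3], ⟨0, -1⟩, ⟨0, 1⟩)],
    ![(![0, 1, 3, 2], 0, 0), (![2, 0, 1, 3], 0, 0)],
    ![(![0, 3, 2, 1], 1, 1), (![0, 3, 2, 1], -1, -1)],
    ![(![0, 3, 2, 1], 1, -1), (![0, 3, 2, 1], -1, 1)],
    ![(![0, 3, 2, 1], ⟨0, 1⟩, ⟨0, 1⟩), (![0, 3, 2, 1], ⟨0, -1⟩, ⟨0, -1⟩)],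
    ![(![0, 3, 2, 1], ⟨0, 1⟩, ⟨0, -1⟩), (![0, 3, 2, 1], ⟨0, -1⟩, ⟨0, 1⟩)]]

/-- The two lines of the source mapped onto `synthemeLine k`. -/
def edgeLine (k : Fin 15) (s : Fin 2) : Submodule ℂ (Fin 4 → ℂ) :=
  coordLine (edge k s).1 (edge k s).2.1 (edge k s).2.2

theorem finrank_edgeLine (k : Fin 15) (s : Fin 2) : Module.finrank ℂ (edgeLine k s) = 2 := by
  have h : ∀ k s, Function.Injective (edge k s).1 := by decide
  exact finrank_coordLine (h k s) _ _

theorem edgeLine_injective : Function.Injective fun p : Fin 15 × Fin 2 => edgeLine p.1 p.2 := by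
  -- The two points of the line on which one of the free coordinates is zero.
  let pt : (Fin 4 → Fin 4) × GaussianInt × GaussianInt → Fin 2 → Fin 4 → GaussianInt :=
    fun d m i => if m = 0 then (if i = d.1 0 then d.2.1 else if i = d.1 1 then 1 else 0)
      else (if i = d.1 2 then d.2.2 else if i = d.1 3 then 1 else 0)
  have hdec : ∀ k s l u, (∀ m, pt (edge k s) m ((edge l u).1 0) =
        (edge l u).2.1 * pt (edge k s) m ((edge l u).1 1) ∧
      pt (edge k s) m ((edge l u).1 2) = (edge l u).2.2 * pt (edge k s) m ((edge l u).1 3)) →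
      (k, s) = (l, u) := by decide +kernel
  have hself : ∀ k s m, pt (edge k s) m ((edge k s).1 0) =
        (edge k s).2.1 * pt (edge k s) m ((edge k s).1 1) ∧
      pt (edge k s) m ((edge k s).1 2) = (edge k s).2.2 * pt (edge k s) m ((edge k s).1 3) := by
    decide +kernel
  rintro ⟨k, s⟩ ⟨l, u⟩ h
  refine hdec k s l u fun m => ?_
  have hmem : (fun i => ((pt (edge k s) m i : GaussianInt) : ℂ)) ∈ edgeLine l u := by
    have h' : edgeLine k s = edgeLine l u := h
    rw [← h']
    refine ⟨?_, ?_⟩ <;> beta_reduce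
    · rw [(hself k s m).1, map_mul]
    · rw [(hself k s m).2, map_mul]
  obtain ⟨h1, h2⟩ := hmem
  rw [← map_mul, GaussianInt.toComplex_inj] at h1 h2
  exact ⟨h1, h2⟩

/-! ### The preimage of the singular lines -/

theorem edge_aux {x y z : ℂ} (h1 : (y ^ 2 - z ^ 2) ^ 2 - 4 * x ^ 2 * (y - z) ^ 2 = 0)
    (h2 : (y ^ 2 - z ^ 2) ^ 2 + 4 * x ^ 2 * (y - z) ^ 2 = 0) : y = z ∨ (x = 0 ∧ y = -z) := by
  have h3 : (x * (y - z)) ^ 2 = 0 := by linear_combination (h2 - h1) / 8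
  have h4 : ((y - z) * (y + z)) ^ 2 = 0 := by linear_combination (h2 + h1) / 2
  rcases mul_eq_zero.mp (pow_eq_zero_iff two_ne_zero |>.mp h3) with h3 | h3
  · rcases mul_eq_zero.mp (pow_eq_zero_iff two_ne_zero |>.mp h4) with h4 | h4
    · exact Or.inl (sub_eq_zero.mp h4)
    · exact Or.inr ⟨h3, eq_neg_of_add_eq_zero_left h4⟩
  · exact Or.inl (sub_eq_zero.mp h3)

/-- Three products of four linear forms, the equations of a singular line not contained in
`t₀ = t₁`, vanish simultaneously on two lines only. Here `c² = c'² = η = ±1` and `c c' = δ`, and the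
substitution of `c y` and `c' w` for `y` and `w` reduces to the case `c = c' = 1`. -/
theorem edge_iff (c c' e e' η δ x y z w : ℂ) {d₀ d₁ d₂ : ℂ} (hc : c ^ 2 = η) (hc' : c' ^ 2 = η)
    (hη : η ^ 2 = 1) (hδ : c * c' = δ) (he : e = -c) (he' : e' = -c')
    (h₀ : d₀ = 3 * (x ^ 4 + y ^ 4 + z ^ 4 + w ^ 4 - 2 * η * (x ^ 2 * y ^ 2 + z ^ 2 * w ^ 2) -
      2 * (x ^ 2 * z ^ 2 + y ^ 2 * w ^ 2) - 2 * η * (x ^ 2 * w ^ 2 + y ^ 2 * z ^ 2) +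
      8 * δ * (x * y * z * w)))
    (h₁ : d₁ = 3 * (x ^ 4 + y ^ 4 + z ^ 4 + w ^ 4 - 2 * η * (x ^ 2 * y ^ 2 + z ^ 2 * w ^ 2) +
      2 * (x ^ 2 * z ^ 2 + y ^ 2 * w ^ 2) + 2 * η * (x ^ 2 * w ^ 2 + y ^ 2 * z ^ 2) -
      8 * δ * (x * y * z * w)))
    (h₂ : d₂ = 12 * ((x ^ 2 - η * y ^ 2) * (z ^ 2 - η * w ^ 2))) :
    (d₀ = 0 ∧ d₁ = 0 ∧ d₂ = 0) ↔
      (x = c * y ∧ z = c' * w) ∨ (x = e * y ∧ z = e' * w) := by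
  have hy4 : y ^ 4 = (c * y) ^ 4 := by
    linear_combination -(η + c ^ 2) * y ^ 4 * hc - y ^ 4 * hη
  have hw4 : w ^ 4 = (c' * w) ^ 4 := by
    linear_combination -(η + c' ^ 2) * w ^ 4 * hc' - w ^ 4 * hη
  have hyw : y ^ 2 * w ^ 2 = (c * y) ^ 2 * (c' * w) ^ 2 := by
    rw [mul_pow, mul_pow, hc, hc']
    linear_combination -y ^ 2 * w ^ 2 * hη
  have hy2 : η * y ^ 2 = (c * y) ^ 2 := by rw [mul_pow, hc]
  have hw2 : η * w ^ 2 = (c' * w) ^ 2 := by rw [mul_pow, hc']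
  have hp : δ * (x * y * z * w) = x * (c * y) * z * (c' * w) := by rw [← hδ]; ring
  have e₀ : d₀ = 3 * (x ^ 4 + (c * y) ^ 4 + z ^ 4 + (c' * w) ^ 4 -
      2 * (x ^ 2 * (c * y) ^ 2 + z ^ 2 * (c' * w) ^ 2) -
      2 * (x ^ 2 * z ^ 2 + (c * y) ^ 2 * (c' * w) ^ 2) -
      2 * (x ^ 2 * (c' * w) ^ 2 + (c * y) ^ 2 * z ^ 2) + 8 * (x * (c * y) * z * (c' * w))) := by
    rw [h₀, ← hy4, ← hw4, ← hyw, ← hy2, ← hw2, ← hp]; ring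
  have e₁ : d₁ = 3 * (x ^ 4 + (c * y) ^ 4 + z ^ 4 + (c' * w) ^ 4 -
      2 * (x ^ 2 * (c * y) ^ 2 + z ^ 2 * (c' * w) ^ 2) +
      2 * (x ^ 2 * z ^ 2 + (c * y) ^ 2 * (c' * w) ^ 2) +
      2 * (x ^ 2 * (c' * w) ^ 2 + (c * y) ^ 2 * z ^ 2) - 8 * (x * (c * y) * z * (c' * w))) := by
    rw [h₁, ← hy4, ← hw4, ← hyw, ← hy2, ← hw2, ← hp]; ring
  have e₂ : d₂ = 12 * ((x ^ 2 - (c * y) ^ 2) * (z ^ 2 - (c' * w) ^ 2)) := by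
    rw [h₂, ← hy2, ← hw2]
  rw [he, he', neg_mul, neg_mul]
  generalize c * y = u at *
  generalize c' * w = v at *
  rw [e₀, e₁, e₂]
  constructor
  · rintro ⟨f₀, f₁, f₂⟩
    have f₂ : ((x - u) * (x + u)) * ((z - v) * (z + v)) = 0 := by linear_combination f₂ / 12
    rcases mul_eq_zero.mp f₂ with f | f <;> rcases mul_eq_zero.mp f with f | f
    · obtain rfl := sub_eq_zero.mp f
      rcases edge_aux (x := x) (y := z) (z := v) (by linear_combination f₀ / 3)
        (by linear_combination f₁ / 3) with g | ⟨g, g'⟩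
      · exact Or.inl ⟨rfl, g⟩
      · exact Or.inr ⟨by rw [g]; ring, g'⟩
    · obtain rfl := eq_neg_of_add_eq_zero_left f
      rcases edge_aux (x := u) (y := z) (z := -v) (by linear_combination f₀ / 3)
        (by linear_combination f₁ / 3) with g | ⟨g, g'⟩
      · exact Or.inr ⟨rfl, g⟩
      · exact Or.inl ⟨by rw [g]; ring, by rw [g', neg_neg]⟩
    · obtain rfl := sub_eq_zero.mp f
      rcases edge_aux (x := z) (y := x) (z := u) (by linear_combination f₀ / 3)
        (by linear_combination f₁ / 3) with g | ⟨g, g'⟩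
      · exact Or.inl ⟨g, rfl⟩
      · exact Or.inr ⟨g', by rw [g]; ring⟩
    · obtain rfl := eq_neg_of_add_eq_zero_left f
      rcases edge_aux (x := v) (y := x) (z := -u) (by linear_combination f₀ / 3)
        (by linear_combination f₁ / 3) with g | ⟨g, g'⟩
      · exact Or.inr ⟨g, rfl⟩
      · exact Or.inl ⟨by rw [g', neg_neg], by rw [g]; ring⟩
  · rintro (⟨rfl, rfl⟩ | ⟨rfl, rfl⟩) <;> refine ⟨?_, ?_, ?_⟩ <;> ring

/-- The case of the singular lines contained in `t₀ = t₁`. -/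
theorem coord_iff (x y z w : ℂ) {d₀ d₁ d₂ : ℂ} (h₀ : d₀ = 48 * (x * y * z * w))
    (h₁ : d₁ = 12 * (x ^ 2 * z ^ 2 + y ^ 2 * w ^ 2 + (x ^ 2 * w ^ 2 + y ^ 2 * z ^ 2)))
    (h₂ : d₂ = 12 * (x ^ 2 * z ^ 2 + y ^ 2 * w ^ 2 - (x ^ 2 * w ^ 2 + y ^ 2 * z ^ 2))) :
    (d₀ = 0 ∧ d₁ = 0 ∧ d₂ = 0) ↔ (x = 0 ∧ y = 0) ∨ (z = 0 ∧ w = 0) := by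
  rw [h₀, h₁, h₂]
  constructor
  · rintro ⟨f₀, f₁, f₂⟩
    have g₀ : x * y * z * w = 0 := by linear_combination f₀ / 48
    have g₁ : x ^ 2 * z ^ 2 + y ^ 2 * w ^ 2 = 0 := by linear_combination (f₁ + f₂) / 24
    have g₂ : x ^ 2 * w ^ 2 + y ^ 2 * z ^ 2 = 0 := by linear_combination (f₁ - f₂) / 24
    rcases mul_eq_zero.mp g₀ with g | rfl
    · rcases mul_eq_zero.mp g with g | rfl
      · rcases mul_eq_zero.mp g with rfl | rfl <;> simp at g₁ g₂ ⊢ <;> tauto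
      · simp at g₁ g₂ ⊢
        tauto
    · simp at g₁ g₂ ⊢
      tauto
  · rintro (⟨rfl, rfl⟩ | ⟨rfl, rfl⟩) <;> simp

/-- The three pairs of a partition, ordered so as to fit `edge_iff` and `coord_iff`. -/
def synthemePair : Fin 15 → Fin 3 → Fin 6 × Fin 6 :=
  ![![(0, 1), (2, 3), (5, 4)],
    ![(0, 2), (1, 3), (5, 4)],
    ![(1, 2), (0, 3), (5, 4)],
    ![(1, 5), (0, 4), (2, 3)],
    ![(0, 5), (1, 4), (2, 3)],
    ![(0, 1), (2, 5), (3, 4)],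
    ![(0, 2), (1, 5), (3, 4)],
    ![(1, 2), (0, 5), (3, 4)],
    ![(1, 3), (0, 4), (2, 5)],
    ![(0, 3), (1, 4), (2, 5)],
    ![(0, 1), (2, 4), (5, 3)],
    ![(0, 2), (1, 4), (5, 3)],
    ![(1, 2), (0, 4), (5, 3)],
    ![(1, 5), (0, 3), (2, 4)],
    ![(0, 5), (1, 3), (2, 4)]]

theorem mem_synthemeLine_iff {k : Fin 15} {t : sumZero} : t ∈ synthemeLine k ↔
    t.1 (synthemePair k 0).1 - t.1 (synthemePair k 0).2 = 0 ∧
    t.1 (synthemePair k 1).1 - t.1 (synthemePair k 1).2 = 0 ∧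
    t.1 (synthemePair k 2).1 - t.1 (synthemePair k 2).2 = 0 := by
  have h1 : ∀ k m, syntheme k (synthemePair k m).1 = syntheme k (synthemePair k m).2 := by decide
  have h2 : ∀ k i j, syntheme k i = syntheme k j → i = j ∨
      ∃ m, (i = (synthemePair k m).1 ∧ j = (synthemePair k m).2) ∨
        (j = (synthemePair k m).1 ∧ i = (synthemePair k m).2) := by decide +kernel
  constructor
  · intro h
    exact ⟨sub_eq_zero.mpr (h _ _ (h1 k 0)), sub_eq_zero.mpr (h _ _ (h1 k 1)),
      sub_eq_zero.mpr (h _ _ (h1 k 2))⟩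
  · rintro ⟨e0, e1, e2⟩ i j hij
    have e : ∀ m, t.1 (synthemePair k m).1 = t.1 (synthemePair k m).2 := by
      intro m
      fin_cases m
      exacts [sub_eq_zero.mp e0, sub_eq_zero.mp e1, sub_eq_zero.mp e2]
    rcases h2 k i j hij with rfl | ⟨m, ⟨rfl, rfl⟩ | ⟨rfl, rfl⟩⟩
    exacts [rfl, e m, (e m).symm]

theorem igusaMap_mem_synthemeLine_iff (k : Fin 15) (b : Fin 4 → ℂ) :
    igusaMap b ∈ synthemeLine k ↔ b ∈ edgeLine k 0 ∨ b ∈ edgeLine k 1 := by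
  have hI : GaussianInt.toComplex ⟨0, 1⟩ = Complex.I := by simp [GaussianInt.toComplex_def]
  have hI' : GaussianInt.toComplex ⟨0, -1⟩ = -Complex.I := by simp [GaussianInt.toComplex_def]
  have hmem : ∀ s, b ∈ edgeLine k s ↔ b ((edge k s).1 0) = (edge k s).2.1 * b ((edge k s).1 1) ∧
      b ((edge k s).1 2) = (edge k s).2.2 * b ((edge k s).1 3) := fun s => Iff.rfl
  rw [mem_synthemeLine_iff, hmem, hmem, igusaMap_apply]
  fin_cases k <;> simp only [edge, synthemePair, Fin.zero_eta, Fin.mk_one, Fin.reduceFinMk,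
    Matrix.cons_val, Matrix.cons_val_zero, Matrix.cons_val_one, map_zero, map_one, map_neg, hI, hI',
    zero_mul]
  · exact coord_iff (b 0) (b 1) (b 2) (b 3) (by ring) (by ring) (by ring)
  · exact edge_iff 1 1 (-1) (-1) 1 1 (b 0) (b 1) (b 2) (b 3)
      (by simp) (by simp) (by simp) (by simp) (by simp) (by simp) (by ring) (by ring) (by ring)
  · exact edge_iff 1 (-1) (-1) 1 1 (-1) (b 0) (b 1) (b 2) (b 3)
      (by simp) (by simp) (by simp) (by simp) (by simp) (by simp) (by ring) (by ring) (by ring)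
  · exact edge_iff Complex.I Complex.I (-Complex.I) (-Complex.I) (-1) (-1) (b 0) (b 1) (b 2) (b 3)
      (by simp) (by simp) (by simp) (by simp) (by simp) (by simp) (by ring) (by ring) (by ring)
  · exact edge_iff Complex.I (-Complex.I) (-Complex.I) Complex.I (-1) 1 (b 0) (b 1) (b 2) (b 3)
      (by simp) (by simp) (by simp) (by simp) (by simp) (by simp) (by ring) (by ring) (by ring)
  · exact coord_iff (b 0) (b 2) (b 1) (b 3) (by ring) (by ring) (by ring)
  · exact edge_iff 1 1 (-1) (-1) 1 1 (b 0) (b 2) (b 1) (b 3)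
      (by simp) (by simp) (by simp) (by simp) (by simp) (by simp) (by ring) (by ring) (by ring)
  · exact edge_iff 1 (-1) (-1) 1 1 (-1) (b 0) (b 2) (b 1) (b 3)
      (by simp) (by simp) (by simp) (by simp) (by simp) (by simp) (by ring) (by ring) (by ring)
  · exact edge_iff Complex.I Complex.I (-Complex.I) (-Complex.I) (-1) (-1) (b 0) (b 2) (b 1) (b 3)
      (by simp) (by simp) (by simp) (by simp) (by simp) (by simp) (by ring) (by ring) (by ring)
  · exact edge_iff Complex.I (-Complex.I) (-Complex.I) Complex.I (-1) 1 (b 0) (b 2) (b 1) (b 3)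
      (by simp) (by simp) (by simp) (by simp) (by simp) (by simp) (by ring) (by ring) (by ring)
  · exact coord_iff (b 0) (b 3) (b 2) (b 1) (by ring) (by ring) (by ring)
  · exact edge_iff 1 1 (-1) (-1) 1 1 (b 0) (b 3) (b 2) (b 1)
      (by simp) (by simp) (by simp) (by simp) (by simp) (by simp) (by ring) (by ring) (by ring)
  · exact edge_iff 1 (-1) (-1) 1 1 (-1) (b 0) (b 3) (b 2) (b 1)
      (by simp) (by simp) (by simp) (by simp) (by simp) (by simp) (by ring) (by ring) (by ring)
  · exact edge_iff Complex.I Complex.I (-Complex.I) (-Complex.I) (-1) (-1) (b 0) (b 3) (b 2) (b 1)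
      (by simp) (by simp) (by simp) (by simp) (by simp) (by simp) (by ring) (by ring) (by ring)
  · exact edge_iff Complex.I (-Complex.I) (-Complex.I) Complex.I (-1) 1 (b 0) (b 3) (b 2) (b 1)
      (by simp) (by simp) (by simp) (by simp) (by simp) (by simp) (by ring) (by ring) (by ring)

/-! ### A criterion for finiteness -/

theorem linearSystem_comp_linearEquiv {n : ℕ} {V V' : Type*} [AddCommGroup V] [Module ℂ V]
    [AddCommGroup V'] [Module ℂ V'] (e : V ≃ₗ[ℂ] V') (f : (Fin n → ℂ) → V) :
    linearSystem (fun a => e (f a)) = linearSystem f := by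
  ext P
  constructor
  · rintro ⟨φ, hφ⟩
    exact ⟨φ ∘ₗ e.toLinearMap, hφ⟩
  · rintro ⟨φ, hφ⟩
    exact ⟨φ ∘ₗ e.symm.toLinearMap, fun a => by simp [hφ a]⟩

theorem toRatFun_ne_zero {n : ℕ} {P : MvPolynomial (Fin n) ℂ} (hP : P ≠ 0) : toRatFun P ≠ 0 :=
  fun h => hP ((IsFractionRing.injective (MvPolynomial (Fin n) ℂ) (RatFun n))
    (h.trans (map_zero _).symm))

theorem isHomogeneous_of_mem_linearSystem {n d : ℕ} {V : Type*} [AddCommGroup V] [Module ℂ V]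
    {f : (Fin n → ℂ) → V} (isForm : ∀ φ : Module.Dual ℂ V, ∃ P : MvPolynomial (Fin n) ℂ,
      P.IsHomogeneous d ∧ ∀ a, MvPolynomial.eval a P = φ (f a))
    {P : MvPolynomial (Fin n) ℂ} (hP : P ∈ linearSystem f) : P.IsHomogeneous d := by
  obtain ⟨φ, hφ⟩ := hP
  obtain ⟨Q, hQ, hφQ⟩ := isForm φ
  rwa [MvPolynomial.funext fun a => (hφ a).trans (hφQ a).symm]

/-- The finitely many generators of the ring of functions on `P ≠ 0`: the powers `Xᵢᵈ / P`, and
the quotients by powers of `P` of the monomials in which all exponents are less than `d`. -/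
def chartGenerators {n : ℕ} (d : ℕ) (P : MvPolynomial (Fin n) ℂ) : Set (RatFun n) :=
  Set.range (fun i => toRatFun (MvPolynomial.X i) ^ d / toRatFun P) ∪
    {z | ∃ (r : Fin n → Fin d) (j : ℕ), ∑ i, (r i : ℕ) = d * j ∧
      z = (∏ i, toRatFun (MvPolynomial.X i) ^ (r i : ℕ)) / toRatFun P ^ j}

theorem chartGenerators_finite {n d : ℕ} (hd : 0 < d) (P : MvPolynomial (Fin n) ℂ) :
    (chartGenerators d P).Finite := by
  refine (Set.finite_range _).union ((Set.finite_range fun r : Fin n → Fin d =>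
    (∏ i, toRatFun (MvPolynomial.X i) ^ (r i : ℕ)) /
      toRatFun P ^ ((∑ i, (r i : ℕ)) / d)).subset ?_)
  rintro _ ⟨r, j, hj, rfl⟩
  exact ⟨r, by simp only [hj, Nat.mul_div_cancel_left j hd]⟩

/-- Division with remainder by `d` of the exponents of a monomial. -/
theorem monomial_div_mem {n d : ℕ} (hd : 0 < d) {P : MvPolynomial (Fin n) ℂ} (hP : P ≠ 0)
    (m : Fin n → ℕ) {k : ℕ} (hm : ∑ i, m i = d * k) :
    (∏ i, toRatFun (MvPolynomial.X i) ^ m i) / toRatFun P ^ k ∈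
      Algebra.adjoin ℂ (chartGenerators d P) := by
  have hP' := toRatFun_ne_zero hP
  have hsum : ∑ i, m i = d * ∑ i, m i / d + ∑ i, m i % d := by
    rw [Finset.mul_sum, ← Finset.sum_add_distrib]
    exact Finset.sum_congr rfl fun i _ => (Nat.div_add_mod _ _).symm
  set q := ∑ i, m i / d with hq
  obtain ⟨j, hj⟩ : d ∣ ∑ i, m i % d := by
    rw [← Nat.dvd_add_right (Dvd.intro q rfl), ← hsum, hm]
    exact Dvd.intro k rfl
  have hk : k = q + j := by
    rw [hm, hj, ← mul_add] at hsum
    exact Nat.eq_of_mul_eq_mul_left hd hsum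
  have hfac : (∏ i, toRatFun (MvPolynomial.X i : MvPolynomial (Fin n) ℂ) ^ m i) / toRatFun P ^ k =
      (∏ i, (toRatFun (MvPolynomial.X i) ^ d / toRatFun P) ^ (m i / d)) *
      ((∏ i, toRatFun (MvPolynomial.X i) ^ (m i % d)) / toRatFun P ^ j) := by
    simp only [div_pow, Finset.prod_div_distrib]
    rw [Finset.prod_pow_eq_pow_sum, ← hq, div_mul_div_comm, ← pow_add, ← hk,
      ← Finset.prod_mul_distrib]
    congr 1
    refine Finset.prod_congr rfl fun i _ => ?_
    rw [← pow_mul, ← pow_add, Nat.div_add_mod]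
  rw [hfac]
  refine mul_mem (prod_mem fun i _ => pow_mem ?_ _) ?_
  · exact Algebra.subset_adjoin (Set.mem_union_left _ (Set.mem_range_self i))
  · exact Algebra.subset_adjoin (Set.mem_union_right _
      ⟨fun i => ⟨m i % d, Nat.mod_lt _ hd⟩, j, hj, rfl⟩)

/-- Decomposition of the elements of the chart into monomials. -/
theorem form_div_eq {n d : ℕ} {P N : MvPolynomial (Fin n) ℂ} {k : ℕ}
    (hN : N.IsHomogeneous (d * k)) : (∀ m ∈ N.support, ∑ i, m i = d * k) ∧
    toRatFun N / toRatFun P ^ k = ∑ m ∈ N.support, algebraMap ℂ (RatFun n) (N.coeff m) *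
      ((∏ i, toRatFun (MvPolynomial.X i) ^ m i) / toRatFun P ^ k) := by
  constructor
  · intro m hm
    have := hN (MvPolynomial.mem_support_iff.mp hm)
    rw [← this, Finsupp.weight_apply, Finsupp.sum_fintype _ _ (by simp)]
    simp
  · conv_lhs => rw [N.as_sum]
    rw [toRatFun, map_sum, Finset.sum_div]
    refine Finset.sum_congr rfl fun m _ => ?_
    rw [MvPolynomial.monomial_eq, map_mul, mul_div_assoc, Finsupp.prod_fintype _ _ (by simp),
      map_prod]
    simp only [map_pow]
    rfl

theorem prod_X_pow_isHomogeneous {n : ℕ} (m : Fin n → ℕ) :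
    (∏ i, (MvPolynomial.X i : MvPolynomial (Fin n) ℂ) ^ m i).IsHomogeneous (∑ i, m i) :=
  MvPolynomial.IsHomogeneous.prod _ _ _ fun i _ => MvPolynomial.isHomogeneous_X_pow i _

theorem sourceChart_eq {n d : ℕ} (hd : 0 < d) {P : MvPolynomial (Fin n) ℂ} (hP : P ≠ 0) :
    sourceChart d P = Algebra.adjoin ℂ (chartGenerators d P) := by
  refine le_antisymm (Algebra.adjoin_le ?_) (Algebra.adjoin_mono ?_)
  · rintro _ ⟨k, N, hN, rfl⟩
    obtain ⟨hdeg, hexp⟩ := form_div_eq (P := P) hN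
    rw [SetLike.mem_coe, hexp]
    exact sum_mem fun m hm => mul_mem (Subalgebra.algebraMap_mem _ _)
      (monomial_div_mem hd hP m (hdeg m hm))
  · rintro _ (⟨i, rfl⟩ | ⟨r, j, hj, rfl⟩)
    · refine ⟨1, MvPolynomial.X i ^ d, ?_, ?_⟩
      · rw [mul_one]
        exact MvPolynomial.isHomogeneous_X_pow i d
      · simp only [toRatFun, map_pow, pow_one]
    · refine ⟨j, ∏ i, MvPolynomial.X i ^ (r i : ℕ), ?_, ?_⟩
      · rw [← hj]
        exact prod_X_pow_isHomogeneous _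
      · simp only [toRatFun, map_prod, map_pow]

/-- A morphism given by forms of degree `d` without common zero is finite if, over each open set
`φ ≠ 0`, the functions `Xᵢᵈ / φ` are integral. -/
theorem isFiniteMorphism_of_isIntegral {n d : ℕ} (hd : 0 < d) {V : Type*} [AddCommGroup V]
    [Module ℂ V] {f : (Fin n → ℂ) → V}
    (isForm : ∀ φ : Module.Dual ℂ V, ∃ P : MvPolynomial (Fin n) ℂ, P.IsHomogeneous d ∧
      ∀ a, MvPolynomial.eval a P = φ (f a))
    (ne_zero : ∀ a, a ≠ 0 → f a ≠ 0)
    (H : ∀ P ∈ linearSystem f, P ≠ 0 → ∀ i,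
      IsIntegral (targetChart f P) (toRatFun (MvPolynomial.X i) ^ d / toRatFun P)) :
    IsFiniteMorphism d f := by
  refine ⟨isForm, ne_zero, fun P hPf hP => ?_⟩
  have h : targetChart f P ≤ sourceChart d P := by
    refine Algebra.adjoin_mono ?_
    rintro _ ⟨N, hN, rfl⟩
    exact ⟨1, N, by rw [mul_one]; exact isHomogeneous_of_mem_linearSystem isForm hN, by simp⟩
  refine ⟨h, ?_⟩
  have hint : ∀ z ∈ sourceChart d P, IsIntegral (targetChart f P) z := by
    intro z hz
    have hC : ∀ c : ℂ, IsIntegral (targetChart f P) (algebraMap ℂ (RatFun n) c) := fun c =>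
      isIntegral_algebraMap (R := targetChart f P)
        (x := ⟨_, Subalgebra.algebraMap_mem (targetChart f P) c⟩)
    induction hz using Algebra.adjoin_induction with
    | mem z hz =>
      obtain ⟨k, N, hN, rfl⟩ := hz
      obtain ⟨hdeg, hexp⟩ := form_div_eq (P := P) hN
      rw [hexp]
      refine IsIntegral.sum _ fun m hm => (hC _).mul (IsIntegral.of_pow hd ?_)
      have : ((∏ i, toRatFun (MvPolynomial.X i) ^ m i) / toRatFun P ^ k) ^ d =
          ∏ i, (toRatFun (MvPolynomial.X i : MvPolynomial (Fin n) ℂ) ^ d / toRatFun P) ^ m i := by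
        simp only [div_pow, Finset.prod_div_distrib]
        rw [Finset.prod_pow_eq_pow_sum, hdeg m hm, ← pow_mul, mul_comm k d, ← Finset.prod_pow]
        congr 1
        refine Finset.prod_congr rfl fun i _ => ?_
        rw [← pow_mul, ← pow_mul, mul_comm]
      rw [this]
      exact IsIntegral.prod _ fun i _ => (H P hPf hP i).pow _
    | algebraMap c => exact hC c
    | add x y _ _ hx hy => exact hx.add hy
    | mul x y _ _ hx hy => exact hx.mul hy
  refine RingHom.IsIntegral.to_finite ?_ ?_
  · intro z
    obtain ⟨p, hp, hpz⟩ := hint z.1 z.2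
    refine ⟨p, hp, Subtype.ext ?_⟩
    have := Polynomial.hom_eval₂ p (Subalgebra.inclusion h).toRingHom
      (sourceChart d P).val.toRingHom z
    exact this.trans hpz
  · have hfg : Algebra.FiniteType ℂ (sourceChart d P) := by
      rw [← Subalgebra.fg_iff_finiteType, sourceChart_eq hd hP]
      exact ⟨(chartGenerators_finite hd P).toFinset, by simp⟩
    refine RingHom.FiniteType.of_comp_finiteType (f := algebraMap ℂ (targetChart f P)) ?_
    have : (Subalgebra.inclusion h).toRingHom.comp (algebraMap ℂ (targetChart f P)) =
        algebraMap ℂ (sourceChart d P) := rfl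
    rw [this]
    exact RingHom.finiteType_algebraMap.mpr hfg

/-! ### Finiteness of `Θ` -/

theorem isIntegral_of_quartic {R A : Type*} [CommRing R] [CommRing A] [Algebra R A] {x : A}
    (c₀ c₁ c₂ c₃ : R) (h : x ^ 4 + algebraMap R A c₃ * x ^ 3 + algebraMap R A c₂ * x ^ 2 +
      algebraMap R A c₁ * x + algebraMap R A c₀ = 0) : IsIntegral R x := by
  nontriviality R
  refine ⟨Polynomial.X ^ 4 + Polynomial.C c₃ * Polynomial.X ^ 3 +
    Polynomial.C c₂ * Polynomial.X ^ 2 + Polynomial.C c₁ * Polynomial.X + Polynomial.C c₀,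
    by monicity!, ?_⟩
  simpa using h

/-- The other monomials of degree four in `u` and `v` are integral, as their powers are monomials in
`u⁴` and `v⁴`. -/
theorem isIntegral_linear_combination_pow_four {E : Type*} [Field E] [Algebra ℂ E]
    {R : Subalgebra ℂ E} {u v p : E} (hp : p ≠ 0) (hu : IsIntegral R (u ^ 4 / p))
    (hv : IsIntegral R (v ^ 4 / p)) (c d : ℂ) :
    IsIntegral R ((algebraMap ℂ E c * u + algebraMap ℂ E d * v) ^ 4 / p) := by
  have hC : ∀ c : ℂ, IsIntegral R (algebraMap ℂ E c) := fun c =>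
    isIntegral_algebraMap (R := R) (x := ⟨_, Subalgebra.algebraMap_mem R c⟩)
  have h31 : IsIntegral R (u ^ 3 * v / p) := by
    refine IsIntegral.of_pow (n := 4) (by norm_num) ?_
    have : (u ^ 3 * v / p) ^ 4 = (u ^ 4 / p) ^ 3 * (v ^ 4 / p) := by field_simp
    rw [this]
    exact (hu.pow 3).mul hv
  have h22 : IsIntegral R (u ^ 2 * v ^ 2 / p) := by
    refine IsIntegral.of_pow (n := 2) (by norm_num) ?_
    have : (u ^ 2 * v ^ 2 / p) ^ 2 = (u ^ 4 / p) * (v ^ 4 / p) := by field_simp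
    rw [this]
    exact hu.mul hv
  have h13 : IsIntegral R (u * v ^ 3 / p) := by
    refine IsIntegral.of_pow (n := 4) (by norm_num) ?_
    have : (u * v ^ 3 / p) ^ 4 = (u ^ 4 / p) * (v ^ 4 / p) ^ 3 := by field_simp
    rw [this]
    exact hu.mul (hv.pow 3)
  have h : (algebraMap ℂ E c * u + algebraMap ℂ E d * v) ^ 4 / p =
      algebraMap ℂ E (c ^ 4) * (u ^ 4 / p) + algebraMap ℂ E (4 * c ^ 3 * d) * (u ^ 3 * v / p) +
      algebraMap ℂ E (6 * c ^ 2 * d ^ 2) * (u ^ 2 * v ^ 2 / p) +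
      algebraMap ℂ E (4 * c * d ^ 3) * (u * v ^ 3 / p) + algebraMap ℂ E (d ^ 4) * (v ^ 4 / p) := by
    simp only [map_mul, map_pow, map_ofNat]
    field_simp
    ring
  rw [h]
  exact (((((hC _).mul hu).add ((hC _).mul h31)).add ((hC _).mul h22)).add
    ((hC _).mul h13)).add ((hC _).mul hv)

/-- The quartic equation satisfied by the `bᵢ⁴`: the coefficients of the product of the `T - bᵢ⁴`
are polynomials in the quartic invariants. -/
theorem isIntegral_pow_four_div {E : Type*} [Field E] [Algebra ℂ E]
    {R : Subalgebra ℂ E} {x y z w p : E} (hp : p ≠ 0)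
    (h₀ : (x ^ 4 + y ^ 4 + z ^ 4 + w ^ 4) / p ∈ R) (h₁ : x * y * z * w / p ∈ R)
    (h₂ : (x ^ 2 * y ^ 2 + z ^ 2 * w ^ 2) / p ∈ R) (h₃ : (x ^ 2 * z ^ 2 + y ^ 2 * w ^ 2) / p ∈ R)
    (h₄ : (x ^ 2 * w ^ 2 + y ^ 2 * z ^ 2) / p ∈ R) : IsIntegral R (x ^ 4 / p) := by
  let α : R := ⟨_, h₀⟩
  let π : R := ⟨_, h₁⟩
  let β₁ : R := ⟨_, h₂⟩
  let β₂ : R := ⟨_, h₃⟩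
  let β₃ : R := ⟨_, h₄⟩
  refine isIntegral_of_quartic (π ^ 4)
    (2 * (β₁ + β₂ + β₃) * π ^ 2 - (β₁ * β₂ * β₃ - α * π ^ 2 + 2 * (β₁ + β₂ + β₃) * π ^ 2))
    ((β₁ + β₂ + β₃) ^ 2 + 2 * π ^ 2 - 2 * (4 * π ^ 2 + β₁ * β₂ + β₁ * β₃ + β₂ * β₃)) (-α) ?_
  simp only [map_add, map_sub, map_mul, map_pow, map_neg, map_ofNat]
  change (x ^ 4 / p) ^ 4 + -((x ^ 4 + y ^ 4 + z ^ 4 + w ^ 4) / p) * _ + _ * _ + _ * _ + _ = 0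
  have hα : algebraMap R E α = (x ^ 4 + y ^ 4 + z ^ 4 + w ^ 4) / p := rfl
  have hπ : algebraMap R E π = x * y * z * w / p := rfl
  have hβ₁ : algebraMap R E β₁ = (x ^ 2 * y ^ 2 + z ^ 2 * w ^ 2) / p := rfl
  have hβ₂ : algebraMap R E β₂ = (x ^ 2 * z ^ 2 + y ^ 2 * w ^ 2) / p := rfl
  have hβ₃ : algebraMap R E β₃ = (x ^ 2 * w ^ 2 + y ^ 2 * z ^ 2) / p := rfl
  rw [hα, hπ, hβ₁, hβ₂, hβ₃]
  field_simp
  ring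

/-- The linear forms on `𝔠` given by the coordinates `heisenbergCoord`. -/
def coordForm : Fin 4 → MvPolynomial (Fin 4) ℂ :=
  ![MvPolynomial.C Complex.I * (MvPolynomial.X 0 - MvPolynomial.X 1),
    MvPolynomial.X 0 + MvPolynomial.X 1, MvPolynomial.X 2 - MvPolynomial.X 3,
    MvPolynomial.X 2 + MvPolynomial.X 3]

theorem eval_coordForm (a : Fin 4 → ℂ) (i : Fin 4) :
    MvPolynomial.eval a (coordForm i) = heisenbergCoord a i := by
  fin_cases i <;> simp [coordForm, heisenbergCoord]

/-- The quartic invariants, as polynomials in four given polynomials. -/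
def quarticPoly (w : Fin 4 → MvPolynomial (Fin 4) ℂ) : Fin 5 → MvPolynomial (Fin 4) ℂ :=
  ![w 0 ^ 4 + w 1 ^ 4 + w 2 ^ 4 + w 3 ^ 4, w 0 * w 1 * w 2 * w 3,
    w 0 ^ 2 * w 1 ^ 2 + w 2 ^ 2 * w 3 ^ 2, w 0 ^ 2 * w 2 ^ 2 + w 1 ^ 2 * w 3 ^ 2,
    w 0 ^ 2 * w 3 ^ 2 + w 1 ^ 2 * w 2 ^ 2]

theorem eval_quarticPoly (w : Fin 4 → MvPolynomial (Fin 4) ℂ) (a : Fin 4 → ℂ) (j : Fin 5) :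
    MvPolynomial.eval a (quarticPoly w j) =
      invariantQuartics (fun i => MvPolynomial.eval a (w i)) j := by
  fin_cases j <;> simp [quarticPoly, invariantQuartics]

theorem quarticPoly_isHomogeneous {w : Fin 4 → MvPolynomial (Fin 4) ℂ}
    (hw : ∀ i, (w i).IsHomogeneous 1) (j : Fin 5) : (quarticPoly w j).IsHomogeneous 4 := by
  have h2 : ∀ i k, (w i ^ 2 * w k ^ 2).IsHomogeneous 4 := fun i k =>
    ((hw i).pow 2).mul ((hw k).pow 2)
  have h4 : ∀ i, (w i ^ 4).IsHomogeneous 4 := fun i => (hw i).pow 4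
  fin_cases j
  · exact (((h4 0).add (h4 1)).add (h4 2)).add (h4 3)
  · exact (((hw 0).mul (hw 1)).mul (hw 2)).mul (hw 3)
  · exact (h2 0 1).add (h2 2 3)
  · exact (h2 0 2).add (h2 1 3)
  · exact (h2 0 3).add (h2 1 2)

theorem coordForm_isHomogeneous (i : Fin 4) : (coordForm i).IsHomogeneous 1 := by
  have hX := MvPolynomial.isHomogeneous_X (σ := Fin 4) ℂ
  fin_cases i
  · have := (MvPolynomial.isHomogeneous_C (Fin 4) Complex.I).mul ((hX 0).sub (hX 1))
    rwa [zero_add] at this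
  · exact (hX 0).add (hX 1)
  · exact (hX 2).sub (hX 3)
  · exact (hX 2).add (hX 3)

theorem linearSystem_theta :
    linearSystem theta = linearSystem fun a => invariantQuartics (heisenbergCoord a) := by
  rw [← linearSystem_comp_linearEquiv coordU5]
  simp only [coordU5_theta]

theorem quarticPoly_mem_linearSystem (j : Fin 5) :
    quarticPoly coordForm j ∈ linearSystem theta := by
  rw [linearSystem_theta]
  exact ⟨LinearMap.proj j, fun a => by simp [eval_quarticPoly, eval_coordForm]⟩

theorem isFiniteMorphism_theta : IsFiniteMorphism 4 theta := by
  refine isFiniteMorphism_of_isIntegral (by norm_num) ?_ ?_ ?_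
  · intro φ
    refine ⟨∑ j, MvPolynomial.C (φ (coordU5.symm (Pi.single j 1))) * quarticPoly coordForm j,
      MvPolynomial.IsHomogeneous.sum _ _ _ fun j _ => ?_, fun a => ?_⟩
    · have := (MvPolynomial.isHomogeneous_C (Fin 4) (φ (coordU5.symm (Pi.single j 1)))).mul
        (quarticPoly_isHomogeneous coordForm_isHomogeneous j)
      rwa [zero_add] at this
    · have h := LinearMap.pi_apply_eq_sum_univ (φ ∘ₗ coordU5.symm.toLinearMap)
        (invariantQuartics (heisenbergCoord a))
      rw [← coordU5_theta] at h
      simp only [LinearMap.comp_apply, LinearEquiv.coe_coe, LinearEquiv.symm_apply_apply] at h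
      rw [h, map_sum]
      refine Finset.sum_congr rfl fun j _ => ?_
      rw [map_mul, MvPolynomial.eval_C, eval_quarticPoly, coordU5_theta, smul_eq_mul, mul_comm]
      simp only [eval_coordForm]
      congr 3
      funext i
      simp [Pi.single_apply, eq_comm]
  · intro a ha h
    have := coordU5_theta a
    rw [h, map_zero] at this
    exact ha (heisenbergCoord.map_eq_zero_iff.mp (eq_zero_of_invariantQuartics this.symm))
  · intro P hPf hP
    have hP' := toRatFun_ne_zero hP
    have hq : ∀ j, toRatFun (quarticPoly coordForm j) / toRatFun P ∈ targetChart theta P :=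
      fun j => Algebra.subset_adjoin ⟨_, quarticPoly_mem_linearSystem j, rfl⟩
    have h₀ := hq 0
    have h₁ := hq 1
    have h₂ := hq 2
    have h₃ := hq 3
    have h₄ := hq 4
    simp only [quarticPoly, toRatFun, Matrix.cons_val, Matrix.cons_val_zero, Matrix.cons_val_one,
      map_add, map_mul, map_pow] at h₀ h₁ h₂ h₃ h₄
    set x := algebraMap (MvPolynomial (Fin 4) ℂ) (RatFun 4) (coordForm 0) with hx
    set y := algebraMap (MvPolynomial (Fin 4) ℂ) (RatFun 4) (coordForm 1) with hy
    set z := algebraMap (MvPolynomial (Fin 4) ℂ) (RatFun 4) (coordForm 2) with hz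
    set w := algebraMap (MvPolynomial (Fin 4) ℂ) (RatFun 4) (coordForm 3) with hw
    have ix := isIntegral_pow_four_div hP' h₀ h₁ h₂ h₃ h₄
    have iy := isIntegral_pow_four_div (x := y) (y := x) (z := z) (w := w) hP'
      (by convert h₀ using 2; ring) (by convert h₁ using 2; ring) (by convert h₂ using 2; ring)
      (by convert h₄ using 2; ring) (by convert h₃ using 2; ring)
    have iz := isIntegral_pow_four_div (x := z) (y := w) (z := x) (w := y) hP'
      (by convert h₀ using 2; ring) (by convert h₁ using 2; ring) (by convert h₂ using 2; ring)
      (by convert h₃ using 2; ring) (by convert h₄ using 2; ring)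
    have iw := isIntegral_pow_four_div (x := w) (y := z) (z := x) (w := y) hP'
      (by convert h₀ using 2; ring) (by convert h₁ using 2; ring) (by convert h₂ using 2; ring)
      (by convert h₄ using 2; ring) (by convert h₃ using 2; ring)
    have hC : ∀ c : ℂ, algebraMap ℂ (RatFun 4) c =
        algebraMap (MvPolynomial (Fin 4) ℂ) (RatFun 4) (MvPolynomial.C c) := fun c => rfl
    have comb : ∀ (c d : ℂ) (i k l : Fin 4), MvPolynomial.X i = MvPolynomial.C c * coordForm k +
        MvPolynomial.C d * coordForm l → toRatFun (MvPolynomial.X i) =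
        algebraMap ℂ (RatFun 4) c * algebraMap _ (RatFun 4) (coordForm k) +
        algebraMap ℂ (RatFun 4) d * algebraMap _ (RatFun 4) (coordForm l) := by
      intro c d i k l h
      rw [toRatFun, h, map_add, map_mul, map_mul, hC, hC]
    have solve : ∀ (c d : ℂ) (i k l : Fin 4),
        (∀ a, a i = c * heisenbergCoord a k + d * heisenbergCoord a l) →
        MvPolynomial.X i = MvPolynomial.C c * coordForm k + MvPolynomial.C d * coordForm l := by
      intro c d i k l h
      refine MvPolynomial.funext fun a => ?_
      simp [eval_coordForm, h a]
    have hI := Complex.I_mul_I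
    intro i
    fin_cases i
    · rw [comb (-Complex.I / 2) (1 / 2) _ 0 1 (solve _ _ _ _ _ fun a => by
        simp [heisenbergCoord]; linear_combination (a 0 - a 1) / 2 * hI)]
      exact isIntegral_linear_combination_pow_four hP' ix iy _ _
    · rw [comb (Complex.I / 2) (1 / 2) _ 0 1 (solve _ _ _ _ _ fun a => by
        simp [heisenbergCoord]; linear_combination -(a 0 - a 1) / 2 * hI)]
      exact isIntegral_linear_combination_pow_four hP' ix iy _ _
    · rw [comb (1 / 2) (1 / 2) _ 2 3 (solve _ _ _ _ _ fun a => by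
        simp [heisenbergCoord]; ring)]
      exact isIntegral_linear_combination_pow_four hP' iz iw _ _
    · rw [comb (-1 / 2) (1 / 2) _ 2 3 (solve _ _ _ _ _ fun a => by
        simp [heisenbergCoord]; ring)]
      exact isIntegral_linear_combination_pow_four hP' iz iw _ _

/-! ### Linear substitutions in rational functions -/

section Substitution

variable {n : ℕ}

/-- The substitution `P ↦ P ∘ A` in polynomials. -/
def substPoly (A : (Fin n → ℂ) →ₗ[ℂ] (Fin n → ℂ)) :
    MvPolynomial (Fin n) ℂ →ₐ[ℂ] MvPolynomial (Fin n) ℂ :=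
  MvPolynomial.aeval fun i => ∑ j, MvPolynomial.C (A (Pi.single j 1) i) * MvPolynomial.X j

theorem eval_substPoly (A : (Fin n → ℂ) →ₗ[ℂ] (Fin n → ℂ)) (P : MvPolynomial (Fin n) ℂ)
    (a : Fin n → ℂ) : MvPolynomial.eval a (substPoly A P) = MvPolynomial.eval (A a) P := by
  have h : ((MvPolynomial.aeval a).comp (substPoly A) : MvPolynomial (Fin n) ℂ →ₐ[ℂ] ℂ) =
      MvPolynomial.aeval (A a) := by
    refine MvPolynomial.algHom_ext fun i => ?_
    rw [AlgHom.comp_apply, substPoly, MvPolynomial.aeval_X, MvPolynomial.aeval_X, map_sum,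
      LinearMap.pi_apply_eq_sum_univ A a, Finset.sum_apply]
    refine Finset.sum_congr rfl fun j _ => ?_
    have : (fun k => if j = k then (1 : ℂ) else 0) = Pi.single j 1 := by
      funext k
      simp [Pi.single_apply, eq_comm]
    simp [this, mul_comm]
  exact congrArg (fun F => F P) h

theorem substPoly_substPoly (A B : (Fin n → ℂ) →ₗ[ℂ] (Fin n → ℂ)) (h : ∀ a, B (A a) = a)
    (P : MvPolynomial (Fin n) ℂ) : substPoly A (substPoly B P) = P :=
  MvPolynomial.funext fun a => by rw [eval_substPoly, eval_substPoly, h]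

/-- The substitution `P ↦ P ∘ A` in polynomials, as an automorphism. -/
def substEquiv (A : (Fin n → ℂ) ≃ₗ[ℂ] (Fin n → ℂ)) :
    MvPolynomial (Fin n) ℂ ≃ₐ[ℂ] MvPolynomial (Fin n) ℂ :=
  { substPoly A.toLinearMap with
    invFun := substPoly A.symm.toLinearMap
    left_inv := fun P => substPoly_substPoly A.symm.toLinearMap A.toLinearMap A.apply_symm_apply P
    right_inv := fun P =>
      substPoly_substPoly A.toLinearMap A.symm.toLinearMap A.symm_apply_apply P }

theorem eval_substEquiv (A : (Fin n → ℂ) ≃ₗ[ℂ] (Fin n → ℂ)) (P : MvPolynomial (Fin n) ℂ)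
    (a : Fin n → ℂ) : MvPolynomial.eval a (substEquiv A P) = MvPolynomial.eval (A a) P :=
  eval_substPoly A.toLinearMap P a

/-- The substitution `z ↦ z ∘ A` in rational functions. -/
def substRat (A : (Fin n → ℂ) ≃ₗ[ℂ] (Fin n → ℂ)) : RatFun n ≃ₐ[ℂ] RatFun n :=
  IsFractionRing.algEquivOfAlgEquiv (substEquiv A)

theorem substRat_toRatFun (A : (Fin n → ℂ) ≃ₗ[ℂ] (Fin n → ℂ)) (P : MvPolynomial (Fin n) ℂ) :
    substRat A (toRatFun P) = toRatFun (substEquiv A P) := by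
  simp [substRat, toRatFun]

variable {V : Type*} [AddCommGroup V] [Module ℂ V]

theorem linearSystem_comp (A : (Fin n → ℂ) ≃ₗ[ℂ] (Fin n → ℂ)) (f : (Fin n → ℂ) → V) :
    linearSystem (fun a => f (A a)) = substEquiv A '' linearSystem f := by
  ext P
  constructor
  · rintro ⟨φ, hφ⟩
    refine ⟨(substEquiv A).symm P, ⟨φ, fun a => ?_⟩, (substEquiv A).apply_symm_apply P⟩
    have := hφ (A.symm a)
    simp only [A.apply_symm_apply] at this
    rw [← this]
    exact eval_substPoly A.symm.toLinearMap P a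
  · rintro ⟨Q, ⟨φ, hφ⟩, rfl⟩
    exact ⟨φ, fun a => by rw [eval_substEquiv, hφ]⟩

theorem imageFunctionField_comp (A : (Fin n → ℂ) ≃ₗ[ℂ] (Fin n → ℂ)) (f : (Fin n → ℂ) → V) :
    imageFunctionField (fun a => f (A a)) =
      (imageFunctionField f).map (substRat A).toAlgHom := by
  rw [imageFunctionField, imageFunctionField, IntermediateField.adjoin_map, linearSystem_comp]
  congr 1
  ext z
  constructor
  · rintro ⟨_, ⟨P, hP, rfl⟩, _, ⟨Q, hQ, rfl⟩, rfl⟩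
    refine ⟨_, ⟨P, hP, Q, hQ, rfl⟩, ?_⟩
    rw [← substRat_toRatFun, ← substRat_toRatFun]
    exact map_div₀ (substRat A) _ _
  · rintro ⟨_, ⟨P, hP, Q, hQ, rfl⟩, rfl⟩
    refine ⟨_, ⟨P, hP, rfl⟩, _, ⟨Q, hQ, rfl⟩, ?_⟩
    rw [← substRat_toRatFun, ← substRat_toRatFun]
    exact map_div₀ (substRat A) _ _

theorem imageFunctionField_comp_linearEquiv {V' : Type*} [AddCommGroup V'] [Module ℂ V']
    (e : V ≃ₗ[ℂ] V') (f : (Fin n → ℂ) → V) :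
    imageFunctionField (fun a => e (f a)) = imageFunctionField f := by
  rw [imageFunctionField, imageFunctionField, linearSystem_comp_linearEquiv]

theorem functionField_eq : functionField n = imageFunctionField (fun a : Fin n → ℂ => a) := by
  have hX : ∀ i, (MvPolynomial.X i : MvPolynomial (Fin n) ℂ) ∈
      linearSystem (fun a : Fin n → ℂ => a) := fun i => ⟨LinearMap.proj i, fun a => by simp⟩
  apply le_antisymm
  · refine IntermediateField.adjoin.mono _ _ _ ?_
    rintro _ ⟨i, j, rfl⟩
    exact ⟨_, hX i, _, hX j, rfl⟩
  · rw [imageFunctionField, IntermediateField.adjoin_le_iff]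
    rintro _ ⟨P, ⟨φ, hφ⟩, Q, ⟨ψ, hψ⟩, rfl⟩
    have key : ∀ (R : MvPolynomial (Fin n) ℂ) (χ : Module.Dual ℂ (Fin n → ℂ)),
        (∀ a, MvPolynomial.eval a R = χ a) → ∀ j,
        toRatFun R / toRatFun (MvPolynomial.X j) ∈ functionField n := by
      intro R χ hR j
      have hR' : R = ∑ i, MvPolynomial.C (χ (Pi.single i 1)) * MvPolynomial.X i := by
        refine MvPolynomial.funext fun a => ?_
        rw [hR, LinearMap.pi_apply_eq_sum_univ χ a, map_sum]
        refine Finset.sum_congr rfl fun i _ => ?_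
        have : (fun k => if i = k then (1 : ℂ) else 0) = Pi.single i 1 := by
          funext k
          simp [Pi.single_apply, eq_comm]
        simp [this, mul_comm]
      rw [hR', toRatFun, map_sum, Finset.sum_div]
      refine sum_mem fun i _ => ?_
      rw [map_mul, mul_div_assoc]
      refine mul_mem (IntermediateField.algebraMap_mem (functionField n) _) ?_
      exact IntermediateField.subset_adjoin _ _ ⟨i, j, rfl⟩
    rcases isEmpty_or_nonempty (Fin n) with hn | ⟨⟨j⟩⟩
    · have : P = 0 := MvPolynomial.funext fun a => by
        rw [hφ, Subsingleton.elim a 0, map_zero, map_zero]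
      rw [this, toRatFun, map_zero, zero_div]
      exact zero_mem _
    · have hj := toRatFun_ne_zero (MvPolynomial.X_ne_zero (R := ℂ) j)
      have : toRatFun P / toRatFun Q = (toRatFun P / toRatFun (MvPolynomial.X j)) /
          (toRatFun Q / toRatFun (MvPolynomial.X j)) := by
        rw [div_div_div_cancel_right₀ hj]
      rw [this]
      exact div_mem (key P φ hφ j) (key Q ψ hψ j)

theorem functionField_map (A : (Fin n → ℂ) ≃ₗ[ℂ] (Fin n → ℂ)) :
    (functionField n).map (substRat A).toAlgHom = functionField n := by
  rw [functionField_eq, ← imageFunctionField_comp]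
  exact imageFunctionField_comp_linearEquiv A fun a => a

/-- The degree does not depend on linear coordinates in the source. -/
theorem degreeOntoImage_comp (A : (Fin n → ℂ) ≃ₗ[ℂ] (Fin n → ℂ)) (f : (Fin n → ℂ) → V) :
    degreeOntoImage (fun a => f (A a)) = degreeOntoImage f := by
  rw [degreeOntoImage, degreeOntoImage, imageFunctionField_comp]
  conv_lhs => rw [← functionField_map A]
  exact IntermediateField.relfinrank_map_map _ _ _

/-- A linear substitution that preserves `f` fixes the function field of the image. -/
theorem substRat_eq_self {A : (Fin n → ℂ) ≃ₗ[ℂ] (Fin n → ℂ)} {f : (Fin n → ℂ) → V}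
    (hA : ∀ a, f (A a) = f a) {z : RatFun n} (hz : z ∈ imageFunctionField f) :
    substRat A z = z := by
  have hP : ∀ P ∈ linearSystem f, substEquiv A P = P := by
    rintro P ⟨φ, hφ⟩
    exact MvPolynomial.funext fun a => by rw [eval_substEquiv, hφ, hφ, hA]
  induction hz using IntermediateField.adjoin_induction with
  | mem z hz =>
    obtain ⟨P, hPf, Q, hQf, rfl⟩ := hz
    rw [map_div₀, substRat_toRatFun, substRat_toRatFun, hP P hPf, hP Q hQf]
  | algebraMap c => exact (substRat A).commutes c
  | add x y _ _ hx hy => rw [map_add, hx, hy]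
  | inv x _ hx => rw [map_inv₀, hx]
  | mul x y _ _ hx hy => rw [map_mul, hx, hy]

end Substitution

theorem degreeOntoImage_theta :
    degreeOntoImage theta = degreeOntoImage invariantQuartics := by
  rw [← degreeOntoImage_comp heisenbergCoord invariantQuartics, degreeOntoImage, degreeOntoImage,
    imageFunctionField, imageFunctionField, linearSystem_theta]

theorem imageFunctionField_le {n d : ℕ} {V : Type*} [AddCommGroup V] [Module ℂ V]
    {f : (Fin n → ℂ) → V} (hf : ∀ P ∈ linearSystem f, P.IsHomogeneous d) :
    imageFunctionField f ≤ functionField n := by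
  rw [imageFunctionField, IntermediateField.adjoin_le_iff]
  rintro _ ⟨P, hP, Q, hQ, rfl⟩
  have key : ∀ R ∈ linearSystem f, ∀ j,
      toRatFun R / toRatFun (MvPolynomial.X j) ^ d ∈ functionField n := by
    intro R hR j
    obtain ⟨hdeg, hexp⟩ := form_div_eq (P := MvPolynomial.X j) (k := d) (d := 1) (N := R)
      (by rw [one_mul]; exact hf R hR)
    rw [hexp]
    refine sum_mem fun m hm => mul_mem (IntermediateField.algebraMap_mem (functionField n) _) ?_
    rw [← (hdeg m hm).trans (one_mul d), ← Finset.prod_pow_eq_pow_sum, ← Finset.prod_div_distrib]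
    refine prod_mem fun i _ => ?_
    have hi : toRatFun (MvPolynomial.X i) / toRatFun (MvPolynomial.X j) ∈ functionField n :=
      IntermediateField.subset_adjoin _ _ ⟨i, j, rfl⟩
    rw [← div_pow]
    exact pow_mem hi _
  rcases isEmpty_or_nonempty (Fin n) with hn | ⟨⟨j⟩⟩
  · have : ∀ R : MvPolynomial (Fin n) ℂ, toRatFun R ∈ functionField n := by
      intro R
      rw [MvPolynomial.eq_C_of_isEmpty R]
      exact IntermediateField.algebraMap_mem (functionField n) _
    exact div_mem (this P) (this Q)
  · have hj := pow_ne_zero d (toRatFun_ne_zero (MvPolynomial.X_ne_zero (R := ℂ) j))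
    have : toRatFun P / toRatFun Q = (toRatFun P / toRatFun (MvPolynomial.X j) ^ d) /
        (toRatFun Q / toRatFun (MvPolynomial.X j) ^ d) := by
      rw [div_div_div_cancel_right₀ hj]
    rw [this]
    exact div_mem (key P hP j) (key Q hQ j)

/-! ### The degree is at most `16` -/

/-- Adjoining a root of a monic polynomial of degree two. -/
theorem finrank_adjoin_le_two {K E : Type*} [Field K] [Field E] [Algebra K E] {z : E} (c d : K)
    (h : z ^ 2 = algebraMap K E c * z + algebraMap K E d) :
    FiniteDimensional K (IntermediateField.adjoin K {z}) ∧
      Module.finrank K (IntermediateField.adjoin K {z}) ≤ 2 := by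
  have hdeg : (Polynomial.C c * Polynomial.X + Polynomial.C d).degree < ((2 : ℕ) : WithBot ℕ) :=
    lt_of_le_of_lt Polynomial.degree_linear_le (by norm_num)
  have hmonic := Polynomial.monic_X_pow_sub hdeg
  have hz : Polynomial.aeval z
      (Polynomial.X ^ 2 - (Polynomial.C c * Polynomial.X + Polynomial.C d)) = 0 := by
    simp [h]
  have hint : IsIntegral K z := ⟨_, hmonic, hz⟩
  refine ⟨IntermediateField.adjoin.finiteDimensional hint, ?_⟩
  rw [IntermediateField.adjoin.finrank hint]
  refine (Polynomial.natDegree_le_natDegree (minpoly.min K z hmonic hz)).trans ?_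
  exact Polynomial.natDegree_le_of_degree_le
    ((Polynomial.degree_sub_le _ _).trans (max_le (Polynomial.degree_X_pow_le 2) hdeg.le))

/-- The ratios of the coordinates are rational in the four elements `u₁ = ab / cd`,
`u₂ = ac / bd`, `z₁`, `z₂`, which are at most quadratic over the field of the invariants. -/
theorem div_mem_of_quadratic_elements {E : Type*} [Field E] (M : Subfield E) {a b c d : E}
    (ha : a ≠ 0) (hb : b ≠ 0) (hc : c ≠ 0) (hd : d ≠ 0)
    (h₁ : (a * b) ^ 2 - (c * d) ^ 2 ≠ 0) (h₂ : (a * c) ^ 2 - (b * d) ^ 2 ≠ 0)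
    (hs : a ^ 2 + b ^ 2 + c ^ 2 + d ^ 2 ≠ 0)
    (hA : (a ^ 4 + b ^ 4 + c ^ 4 + d ^ 4) / (a * b * c * d) ∈ M)
    (hB : (a ^ 2 * d ^ 2 + b ^ 2 * c ^ 2) / (a * b * c * d) ∈ M)
    (hu₁ : a * b / (c * d) ∈ M) (hu₂ : a * c / (b * d) ∈ M)
    (hz₁ : (a ^ 2 + b ^ 2 + c ^ 2 + d ^ 2) / (a * b + c * d) ∈ M)
    (hz₂ : (a ^ 2 + b ^ 2 + c ^ 2 + d ^ 2) / (a * c + b * d) ∈ M) :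
    a / d ∈ M ∧ b / d ∈ M ∧ c / d ∈ M := by
  have h₁' : a * b + c * d ≠ 0 := fun h => h₁ (by linear_combination (a * b - c * d) * h)
  have h₂' : a * c + b * d ≠ 0 := fun h => h₂ (by linear_combination (a * c - b * d) * h)
  have hm : a ^ 2 / d ^ 2 ∈ M := by
    convert mul_mem hu₁ hu₂ using 1
    field_simp
  have hn : b ^ 2 / c ^ 2 ∈ M := by
    convert div_mem hu₁ hu₂ using 1
    field_simp
  -- The third ratio `u₃ = ad / bc` is the solution of a linear equation over the other elements.
  have hu₃ : a * d / (b * c) ∈ M := by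
    have h := div_mem (sub_mem hA (mul_mem (add_mem hn (inv_mem hn)) hB))
      (sub_mem (add_mem hm (inv_mem hm)) (add_mem hn (inv_mem hn)))
    have hne : a ^ 2 / d ^ 2 + (a ^ 2 / d ^ 2)⁻¹ - (b ^ 2 / c ^ 2 + (b ^ 2 / c ^ 2)⁻¹) ≠ 0 := by
      have : a ^ 2 / d ^ 2 + (a ^ 2 / d ^ 2)⁻¹ - (b ^ 2 / c ^ 2 + (b ^ 2 / c ^ 2)⁻¹) =
          ((a * b) ^ 2 - (c * d) ^ 2) * ((a * c) ^ 2 - (b * d) ^ 2) / (a * b * c * d) ^ 2 := by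
        field_simp
        ring
      rw [this]
      exact div_ne_zero (mul_ne_zero h₁ h₂) (by positivity)
    convert h using 1
    rw [eq_div_iff hne]
    field_simp
    ring
  have hS : (a ^ 2 + b ^ 2 + c ^ 2 + d ^ 2) / d ^ 2 ∈ M := by
    have h := add_mem (add_mem (add_mem hm (div_mem hu₁ hu₃)) (div_mem hu₂ hu₃)) (one_mem M)
    convert h using 1
    field_simp
  have hc' : c / d ∈ M := by
    have h := div_mem hS (mul_mem hz₁ (add_mem hu₁ (one_mem M)))
    convert h using 1
    have : a * b / (c * d) + 1 = (a * b + c * d) / (c * d) := by field_simp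
    rw [this]
    field_simp
  have hb' : b / d ∈ M := by
    have h := div_mem hS (mul_mem hz₂ (add_mem hu₂ (one_mem M)))
    convert h using 1
    have : a * c / (b * d) + 1 = (a * c + b * d) / (b * d) := by field_simp
    rw [this]
    field_simp
  refine ⟨?_, hb', hc'⟩
  convert div_mem (mul_mem hu₁ hc') hb' using 1
  field_simp

theorem isHomogeneous_of_mem_linearSystem_invariantQuartics {P : MvPolynomial (Fin 4) ℂ}
    (hP : P ∈ linearSystem invariantQuartics) : P.IsHomogeneous 4 := by
  refine isHomogeneous_of_mem_linearSystem (fun φ => ?_) hP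
  refine ⟨∑ j, MvPolynomial.C (φ (Pi.single j 1)) * quarticPoly MvPolynomial.X j,
    MvPolynomial.IsHomogeneous.sum _ _ _ fun j _ => ?_, fun a => ?_⟩
  · have := (MvPolynomial.isHomogeneous_C (Fin 4) (φ (Pi.single j 1))).mul
      (quarticPoly_isHomogeneous (MvPolynomial.isHomogeneous_X ℂ) j)
    rwa [zero_add] at this
  · rw [LinearMap.pi_apply_eq_sum_univ φ, map_sum]
    refine Finset.sum_congr rfl fun j _ => ?_
    rw [map_mul, MvPolynomial.eval_C, eval_quarticPoly, smul_eq_mul, mul_comm]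
    simp only [MvPolynomial.eval_X]
    congr 2
    funext i
    simp [Pi.single_apply, eq_comm]

theorem imageFunctionField_invariantQuartics_le :
    imageFunctionField invariantQuartics ≤ functionField 4 :=
  imageFunctionField_le fun _ => isHomogeneous_of_mem_linearSystem_invariantQuartics

/-- A quotient of linear combinations of the invariants lies in the function field of the image. -/
theorem sum_div_sum_mem (v w : Fin 5 → ℂ) :
    toRatFun (∑ j, MvPolynomial.C (v j) * quarticPoly MvPolynomial.X j) /
      toRatFun (∑ j, MvPolynomial.C (w j) * quarticPoly MvPolynomial.X j) ∈
      imageFunctionField invariantQuartics := by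
  have h : ∀ v : Fin 5 → ℂ, (∑ j, MvPolynomial.C (v j) * quarticPoly MvPolynomial.X j) ∈
      linearSystem invariantQuartics := fun v =>
    ⟨∑ j, v j • LinearMap.proj j, fun a => by simp [eval_quarticPoly]⟩
  exact IntermediateField.subset_adjoin _ _ ⟨_, h v, _, h w, rfl⟩

theorem toRatFun_ne_zero_of_eval {n : ℕ} {P : MvPolynomial (Fin n) ℂ} (a : Fin n → ℂ)
    (h : MvPolynomial.eval a P ≠ 0) : toRatFun P ≠ 0 :=
  toRatFun_ne_zero fun hP => h (by rw [hP, map_zero])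

/-- The function field of `ℙ³` is contained in the compositum of four extensions of degree at most
two of the function field of the image. -/
theorem finrank_le_sixteen :
    FiniteDimensional (imageFunctionField invariantQuartics)
      (IntermediateField.extendScalars imageFunctionField_invariantQuartics_le) ∧
    Module.finrank (imageFunctionField invariantQuartics)
      (IntermediateField.extendScalars imageFunctionField_invariantQuartics_le) ≤ 16 := by
  set K := imageFunctionField invariantQuartics with hK
  set x : Fin 4 → RatFun 4 := fun i => toRatFun (MvPolynomial.X i) with hx
  have x₀ : x 0 ≠ 0 := toRatFun_ne_zero (MvPolynomial.X_ne_zero 0)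
  have x₁ : x 1 ≠ 0 := toRatFun_ne_zero (MvPolynomial.X_ne_zero 1)
  have x₂ : x 2 ≠ 0 := toRatFun_ne_zero (MvPolynomial.X_ne_zero 2)
  have x₃ : x 3 ≠ 0 := toRatFun_ne_zero (MvPolynomial.X_ne_zero 3)
  have h₁ : (x 0 * x 1) ^ 2 - (x 2 * x 3) ^ 2 ≠ 0 := by
    have := toRatFun_ne_zero_of_eval
      (P := (MvPolynomial.X 0 * MvPolynomial.X 1) ^ 2 - (MvPolynomial.X 2 * MvPolynomial.X 3) ^ 2)
      ![1, 1, 0, 0] (by simp)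
    simpa [x] using this
  have h₂ : (x 0 * x 2) ^ 2 - (x 1 * x 3) ^ 2 ≠ 0 := by
    have := toRatFun_ne_zero_of_eval
      (P := (MvPolynomial.X 0 * MvPolynomial.X 2) ^ 2 - (MvPolynomial.X 1 * MvPolynomial.X 3) ^ 2)
      ![1, 0, 1, 0] (by simp)
    simpa [x] using this
  have hs : x 0 ^ 2 + x 1 ^ 2 + x 2 ^ 2 + x 3 ^ 2 ≠ 0 := by
    have := toRatFun_ne_zero_of_eval (P := MvPolynomial.X 0 ^ 2 + MvPolynomial.X 1 ^ 2 +
      MvPolynomial.X 2 ^ 2 + MvPolynomial.X 3 ^ 2) ![1, 0, 0, 0] (by simp)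
    simpa [x] using this
  have h₁' : x 0 * x 1 + x 2 * x 3 ≠ 0 := fun h =>
    h₁ (by linear_combination (x 0 * x 1 - x 2 * x 3) * h)
  have h₂' : x 0 * x 2 + x 1 * x 3 ≠ 0 := fun h =>
    h₂ (by linear_combination (x 0 * x 2 - x 1 * x 3) * h)
  have hA : (x 0 ^ 4 + x 1 ^ 4 + x 2 ^ 4 + x 3 ^ 4) / (x 0 * x 1 * x 2 * x 3) ∈ K := by
    simpa [Fin.sum_univ_five, quarticPoly, x] using
      sum_div_sum_mem ![1, 0, 0, 0, 0] ![0, 1, 0, 0, 0]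
  have hB₁ : (x 0 ^ 2 * x 1 ^ 2 + x 2 ^ 2 * x 3 ^ 2) / (x 0 * x 1 * x 2 * x 3) ∈ K := by
    simpa [Fin.sum_univ_five, quarticPoly, x] using
      sum_div_sum_mem ![0, 0, 1, 0, 0] ![0, 1, 0, 0, 0]
  have hB₂ : (x 0 ^ 2 * x 2 ^ 2 + x 1 ^ 2 * x 3 ^ 2) / (x 0 * x 1 * x 2 * x 3) ∈ K := by
    simpa [Fin.sum_univ_five, quarticPoly, x] using
      sum_div_sum_mem ![0, 0, 0, 1, 0] ![0, 1, 0, 0, 0]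
  have hB₃ : (x 0 ^ 2 * x 3 ^ 2 + x 1 ^ 2 * x 2 ^ 2) / (x 0 * x 1 * x 2 * x 3) ∈ K := by
    simpa [Fin.sum_univ_five, quarticPoly, x] using
      sum_div_sum_mem ![0, 0, 0, 0, 1] ![0, 1, 0, 0, 0]
  have two : toRatFun (MvPolynomial.C 2 : MvPolynomial (Fin 4) ℂ) = 2 :=
    (congrArg _ (map_ofNat MvPolynomial.C 2)).trans (map_ofNat _ 2)
  -- In terms of the invariants `c₀, …, c₄`, this is `(c₀ + 2(c₂ + c₃ + c₄)) / (c₂ + 2c₁)`.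
  have hC₁ : ((x 0 ^ 2 + x 1 ^ 2 + x 2 ^ 2 + x 3 ^ 2) / (x 0 * x 1 + x 2 * x 3)) ^ 2 ∈ K := by
    have := sum_div_sum_mem ![1, 0, 2, 2, 2] ![0, 2, 1, 0, 0]
    convert this using 1
    rw [div_pow]
    congr 1 <;> simp [Fin.sum_univ_five, quarticPoly, x, two] <;> ring
  have hC₂ : ((x 0 ^ 2 + x 1 ^ 2 + x 2 ^ 2 + x 3 ^ 2) / (x 0 * x 2 + x 1 * x 3)) ^ 2 ∈ K := by
    have := sum_div_sum_mem ![1, 0, 2, 2, 2] ![0, 2, 0, 1, 0]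
    convert this using 1
    rw [div_pow]
    congr 1 <;> simp [Fin.sum_univ_five, quarticPoly, x, two] <;> ring
  have q₁ : (x 0 * x 1 / (x 2 * x 3)) ^ 2 = (x 0 ^ 2 * x 1 ^ 2 + x 2 ^ 2 * x 3 ^ 2) /
      (x 0 * x 1 * x 2 * x 3) * (x 0 * x 1 / (x 2 * x 3)) + -1 := by
    field_simp
    ring
  obtain ⟨f₁, r₁⟩ := finrank_adjoin_le_two (K := K) ⟨_, hB₁⟩ (-1)
    (q₁.trans (by rw [map_neg, map_one]; rfl))
  have q₂ : (x 0 * x 2 / (x 1 * x 3)) ^ 2 = (x 0 ^ 2 * x 2 ^ 2 + x 1 ^ 2 * x 3 ^ 2) /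
      (x 0 * x 1 * x 2 * x 3) * (x 0 * x 2 / (x 1 * x 3)) + -1 := by
    field_simp
    ring
  obtain ⟨f₂, r₂⟩ := finrank_adjoin_le_two (K := K) ⟨_, hB₂⟩ (-1)
    (q₂.trans (by rw [map_neg, map_one]; rfl))
  obtain ⟨f₃, r₃⟩ := finrank_adjoin_le_two (K := K)
    (z := (x 0 ^ 2 + x 1 ^ 2 + x 2 ^ 2 + x 3 ^ 2) / (x 0 * x 1 + x 2 * x 3)) 0 ⟨_, hC₁⟩ (by
      rw [map_zero, zero_mul, zero_add]; rfl)
  obtain ⟨f₄, r₄⟩ := finrank_adjoin_le_two (K := K)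
    (z := (x 0 ^ 2 + x 1 ^ 2 + x 2 ^ 2 + x 3 ^ 2) / (x 0 * x 2 + x 1 * x 3)) 0 ⟨_, hC₂⟩ (by
      rw [map_zero, zero_mul, zero_add]; rfl)
  set M₁ := IntermediateField.adjoin K {x 0 * x 1 / (x 2 * x 3)} with hM₁
  set M₂ := IntermediateField.adjoin K {x 0 * x 2 / (x 1 * x 3)} with hM₂
  set M₃ := IntermediateField.adjoin K
    {(x 0 ^ 2 + x 1 ^ 2 + x 2 ^ 2 + x 3 ^ 2) / (x 0 * x 1 + x 2 * x 3)} with hM₃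
  set M₄ := IntermediateField.adjoin K
    {(x 0 ^ 2 + x 1 ^ 2 + x 2 ^ 2 + x 3 ^ 2) / (x 0 * x 2 + x 1 * x 3)} with hM₄
  have hKM : ∀ z ∈ K, z ∈ (M₁ ⊔ M₂) ⊔ (M₃ ⊔ M₄) := fun z hz =>
    IntermediateField.algebraMap_mem _ (⟨z, hz⟩ : K)
  have hmem := div_mem_of_quadratic_elements ((M₁ ⊔ M₂) ⊔ (M₃ ⊔ M₄)).toSubfield x₀ x₁ x₂ x₃ h₁ h₂ hs
    (hKM _ hA) (hKM _ hB₃)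
    ((le_sup_left.trans le_sup_left : M₁ ≤ _) (IntermediateField.mem_adjoin_simple_self K _))
    ((le_sup_right.trans le_sup_left : M₂ ≤ _) (IntermediateField.mem_adjoin_simple_self K _))
    ((le_sup_left.trans le_sup_right : M₃ ≤ _) (IntermediateField.mem_adjoin_simple_self K _))
    ((le_sup_right.trans le_sup_right : M₄ ≤ _) (IntermediateField.mem_adjoin_simple_self K _))
  have hmem' : ∀ i, x i / x 3 ∈ (M₁ ⊔ M₂) ⊔ (M₃ ⊔ M₄) := by
    intro i
    fin_cases i
    · exact hmem.1
    · exact hmem.2.1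
    · exact hmem.2.2
    · change x 3 / x 3 ∈ _
      rw [div_self x₃]
      exact one_mem _
  have hle : IntermediateField.extendScalars imageFunctionField_invariantQuartics_le ≤
      (M₁ ⊔ M₂) ⊔ (M₃ ⊔ M₄) := by
    rw [IntermediateField.extendScalars_le_iff, functionField, IntermediateField.adjoin_le_iff]
    rintro _ ⟨i, j, rfl⟩
    have := div_mem (hmem' i) (hmem' j)
    rwa [div_div_div_cancel_right₀ x₃] at this
  refine ⟨FiniteDimensional.of_injective (IntermediateField.inclusion hle).toLinearMap
    (IntermediateField.inclusion hle).injective, ?_⟩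
  calc _ ≤ Module.finrank K ↥((M₁ ⊔ M₂) ⊔ (M₃ ⊔ M₄)) := LinearMap.finrank_le_finrank_of_injective
        (f := (IntermediateField.inclusion hle).toLinearMap)
        (IntermediateField.inclusion hle).injective
    _ ≤ _ := IntermediateField.finrank_sup_le _ _
    _ ≤ (2 * 2) * (2 * 2) := by
        gcongr
        · exact (IntermediateField.finrank_sup_le _ _).trans (Nat.mul_le_mul r₁ r₂)
        · exact (IntermediateField.finrank_sup_le _ _).trans (Nat.mul_le_mul r₃ r₄)
    _ = 16 := rfl

/-! ### The Heisenberg group and the degree -/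

/-- The character `i ↦ (-1)^{⟨t, i⟩}` of `(ℤ/2)²`; the elements of `(ℤ/2)²` are the binary
expansions of `0, 1, 2, 3`. -/
def signChar (t i : Fin 4) : ℤ := if (t &&& i) = 1 ∨ (t &&& i) = 2 then -1 else 1

theorem signChar_mul_self (t i : Fin 4) : (signChar t i : ℂ) * signChar t i = 1 := by
  have : signChar t i * signChar t i = 1 := by revert t i; decide
  exact_mod_cast this

/-- The element of the Heisenberg group of level two that translates the indices by `s ∈ (ℤ/2)²`
and changes the signs by the character `t`. -/
def heisenbergMap (p : Fin 4 × Fin 4) : (Fin 4 → ℂ) ≃ₗ[ℂ] (Fin 4 → ℂ) where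
  toFun b i := signChar p.2 i * b (i ^^^ p.1)
  invFun b i := signChar p.2 (i ^^^ p.1) * b (i ^^^ p.1)
  map_add' b b' := by
    funext i
    simp [mul_add]
  map_smul' c b := by
    funext i
    simp only [Pi.smul_apply, smul_eq_mul, RingHom.id_apply]
    ring
  left_inv b := by
    funext i
    have h : i ^^^ p.1 ^^^ p.1 = i := by revert p i; decide
    simp only [h]
    rw [← mul_assoc, signChar_mul_self, one_mul]
  right_inv b := by
    funext i
    have h : i ^^^ p.1 ^^^ p.1 = i := by revert p i; decide
    simp only [h]
    rw [← mul_assoc, signChar_mul_self, one_mul]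

theorem invariantQuartics_heisenbergMap (p : Fin 4 × Fin 4) (b : Fin 4 → ℂ) :
    invariantQuartics (heisenbergMap p b) = invariantQuartics b := by
  obtain ⟨s, t⟩ := p
  fin_cases s <;> fin_cases t <;>
    (funext j; fin_cases j <;> simp +decide [invariantQuartics, heisenbergMap, signChar] <;> ring)

/-- A linear substitution that preserves the invariants, as an automorphism over the function field
of the image. -/
def heisenbergAut (p : Fin 4 × Fin 4) :
    RatFun 4 →ₐ[imageFunctionField invariantQuartics] RatFun 4 where
  __ := (substRat (heisenbergMap p)).toRingHom
  commutes' z := substRat_eq_self (invariantQuartics_heisenbergMap p) z.2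

/-- The point `(1, 2, 3, 5)` separates the elements of the Heisenberg group modulo scalars. -/
theorem eq_of_heisenbergMap {p q : Fin 4 × Fin 4}
    (h : ∀ (i : Fin 4) (b : Fin 4 → ℂ), heisenbergMap p b i * heisenbergMap q b 0 =
      heisenbergMap q b i * heisenbergMap p b 0) : p = q := by
  have h' : ∀ i, signChar p.2 i * ![1, 2, 3, 5] (i ^^^ p.1) *
      (signChar q.2 0 * ![1, 2, 3, 5] (0 ^^^ q.1)) =
      signChar q.2 i * ![1, 2, 3, 5] (i ^^^ q.1) *
      (signChar p.2 0 * ![1, 2, 3, 5] (0 ^^^ p.1)) := by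
    intro i
    have hi := h i fun j => ((![1, 2, 3, 5] j : ℤ) : ℂ)
    simp only [heisenbergMap, LinearEquiv.coe_mk, LinearMap.coe_mk, AddHom.coe_mk] at hi
    exact_mod_cast hi
  clear h
  revert p q
  decide

theorem heisenbergAut_injective {p q : Fin 4 × Fin 4}
    (h : ∀ z ∈ functionField 4, heisenbergAut p z = heisenbergAut q z) : p = q := by
  refine eq_of_heisenbergMap fun i b => ?_
  have hz := h (toRatFun (MvPolynomial.X i) / toRatFun (MvPolynomial.X 0))
    (IntermediateField.subset_adjoin _ _ ⟨i, 0, rfl⟩)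
  change substRat (heisenbergMap p) _ = substRat (heisenbergMap q) _ at hz
  have hne : ∀ r : Fin 4 × Fin 4, substRat (heisenbergMap r) (toRatFun (MvPolynomial.X 0)) ≠ 0 :=
    fun r => (map_ne_zero _).mpr (toRatFun_ne_zero (MvPolynomial.X_ne_zero 0))
  rw [map_div₀, map_div₀, div_eq_div_iff (hne p) (hne q)] at hz
  simp only [substRat_toRatFun, toRatFun, ← map_mul] at hz
  have := congrArg (MvPolynomial.eval b)
    (IsFractionRing.injective (MvPolynomial (Fin 4) ℂ) (RatFun 4) hz)
  simpa only [map_mul, eval_substEquiv, MvPolynomial.eval_X] using this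

/-- The sixteen elements of the Heisenberg group modulo scalars give as many embeddings of the
function field over the function field of the image, so that the upper bound for the degree is
attained. -/
theorem degreeOntoImage_invariantQuartics : degreeOntoImage invariantQuartics = 16 := by
  rw [degreeOntoImage,
    IntermediateField.relfinrank_eq_finrank_of_le imageFunctionField_invariantQuartics_le]
  obtain ⟨hfin, hle⟩ := finrank_le_sixteen
  refine le_antisymm hle ?_
  let F := IntermediateField.extendScalars imageFunctionField_invariantQuartics_le
  let σ : Fin 4 × Fin 4 → (F →ₐ[imageFunctionField invariantQuartics] RatFun 4) :=
    fun p => (heisenbergAut p).comp F.val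
  have hσ : Function.Injective σ := fun p q h =>
    heisenbergAut_injective fun z hz => congrArg (fun τ => τ (⟨z, hz⟩ : F)) h
  have : Module.Free (imageFunctionField invariantQuartics) F := Module.Free.of_divisionRing _ _
  have : Module.Finite (imageFunctionField invariantQuartics) F := hfin
  calc 16 = Nat.card (Fin 4 × Fin 4) := by simp
    _ ≤ Nat.card (F →ₐ[imageFunctionField invariantQuartics] RatFun 4) :=
        Nat.card_le_card_of_injective σ hσ
    _ ≤ Module.finrank _ F := card_algHom_le_finrank _ _ _

/-! ### The morphism of projective spaces -/

theorem theta_ne_zero {a : Fin 4 → ℂ} (ha : a ≠ 0) : theta a ≠ 0 := fun h => by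
  have := identU5_theta a
  rw [h, map_zero] at this
  exact igusaMap_ne_zero (heisenbergCoord.map_ne_zero_iff.mpr ha) this.symm

theorem theta_smul (c : ℂ) (a : Fin 4 → ℂ) : theta (c • a) = c ^ 4 • theta a :=
  identU5.injective (by
    rw [identU5_theta, map_smul, igusaMap_smul, map_smul, identU5_theta])

/-- The map `ℙ(𝔠) → ℙ(U₅)` induced by `theta`. -/
def projTheta (p : Projectivization ℂ (Fin 4 → ℂ)) : Projectivization ℂ U5 :=
  Projectivization.mk ℂ (theta p.rep) (theta_ne_zero p.rep_nonzero)

theorem projTheta_mk {a : Fin 4 → ℂ} (ha : a ≠ 0) :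
    projTheta (Projectivization.mk ℂ a ha) =
      Projectivization.mk ℂ (theta a) (theta_ne_zero ha) := by
  obtain ⟨c, hc⟩ := Projectivization.exists_smul_eq_mk_rep ℂ a ha
  refine (Projectivization.mk_eq_mk_iff' ℂ _ _ _ _).mpr ⟨(c : ℂ) ^ 4, ?_⟩
  rw [← theta_smul, ← hc]
  rfl

theorem map_identU5_projTheta (p : Projectivization ℂ (Fin 4 → ℂ)) :
    Projectivization.map identU5.toLinearMap identU5.injective (projTheta p) =
      Projectivization.mk ℂ (igusaMap (heisenbergCoord p.rep))
        (igusaMap_ne_zero (heisenbergCoord.map_ne_zero_iff.mpr p.rep_nonzero)) := by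
  rw [projTheta, Projectivization.map_mk]
  simp only [LinearEquiv.coe_coe, identU5_theta]

theorem eval_crForm_smul (c : ℂ) (t : sumZero) :
    MvPolynomial.eval (c • t).1 crForm = c ^ 4 * MvPolynomial.eval t.1 crForm := by
  rw [eval_crForm, eval_crForm]
  simp only [Submodule.coe_smul, Pi.smul_apply, smul_eq_mul, mul_pow, ← Finset.mul_sum]
  ring

theorem mk_mem_CR4 {t : sumZero} (ht : t ≠ 0) :
    Projectivization.mk ℂ t ht ∈ CR4 ↔ MvPolynomial.eval t.1 crForm = 0 := by
  obtain ⟨c, hc⟩ := Projectivization.exists_smul_eq_mk_rep ℂ t ht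
  change MvPolynomial.eval (Projectivization.mk ℂ t ht).rep.1 crForm = 0 ↔ _
  rw [← hc, Units.smul_def, eval_crForm_smul, mul_eq_zero, or_iff_right (pow_ne_zero 4 c.ne_zero)]

theorem submodule_mk_le {V : Type*} [AddCommGroup V] [Module ℂ V] {v : V} (hv : v ≠ 0)
    (S : Submodule ℂ V) : (Projectivization.mk ℂ v hv).submodule ≤ S ↔ v ∈ S := by
  rw [Projectivization.submodule_mk, Submodule.span_singleton_le_iff_mem]

theorem submodule_le_iff {V : Type*} [AddCommGroup V] [Module ℂ V] (p : Projectivization ℂ V)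
    (S : Submodule ℂ V) : p.submodule ≤ S ↔ p.rep ∈ S := by
  rw [Projectivization.submodule_eq, Submodule.span_singleton_le_iff_mem]

/-- The image of `ℙ(𝔠)` is the Igusa quartic. -/
theorem image_range_projTheta :
    Projectivization.map identU5.toLinearMap identU5.injective '' Set.range projTheta = CR4 := by
  ext t
  constructor
  · rintro ⟨_, ⟨p, rfl⟩, rfl⟩
    rw [map_identU5_projTheta, mk_mem_CR4]
    exact eval_crForm_igusaMap _
  · intro ht
    obtain ⟨b, k, hk, hb⟩ := exists_igusaMap ht
    obtain ⟨a, rfl⟩ := heisenbergCoord.surjective b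
    have ha : a ≠ 0 := by
      rintro rfl
      have h0 : igusaMap 0 = 0 := by
        have := igusaMap_smul 0 0
        rwa [smul_zero, zero_pow four_ne_zero, zero_smul] at this
      rw [map_zero, h0] at hb
      exact smul_ne_zero hk t.rep_nonzero hb.symm
    refine ⟨_, ⟨Projectivization.mk ℂ a ha, rfl⟩, ?_⟩
    rw [projTheta_mk, Projectivization.map_mk, ← t.mk_rep, Projectivization.mk_eq_mk_iff']
    exact ⟨k, by rw [LinearEquiv.coe_coe, identU5_theta, hb]⟩

theorem mem_singularCR4_iff (p : Projectivization ℂ sumZero) :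
    p ∈ singularCR4 ↔ ∃ k, p.submodule ≤ synthemeLine k := by
  simp only [submodule_le_iff]
  exact singular_iff

theorem isUnionOfLines_singularCR4 : IsUnionOfLines 15 singularCR4 := by
  classical
  refine ⟨Finset.univ.image synthemeLine, ?_, ?_, ?_⟩
  · rw [Finset.card_image_of_injective _ synthemeLine_injective, Finset.card_univ,
      Fintype.card_fin]
  · intro S hS
    obtain ⟨k, -, rfl⟩ := Finset.mem_image.mp hS
    exact finrank_synthemeLine k
  · ext p
    simp [mem_singularCR4_iff]

theorem isUnionOfLines_preimage : IsUnionOfLines 30 (projTheta ⁻¹'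
    (Projectivization.map identU5.toLinearMap identU5.injective ⁻¹' singularCR4)) := by
  classical
  let line : Fin 15 × Fin 2 → Submodule ℂ (Fin 4 → ℂ) := fun r =>
    (edgeLine r.1 r.2).comap heisenbergCoord.toLinearMap
  have hline : Function.Injective line :=
    (Submodule.comap_injective_of_surjective heisenbergCoord.surjective).comp edgeLine_injective
  refine ⟨Finset.univ.image line, ?_, ?_, ?_⟩
  · rw [Finset.card_image_of_injective _ hline, Finset.card_univ]
    rfl
  · intro S hS
    obtain ⟨r, -, rfl⟩ := Finset.mem_image.mp hS
    rw [← finrank_edgeLine r.1 r.2]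
    exact (heisenbergCoord.submoduleMap _).finrank_eq.trans
      (by rw [Submodule.map_comap_eq_of_surjective heisenbergCoord.surjective])
  · ext p
    rw [Set.mem_preimage, Set.mem_preimage, map_identU5_projTheta, mem_singularCR4_iff]
    simp only [submodule_mk_le, igusaMap_mem_synthemeLine_iff, Set.mem_iUnion]
    constructor
    · rintro ⟨k, h | h⟩
      · exact ⟨_, Finset.mem_image_of_mem line (Finset.mem_univ (k, 0)),
          (submodule_le_iff p _).mpr h⟩
      · exact ⟨_, Finset.mem_image_of_mem line (Finset.mem_univ (k, 1)),
          (submodule_le_iff p _).mpr h⟩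
    · rintro ⟨S, hS, h⟩
      obtain ⟨⟨k, s⟩, -, rfl⟩ := Finset.mem_image.mp hS
      have h' : heisenbergCoord p.rep ∈ edgeLine k s := (submodule_le_iff p _).mp h
      refine ⟨k, ?_⟩
      fin_cases s
      · exact Or.inl h'
      · exact Or.inr h'

end SpinorKummer

end

theorem mainTheorem2 :
    Module.finrank ℂ SpinorKummer.U5 = 5 ∧
    SpinorKummer.IsFiniteMorphism 4 SpinorKummer.theta ∧
    SpinorKummer.IsEquivariant SpinorKummer.littleWeylGroup SpinorKummer.theta ∧
    SpinorKummer.IsEquivariant SpinorKummer.reflectionGroup SpinorKummer.theta ∧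
    SpinorKummer.degreeOntoImage SpinorKummer.theta = 16 ∧
    ∃ Θ : Projectivization ℂ (Fin 4 → ℂ) → Projectivization ℂ SpinorKummer.U5,
      (∀ (a : Fin 4 → ℂ) (ha : a ≠ 0), ∃ h : SpinorKummer.theta a ≠ 0,
        Θ (Projectivization.mk ℂ a ha) = Projectivization.mk ℂ (SpinorKummer.theta a) h) ∧
      ∃ L : SpinorKummer.U5 ≃ₗ[ℂ] SpinorKummer.sumZero,
        Projectivization.map L.toLinearMap L.injective '' Set.range Θ = SpinorKummer.CR4 ∧
        SpinorKummer.IsUnionOfLines 15 SpinorKummer.singularCR4 ∧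
        SpinorKummer.IsUnionOfLines 30
          (Θ ⁻¹' (Projectivization.map L.toLinearMap L.injective ⁻¹'
            SpinorKummer.singularCR4)) :=
  ⟨SpinorKummer.finrank_U5, SpinorKummer.isFiniteMorphism_theta,
    SpinorKummer.isEquivariant_littleWeylGroup, SpinorKummer.isEquivariant_reflectionGroup,
    SpinorKummer.degreeOntoImage_theta.trans SpinorKummer.degreeOntoImage_invariantQuartics,
    SpinorKummer.projTheta,
    fun _ ha => ⟨SpinorKummer.theta_ne_zero ha, SpinorKummer.projTheta_mk ha⟩,
    SpinorKummer.identU5, SpinorKummer.image_range_projTheta,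
    SpinorKummer.isUnionOfLines_singularCR4, SpinorKummer.isUnionOfLines_preimage⟩
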